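/- Let $n>3$ and let $M^n$ be a closed (compact, without boundary) connected smooth Riemannian manifold of dimension $n$ with scalar curvature $R_M$ and Levi-Civita connection $\nabla$. Let $\mathfrak a$ be a smooth symmetric $(0,2)$ tensor field on $M^n$, and let $\mathcal A$ be its dual $(1,1)$ tensor field, i.e. $\langle \mathcal A v,w\rangle=\mathfrak a(v,w)$ for all tangent vectors $v,w$ at the same point. Suppose that 1. $R_M\ge 0$ on $M^n$; 2. $\mathfrak a$ is Codazzian, i.e. $(\nabla_X\mathfrak a)(Y,Z)=(\nabla_Y\mathfrak a)(X,Z)$ for all vector fields $X,Y,Z$; 3. for each $k=1,\dots,n-1$ the function $\operatorname{tr}(\mathcal A^k)$ is constant on $M^n$. Then $\operatorname{tr}(\mathcal A^n)$ is constant on $M^n$, and the eigenvalues of $\mathcal A$ are constant: there are real numbers $\mu_1,\dots,\mu_n$ which are the eigenvalues of $\mathcal A$, counted with multiplicity, at every point of $M^n$. If moreover $\mathcal A$ has $n$ distinct eigenvalues at some point of $M^n$, then $R_M\equiv 0$ on $M^n$. -/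

import Mathlib

open Bundle Manifold
open scoped ContDiff Topology

namespace RiemannianGeometry

noncomputable section

/-! ### Metric duals -/

/-- The endomorphism `B♯` of a Euclidean vector space that is metrically dual to the bilinear form
`B`, that is, `⟪B♯ v, w⟫ = B v w` for all `v`, `w`. -/
def sharp {V : Type*} [NormedAddCommGroup V] [InnerProductSpace ℝ V] [FiniteDimensional ℝ V]
    (B : V →L[ℝ] V →L[ℝ] ℝ) : V →L[ℝ] V :=
  haveI : CompleteSpace V := FiniteDimensional.complete ℝ V
  LinearMap.toContinuousLinearMap
    { toFun := fun v ↦ (InnerProductSpace.toDual ℝ V).symm (B v)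
      map_add' := by simp
      map_smul' := by simp }

lemma inner_sharp {V : Type*} [NormedAddCommGroup V] [InnerProductSpace ℝ V]
    [FiniteDimensional ℝ V] (B : V →L[ℝ] V →L[ℝ] ℝ) (v w : V) :
    inner ℝ (sharp B v) w = B v w := by
  have : CompleteSpace V := FiniteDimensional.complete ℝ V
  simp [sharp]

/-! ### The Levi-Civita connection

`M` is a smooth manifold whose tangent bundle carries a smooth Riemannian metric. -/

variable {E : Type*} [NormedAddCommGroup E] [NormedSpace ℝ E] [FiniteDimensional ℝ E]
  [CompleteSpace E]
  {H : Type*} [TopologicalSpace H] {I : ModelWithCorners ℝ E H}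
  {M : Type*} [TopologicalSpace M] [ChartedSpace H M] [IsManifold I ∞ M]
  [RiemannianBundle (fun x : M ↦ TangentSpace I x)]
  [IsContMDiffRiemannianBundle I ∞ E (fun x : M ↦ TangentSpace I x)]

instance instFiniteDimensionalTangentSpace (x : M) : FiniteDimensional ℝ (TangentSpace I x) :=
  inferInstanceAs (FiniteDimensional ℝ E)

set_option linter.unusedSectionVars false in
lemma mdiffAt_inner {X Y : Π x : M, TangentSpace I x} {x : M}
    (hX : MDiffAt (T% X) x) (hY : MDiffAt (T% Y) x) :
    MDiffAt (fun y ↦ inner ℝ (X y) (Y y)) x :=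
  MDifferentiableAt.inner_bundle (IB := I) (F := E) (E := fun x : M ↦ TangentSpace I x)
    (b := fun y ↦ y) hX hY

variable (I) in
/-- The right-hand side of the Koszul formula: one half of
`X⟪Y, Z⟫ + Y⟪X, Z⟫ - Z⟪X, Y⟫ + ⟪[X, Y], Z⟫ - ⟪[X, Z], Y⟫ - ⟪[Y, Z], X⟫` at the point `x`. -/
def koszul (X Y Z : Π x : M, TangentSpace I x) (x : M) : ℝ :=
  (1 / 2) * (mvfderiv I (fun y ↦ inner ℝ (Y y) (Z y)) x (X x)
    + mvfderiv I (fun y ↦ inner ℝ (X y) (Z y)) x (Y x)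
    - mvfderiv I (fun y ↦ inner ℝ (X y) (Y y)) x (Z x)
    + inner ℝ (VectorField.mlieBracket I X Y x) (Z x)
    - inner ℝ (VectorField.mlieBracket I X Z x) (Y x)
    - inner ℝ (VectorField.mlieBracket I Y Z x) (X x))

lemma tensorialAt_koszul_left {Y Z : Π x : M, TangentSpace I x} {x : M}
    (hY : MDiffAt (T% Y) x) (hZ : MDiffAt (T% Z) x) :
    TensorialAt I E (koszul I · Y Z x) x where
  smul {f X} hf hX := by
    have h1 := mdiffAt_inner hX hZ
    have h2 := mdiffAt_inner hX hY
    simp [koszul, inner_smul_left, VectorField.mlieBracket_smul_left hf hX, mvfderiv_fun_mul hf h1,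
      mvfderiv_fun_mul hf h2, inner_add_left, inner_smul_right]
    ring
  add {X X'} hX hX' := by
    simp [koszul, inner_add_left, VectorField.mlieBracket_add_left hX hX',
      mvfderiv_fun_add (mdiffAt_inner hX hZ) (mdiffAt_inner hX' hZ),
      mvfderiv_fun_add (mdiffAt_inner hX hY) (mdiffAt_inner hX' hY), inner_add_right]
    ring

lemma tensorialAt_koszul_right {X Y : Π x : M, TangentSpace I x} {x : M}
    (hX : MDiffAt (T% X) x) (hY : MDiffAt (T% Y) x) :
    TensorialAt I E (koszul I X Y · x) x where
  smul {f Z} hf hZ := by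
    have h1 := mdiffAt_inner hX hZ
    have h2 := mdiffAt_inner hY hZ
    simp [koszul, inner_smul_left, VectorField.mlieBracket_smul_right hf hZ, mvfderiv_fun_mul hf h1,
      mvfderiv_fun_mul hf h2, inner_add_left, inner_smul_right]
    rw [real_inner_comm (Z x) (Y x), real_inner_comm (Z x) (X x)]
    ring
  add {Z Z'} hZ hZ' := by
    simp [koszul, inner_add_left, VectorField.mlieBracket_add_right hZ hZ',
      mvfderiv_fun_add (mdiffAt_inner hX hZ) (mdiffAt_inner hX hZ'),
      mvfderiv_fun_add (mdiffAt_inner hY hZ) (mdiffAt_inner hY hZ'), inner_add_right]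
    ring

open Classical in
/-- The endomorphism `v ↦ ∇_v Y` of `T_x M`, defined by the Koszul formula when the vector field
`Y` is differentiable at `x` (and by the junk value `0` otherwise). -/
def leviCivitaAux (Y : Π x : M, TangentSpace I x) (x : M) :
    TangentSpace I x →L[ℝ] TangentSpace I x :=
  if hY : MDiffAt (T% Y) x then
    sharp (TensorialAt.mkHom₂ (I := I) (F := E) (F' := E)
      (fun X Z : Π x : M, TangentSpace I x ↦ koszul I X Y Z x) x
      (fun _ hZ ↦ tensorialAt_koszul_left hY hZ)
      (fun _ hX ↦ tensorialAt_koszul_right hX hY))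
  else 0

lemma inner_leviCivitaAux {X Y Z : Π x : M, TangentSpace I x} {x : M} (hX : MDiffAt (T% X) x)
    (hY : MDiffAt (T% Y) x) (hZ : MDiffAt (T% Z) x) :
    inner ℝ (leviCivitaAux Y x (X x)) (Z x) = koszul I X Y Z x := by
  rw [leviCivitaAux, dif_pos hY, inner_sharp]
  exact TensorialAt.mkHom₂_apply (I := I) (F := E) (F' := E) _ _ hX hZ

set_option linter.unusedSectionVars false in
lemma clm_ext_inner {x : M} {S T : TangentSpace I x →L[ℝ] TangentSpace I x}
    (h : ∀ X Z : Π x : M, TangentSpace I x, MDiffAt (T% X) x → MDiffAt (T% Z) x →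
      inner ℝ (S (X x)) (Z x) = inner ℝ (T (X x)) (Z x)) : S = T := by
  ext1 v
  refine ext_inner_right ℝ fun w ↦ ?_
  simpa using h (FiberBundle.extend E v) (FiberBundle.extend E w)
    (FiberBundle.mdifferentiableAt_extend ..) (FiberBundle.mdifferentiableAt_extend ..)

variable (I M) in
/-- The Levi-Civita connection of a Riemannian manifold; `leviCivita I M Y x v` is `∇_v Y`. -/
def leviCivita : CovariantDerivative I E (fun x : M ↦ TangentSpace I x) where
  toFun := leviCivitaAux
  isCovariantDerivativeOnUniv :=
    { add := by
        intro Y Y' x hY hY' _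
        refine clm_ext_inner fun X Z hX hZ ↦ ?_
        have hadd : MDiffAt (T% (Y + Y')) x := mdifferentiableAt_add_section hY hY'
        rw [inner_leviCivitaAux hX hadd hZ, add_apply, inner_add_left,
          inner_leviCivitaAux hX hY hZ, inner_leviCivitaAux hX hY' hZ]
        simp [koszul, inner_add_left, VectorField.mlieBracket_add_left hY hY',
          VectorField.mlieBracket_add_right hY hY',
          mvfderiv_fun_add (mdiffAt_inner hX hY) (mdiffAt_inner hX hY'),
          mvfderiv_fun_add (mdiffAt_inner hY hZ) (mdiffAt_inner hY' hZ), inner_add_right]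
        ring
      leibniz := by
        intro Y f x hY hf _
        refine clm_ext_inner fun X Z hX hZ ↦ ?_
        have hsmul : MDiffAt (T% (f • Y)) x := hf.smul_section hY
        rw [inner_leviCivitaAux hX hsmul hZ, add_apply, inner_add_left,
          smul_apply, inner_smul_left, inner_leviCivitaAux hX hY hZ]
        have h1 := mdiffAt_inner hX hY
        have h2 := mdiffAt_inner hY hZ
        simp [koszul, inner_smul_left, VectorField.mlieBracket_smul_right hf hY,
          VectorField.mlieBracket_smul_left hf hY, mvfderiv_fun_mul hf h1,
          mvfderiv_fun_mul hf h2, inner_add_left, inner_smul_right]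
        rw [real_inner_comm (Y x) (X x)]
        ring }

/-- The Koszul formula. -/
lemma inner_leviCivita {X Y Z : Π x : M, TangentSpace I x} {x : M} (hX : MDiffAt (T% X) x)
    (hY : MDiffAt (T% Y) x) (hZ : MDiffAt (T% Z) x) :
    inner ℝ (leviCivita I M Y x (X x)) (Z x) = koszul I X Y Z x :=
  inner_leviCivitaAux hX hY hZ

/-- The Levi-Civita connection is torsion-free. -/
theorem torsion_leviCivita : (leviCivita I M).torsion = 0 := by
  rw [CovariantDerivative.torsion_eq_zero_iff]
  intro X Y x hX hY
  refine ext_inner_right ℝ fun w ↦ ?_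
  have hZ : MDiffAt (T% (FiberBundle.extend E w : Π x : M, TangentSpace I x)) x :=
    FiberBundle.mdifferentiableAt_extend ..
  have h1 := inner_leviCivita hX hY hZ
  have h2 := inner_leviCivita hY hX hZ
  rw [FiberBundle.extend_apply_self] at h1 h2
  rw [inner_sub_left, h1, h2]
  simp only [koszul, VectorField.mlieBracket_swap_apply (V := Y) (W := X), inner_neg_left,
    real_inner_comm, FiberBundle.extend_apply_self]
  ring

/-- The Levi-Civita connection is compatible with the metric. -/
theorem mvfderiv_inner_leviCivita {X Y Z : Π x : M, TangentSpace I x} {x : M}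
    (hX : MDiffAt (T% X) x) (hY : MDiffAt (T% Y) x) (hZ : MDiffAt (T% Z) x) :
    mvfderiv I (fun y ↦ inner ℝ (Y y) (Z y)) x (X x) =
      inner ℝ (leviCivita I M Y x (X x)) (Z x) + inner ℝ (Y x) (leviCivita I M Z x (X x)) := by
  rw [real_inner_comm (leviCivita I M Z x (X x)), inner_leviCivita hX hY hZ,
    inner_leviCivita hX hZ hY]
  simp only [koszul, VectorField.mlieBracket_swap_apply (V := Z) (W := Y), inner_neg_left]
  simp only [real_inner_comm]
  ring

/-! ### Curvature -/

/-- The curvature `R(X, Y) Z = ∇_X ∇_Y Z - ∇_Y ∇_X Z - ∇_[X, Y] Z`. -/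
def curvature (X Y Z : Π x : M, TangentSpace I x) (x : M) : TangentSpace I x :=
  leviCivita I M (fun y ↦ leviCivita I M Z y (Y y)) x (X x)
    - leviCivita I M (fun y ↦ leviCivita I M Z y (X y)) x (Y x)
    - leviCivita I M Z x (VectorField.mlieBracket I X Y x)

/-- The curvature tensor `R_x(u, v) w`, computed with extensions of the tangent vectors
`u`, `v`, `w` to vector fields which are smooth near `x`. -/
def curvatureAt (x : M) (u v w : TangentSpace I x) : TangentSpace I x :=
  curvature (FiberBundle.extend E u) (FiberBundle.extend E v) (FiberBundle.extend E w) x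

variable (I) in
/-- The scalar curvature `∑ i, ∑ j, ⟪R(eᵢ, eⱼ) eⱼ, eᵢ⟫`, where `e` is an orthonormal basis of the
tangent space. -/
def scalarCurvature (x : M) : ℝ :=
  let e := stdOrthonormalBasis ℝ (TangentSpace I x)
  ∑ i, ∑ j, inner ℝ (curvatureAt x (e i) (e j) (e j)) (e i)

/-! ### Tensor fields of type `(0, 2)` -/

/-- Smoothness of a field of bilinear forms on the tangent spaces. -/
def IsSmoothTensor (a : Π x : M, TangentSpace I x →L[ℝ] TangentSpace I x →L[ℝ] ℝ) : Prop :=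
  ContMDiff I (I.prod 𝓘(ℝ, E →L[ℝ] E →L[ℝ] ℝ)) ∞
    (fun x ↦ TotalSpace.mk' (E →L[ℝ] E →L[ℝ] ℝ)
      (E := fun x : M ↦ TangentSpace I x →L[ℝ] TangentSpace I x →L[ℝ] ℝ) x (a x))

/-- The covariant derivative
`(∇_X a)(Y, Z) = X(a(Y, Z)) - a(∇_X Y, Z) - a(Y, ∇_X Z)` of a `(0, 2)` tensor field. -/
def covDerivTensor (a : Π x : M, TangentSpace I x →L[ℝ] TangentSpace I x →L[ℝ] ℝ)
    (X Y Z : Π x : M, TangentSpace I x) (x : M) : ℝ :=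
  mvfderiv I (fun y ↦ a y (Y y) (Z y)) x (X x)
    - a x (leviCivita I M Y x (X x)) (Z x) - a x (Y x) (leviCivita I M Z x (X x))

/-- A `(0, 2)` tensor field `a` is Codazzian if `(∇_X a)(Y, Z) = (∇_Y a)(X, Z)`. For a smooth
tensor field both sides at `x` depend only on the values of `X`, `Y`, `Z` at `x`. -/
def IsCodazzi (a : Π x : M, TangentSpace I x →L[ℝ] TangentSpace I x →L[ℝ] ℝ) : Prop :=
  ∀ (x : M) (X Y Z : Π x : M, TangentSpace I x),
    MDiffAt (T% X) x → MDiffAt (T% Y) x → MDiffAt (T% Z) x →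
      covDerivTensor a X Y Z x = covDerivTensor a Y X Z x

/-- The `(1, 1)` tensor field dual to a `(0, 2)` tensor field, as a field of endomorphisms. -/
def dualEndo (a : Π x : M, TangentSpace I x →L[ℝ] TangentSpace I x →L[ℝ] ℝ) (x : M) :
    Module.End ℝ (TangentSpace I x) :=
  (sharp (a x)).toLinearMap

end

end RiemannianGeometry

/-! ### Real-rooted polynomials: gap coefficients and Laguerre's inequality -/

namespace RiemannianGeometry

noncomputable section

open Polynomial Finset

/-! By Newton's identities the power sums of order below `n` fix every coefficient of the
characteristic polynomial except the constant one, so the polynomial at `x` is `p = Q - f(x)` with a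
fixed `Q` and a smooth function `f`, the determinant up to sign and an additive constant
(`nodalPoly_sub_nodalPoly`, `contMDiff_det_dualEndo`). It remains to show that `f` is constant.

Let `α` and `β` be the minimum and maximum of `f` and suppose `α < β`. Both `Q - α` and `Q - β` are
real-rooted, being characteristic polynomials of symmetric endomorphisms. Laguerre's inequality for
these two shows that on the band `α < f < β` the eigenvalues `μ j` are distinct, and that `-1/(2(β -
f)) ≤ p''(μ j)/(2 p'(μ j)^2) ≤ 1/(2(f - α))` (`nodalPoly_root_bounds`). Hence the band is covered by
smooth orthonormal eigenframes `e`, with `dμ j = df / p'(μ j)` (`exists_isEigenframeOn`).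

In such a frame the Codazzi equation determines `⟪∇_{e i} e i, e j⟫` as `f_j / (p'(μ i)(μ i - μ
j))`, where `f_j` is the derivative of `f` along `e j`. The field `V = ∑ ∇_{e i} e i` therefore has
the components `f_j p''(μ j)/(2 p'(μ j)^2)`. It does not change under permutations and sign changes
of the frame, so it is defined on the whole band. Computing the scalar curvature `R` in the frame
gives `2 div V = R + ∑ f_j^2 D_j` (`divergence_eq`), where `D_j` is the sum of the squares of the
numbers `1/(p'(μ i)(μ i - μ j))`, `i ≠ j`, minus the square of their sum. An elementary inequality
gives `D_j > 0` as soon as there are three eigenvalues (`sq_sum_gapCoeff_lt_sum_sq`). So `div V ≥ 0`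
when `R ≥ 0`.

Finally `div (ψ V)` is integrated for a cutoff `ψ = bandCutoff α β ε ∘ f`. The term `dψ(V)` is at
least a constant times `-ε`: the bounds on `p''/(2 p'^2)` blow up only like the reciprocal distance
of `f` to its extreme values, `|df|^2` is bounded by a multiple of `(f - α)(β - f)`
(`exists_sq_mvfderiv_le_mul`), and the logarithmic derivative of the cutoff is of size `ε`. As `ε →
0`, `div V = 0` on the band, hence `df = 0` there. Off the band `df = 0` because `f` is extremal, so
`f` is constant on the connected manifold.

If the eigenvalues are distinct at one point, they are distinct everywhere since the characteristic
polynomial is constant. Eigenframes then exist around every point, `V = 0` because `df = 0`, and the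
divergence formula reduces to `R = 0`. -/

lemma eval_derivative_prod_X_sub_C {ι : Type*} [DecidableEq ι] (s : Finset ι) (μ : ι → ℝ) {t : ℝ} (ht : ∀ i ∈ s, t ≠ μ i) :
    (derivative (∏ i ∈ s, (X - C (μ i)))).eval t =
      (∏ i ∈ s, (t - μ i)) * ∑ i ∈ s, (t - μ i)⁻¹ := by
  simp only [derivative_prod_finset, eval_finsetSum, mul_sum]
  refine sum_congr rfl fun i hi ↦ ?_
  rw [← mul_prod_erase s (fun k ↦ t - μ k) hi]
  have := sub_ne_zero.2 (ht i hi)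
  simp [eval_prod]
  field_simp

/-- Both factors are estimated by `1 + x ≤ exp x`, and the exponentials cancel. The product is the
ratio of the sum of all gap coefficients at a node to an extremal one. -/
lemma one_add_sum_mul_prod_one_sub_mem_Icc {ι : Type*} (s : Finset ι) (v : ι → ℝ) (hv : ∀ i ∈ s, v i ≤ 1)
    (hs : 0 ≤ 1 + ∑ i ∈ s, v i) :
    (1 + ∑ i ∈ s, v i) * ∏ i ∈ s, (1 - v i) ∈ Set.Icc (0 : ℝ) 1 := by
  have hprod : 0 ≤ ∏ i ∈ s, (1 - v i) := prod_nonneg fun i hi ↦ by linarith [hv i hi]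
  refine ⟨mul_nonneg hs hprod, ?_⟩
  have h1 : ∏ i ∈ s, (1 - v i) ≤ Real.exp (-∑ i ∈ s, v i) := by
    rw [← sum_neg_distrib, Real.exp_sum]
    exact prod_le_prod (fun i hi ↦ by linarith [hv i hi])
      fun i _ ↦ by linarith [Real.add_one_le_exp (-v i)]
  have h2 : 1 + ∑ i ∈ s, v i ≤ Real.exp (∑ i ∈ s, v i) := by
    linarith [Real.add_one_le_exp (∑ i ∈ s, v i)]
  calc _ ≤ Real.exp (∑ i ∈ s, v i) * Real.exp (-∑ i ∈ s, v i) :=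
        mul_le_mul h2 h1 hprod (Real.exp_pos _).le
    _ = 1 := by rw [← Real.exp_add]; simp

section Nodes

variable {ι : Type*} [Fintype ι] [DecidableEq ι]

/-- The monic polynomial with the roots `μ i`. -/
def nodalPoly (μ : ι → ℝ) : ℝ[X] := ∏ i, (X - C (μ i))

lemma nodalPoly_eq_mul (μ : ι → ℝ) (j : ι) :
    nodalPoly μ = (X - C (μ j)) * ∏ i ∈ univ.erase j, (X - C (μ i)) :=
  (mul_prod_erase univ (fun i ↦ X - C (μ i)) (mem_univ j)).symm

lemma eval_nodalPoly (μ : ι → ℝ) (j : ι) : (nodalPoly μ).eval (μ j) = 0 := by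
  simp [nodalPoly_eq_mul μ j]

lemma eval_derivative_nodalPoly (μ : ι → ℝ) (j : ι) :
    (derivative (nodalPoly μ)).eval (μ j) = ∏ i ∈ univ.erase j, (μ j - μ i) := by
  simp [nodalPoly_eq_mul μ j, eval_prod]

lemma eval_derivative_nodalPoly_ne_zero {μ : ι → ℝ} (hμ : Function.Injective μ) (j : ι) :
    (derivative (nodalPoly μ)).eval (μ j) ≠ 0 := by
  rw [eval_derivative_nodalPoly]
  exact prod_ne_zero_iff.2 fun i hi ↦ sub_ne_zero.2 (hμ.ne (ne_of_mem_erase hi).symm)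

lemma eval_derivative_derivative_nodalPoly {μ : ι → ℝ} (hμ : Function.Injective μ) (j : ι) :
    (derivative (derivative (nodalPoly μ))).eval (μ j) =
      2 * ((∏ i ∈ univ.erase j, (μ j - μ i)) * ∑ i ∈ univ.erase j, (μ j - μ i)⁻¹) := by
  rw [← eval_derivative_prod_X_sub_C _ _ fun i hi ↦ hμ.ne (ne_of_mem_erase hi).symm]
  simp [nodalPoly_eq_mul μ j]
  ring

/-- The coefficient `1 / (p'(μ i) (μ i - μ j))`, where `p` is the monic polynomial with the
roots `μ`. -/
def gapCoeff (μ : ι → ℝ) (i j : ι) : ℝ :=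
  ((derivative (nodalPoly μ)).eval (μ i) * (μ i - μ j))⁻¹

/-- A partial fraction identity. -/
lemma sum_gapCoeff {μ : ι → ℝ} (hμ : Function.Injective μ) (j : ι) :
    ∑ i ∈ univ.erase j, gapCoeff μ i j =
      (derivative (derivative (nodalPoly μ))).eval (μ j) /
        (2 * (derivative (nodalPoly μ)).eval (μ j) ^ 2) := by
  set g : ℝ[X] := ∏ i ∈ univ.erase j, (X - C (μ i)) with hg
  have hp : nodalPoly μ = (X - C (μ j)) * g := nodalPoly_eq_mul μ j
  -- With `p = (X - μ j) g` and `g = g(μ j) + (X - μ j) h` one has `p''(μ j) = 2 h(μ j)`, while `h(μ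
  -- i) = -g(μ j)/(μ i - μ j)` at the other roots, so the values of `h` carry the whole identity.
  obtain ⟨h, hh⟩ : X - C (μ j) ∣ g - C (g.eval (μ j)) := by
    rw [dvd_iff_isRoot]; simp
  have hgj : (derivative (nodalPoly μ)).eval (μ j) = g.eval (μ j) := by simp [hp]
  have hhj : (derivative (derivative (nodalPoly μ))).eval (μ j) = 2 * h.eval (μ j) := by
    have : g = C (g.eval (μ j)) + (X - C (μ j)) * h := by rw [← hh]; ring
    rw [hp, this]; simp; ring
  have hdeg_g : g.natDegree = Fintype.card ι - 1 := by
    rw [hg, natDegree_prod_of_monic _ _ fun i _ ↦ monic_X_sub_C _]; simp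
  have hgj0 := eval_derivative_nodalPoly_ne_zero hμ j
  rw [hgj] at hgj0
  have hcard : 0 < Fintype.card ι := Fintype.card_pos_iff.2 ⟨j⟩
  have hdeg : h = 0 ∨ h.natDegree + 1 < Fintype.card ι := by
    refine or_iff_not_imp_left.2 fun h0 ↦ ?_
    have h1 := congrArg natDegree hh
    rw [natDegree_sub_C, natDegree_mul (X_sub_C_ne_zero _) h0, natDegree_X_sub_C] at h1
    omega
  have hcoeff : h.coeff (#(univ : Finset ι) - 1) = 0 := by
    rcases hdeg with rfl | hdeg
    · simp
    · exact coeff_eq_zero_of_natDegree_lt (by rw [card_univ]; omega)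
  have hdeg' : h.degree < #(univ : Finset ι) := by
    rcases hdeg with rfl | hdeg
    · simp
    · refine degree_le_natDegree.trans_lt ?_
      rw [card_univ]; exact_mod_cast (by omega)
  -- The degree of `h` is at most the number of nodes minus two, so its coefficient one degree
  -- higher is zero. Lagrange interpolation writes this coefficient as the sum of `h(μ i)/p'(μ i)`
  -- over all nodes.
  have key := Lagrange.coeff_eq_sum (s := univ) (v := μ) hμ.injOn hdeg'
  rw [hcoeff, ← add_sum_erase _ _ (mem_univ j)] at key
  have hterm : ∀ i ∈ univ.erase j, h.eval (μ i) / ∏ k ∈ univ.erase i, (μ i - μ k) =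
      - g.eval (μ j) * gapCoeff μ i j := by
    intro i hi
    have hne := sub_ne_zero.2 (hμ.ne (ne_of_mem_erase hi))
    have h2 := congrArg (eval (μ i)) hh
    have hgi : g.eval (μ i) = 0 := by
      rw [hg, eval_prod]; exact prod_eq_zero hi (by simp)
    simp [hgi] at h2
    rw [gapCoeff, ← eval_derivative_nodalPoly, mul_inv, h2]
    field_simp
  rw [sum_congr rfl hterm, ← mul_sum, ← eval_derivative_nodalPoly, hgj] at key
  rw [hgj, hhj]
  field_simp at key ⊢
  linarith

/-- The square of a root gap coefficient is not smaller than the square of the sum of all of them,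
if the reciprocal gap is extremal. -/
lemma sq_sum_gapCoeff_le {μ : ι → ℝ} (hμ : Function.Injective μ) {i j : ι} (hij : i ≠ j)
    (hv : ∀ k ∈ (univ.erase j).erase i, (μ k - μ j)⁻¹ / (μ i - μ j)⁻¹ ≤ 1)
    (hS : 0 ≤ (∑ k ∈ univ.erase j, (μ k - μ j)⁻¹) / (μ i - μ j)⁻¹) :
    (∑ k ∈ univ.erase j, gapCoeff μ k j) ^ 2 ≤ gapCoeff μ i j ^ 2 := by
  have hi : i ∈ univ.erase j := mem_erase.2 ⟨hij, mem_univ _⟩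
  have hd : ∀ k ∈ univ.erase j, μ k - μ j ≠ 0 := fun k hk ↦
    sub_ne_zero.2 (hμ.ne (ne_of_mem_erase hk))
  have hdi := hd i hi
  set s := (univ.erase j).erase i with hs
  -- Since `1 - v k = (μ i - μ k)/(μ j - μ k)`, the product of these factors compares `p'(μ i)` with
  -- `p'(μ j)`.
  set v : ι → ℝ := fun k ↦ (μ k - μ j)⁻¹ / (μ i - μ j)⁻¹ with hvdef
  have hSv : (∑ k ∈ univ.erase j, (μ k - μ j)⁻¹) / (μ i - μ j)⁻¹ = 1 + ∑ k ∈ s, v k := by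
    rw [← add_sum_erase _ _ hi, add_div, div_self (inv_ne_zero hdi), sum_div]
  rw [hSv] at hS
  obtain ⟨h0, h1⟩ := one_add_sum_mul_prod_one_sub_mem_Icc s v hv hS
  set P := ∏ k ∈ s, (μ j - μ k) with hP
  have hP0 : P ≠ 0 := prod_ne_zero_iff.2 fun k hk ↦
    sub_ne_zero.2 (hμ.ne (ne_of_mem_erase (mem_of_mem_erase hk)).symm)
  have hpj : (derivative (nodalPoly μ)).eval (μ j) = (μ j - μ i) * P := by
    rw [eval_derivative_nodalPoly, ← mul_prod_erase _ _ hi]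
  have hpi : (derivative (nodalPoly μ)).eval (μ i) =
      (μ i - μ j) * (P * ∏ k ∈ s, (1 - v k)) := by
    have hj : j ∈ univ.erase i := mem_erase.2 ⟨hij.symm, mem_univ _⟩
    rw [eval_derivative_nodalPoly, ← mul_prod_erase _ _ hj, erase_right_comm, ← hs, hP,
      ← prod_mul_distrib]
    congr 1
    refine prod_congr rfl fun k hk ↦ ?_
    have := hd k (mem_of_mem_erase hk)
    simp only [hvdef]
    field_simp
    ring
  have hpi0 := eval_derivative_nodalPoly_ne_zero hμ i
  have hprod0 : ∏ k ∈ s, (1 - v k) ≠ 0 := by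
    rw [hpi] at hpi0; exact right_ne_zero_of_mul (right_ne_zero_of_mul hpi0)
  have hc : ∑ k ∈ univ.erase j, gapCoeff μ k j =
      (1 + ∑ k ∈ s, v k) / ((μ i - μ j) ^ 2 * P) := by
    rw [sum_gapCoeff hμ, eval_derivative_derivative_nodalPoly hμ, ← eval_derivative_nodalPoly,
      hpj, ← hSv]
    have : ∑ k ∈ univ.erase j, (μ j - μ k)⁻¹ = - ∑ k ∈ univ.erase j, (μ k - μ j)⁻¹ := by
      rw [← sum_neg_distrib]
      exact sum_congr rfl fun k _ ↦ by rw [← inv_neg, neg_sub]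
    rw [this]
    have h3 : μ j - μ i ≠ 0 := by rw [← neg_sub]; exact neg_ne_zero.2 hdi
    field_simp
    ring
  have hx : gapCoeff μ i j = 1 / ((μ i - μ j) ^ 2 * P) / ∏ k ∈ s, (1 - v k) := by
    rw [gapCoeff, hpi]; field_simp
  -- The full sum is the extremal coefficient times a number in `[0, 1]`.
  have : ∑ k ∈ univ.erase j, gapCoeff μ k j =
      gapCoeff μ i j * ((1 + ∑ k ∈ s, v k) * ∏ k ∈ s, (1 - v k)) := by
    rw [hc, hx]; field_simp
  rw [this, mul_pow]
  exact mul_le_of_le_one_right (sq_nonneg _) (pow_le_one₀ h0 h1)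

/-- Let `i` maximize the reciprocal gap `(μ k - μ j)⁻¹` if these sum to a nonnegative number, and
minimize it otherwise. Its reciprocal gap then has the sign of the sum and all ratios to it are at
most `1`, so the single square at `i` dominates the square of the sum. A third node contributes
another nonzero square, whence strictness. -/
lemma sq_sum_gapCoeff_lt_sum_sq {μ : ι → ℝ} (hμ : Function.Injective μ)
    (hcard : 3 ≤ Fintype.card ι) (j : ι) :
    (∑ k ∈ univ.erase j, gapCoeff μ k j) ^ 2 < ∑ k ∈ univ.erase j, gapCoeff μ k j ^ 2 := by
  have hcard' : 2 ≤ #(univ.erase j) := by rw [card_erase_of_mem (mem_univ j), card_univ]; omega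
  have hne : (univ.erase j).Nonempty := card_pos.1 (by omega)
  set u : ι → ℝ := fun k ↦ (μ k - μ j)⁻¹ with hu
  have hu0 : ∀ k ∈ univ.erase j, u k ≠ 0 := fun k hk ↦
    inv_ne_zero (sub_ne_zero.2 (hμ.ne (ne_of_mem_erase hk)))
  obtain ⟨i, hi, hle⟩ : ∃ i ∈ univ.erase j,
      (∑ k ∈ univ.erase j, gapCoeff μ k j) ^ 2 ≤ gapCoeff μ i j ^ 2 := by
    rcases le_or_gt 0 (∑ k ∈ univ.erase j, u k) with hS | hS
    · obtain ⟨i, hi, hmax⟩ := exists_max_image (univ.erase j) u hne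
      have hpos : 0 < u i := by
        refine lt_of_le_of_ne ?_ (hu0 i hi).symm
        by_contra! hneg
        exact absurd hS (not_le.2 (sum_neg (fun k hk ↦ (hmax k hk).trans_lt hneg) hne))
      exact ⟨i, hi, sq_sum_gapCoeff_le hμ (ne_of_mem_erase hi)
        (fun k hk ↦ (div_le_one hpos).2 (hmax k (mem_of_mem_erase hk))) (div_nonneg hS hpos.le)⟩
    · obtain ⟨i, hi, hmin⟩ := exists_min_image (univ.erase j) u hne
      have hneg : u i < 0 := by
        by_contra! hpos
        exact absurd hS (not_lt.2 (sum_nonneg fun k hk ↦ hpos.trans (hmin k hk)))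
      exact ⟨i, hi, sq_sum_gapCoeff_le hμ (ne_of_mem_erase hi)
        (fun k hk ↦ (div_le_one_of_neg hneg).2 (hmin k (mem_of_mem_erase hk)))
        (div_nonneg_of_nonpos hS.le hneg.le)⟩
  obtain ⟨k, hk, hki⟩ := exists_mem_ne (by omega : 1 < #(univ.erase j)) i
  refine hle.trans_lt ?_
  rw [← add_sum_erase _ _ hi]
  refine lt_add_of_pos_right _ (sum_pos' (fun _ _ ↦ sq_nonneg _) ⟨k, mem_erase.2 ⟨hki, hk⟩, ?_⟩)
  exact sq_pos_of_ne_zero (inv_ne_zero (mul_ne_zero (eval_derivative_nodalPoly_ne_zero hμ k)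
    (sub_ne_zero.2 (hμ.ne (ne_of_mem_erase hk)))))

/-- **Laguerre's inequality** for real-rooted polynomials, in a weak form. -/
lemma laguerre_nodalPoly [Nonempty ι] (μ : ι → ℝ) {t : ℝ} (ht : (nodalPoly μ).eval t ≠ 0) :
    (nodalPoly μ).eval t * (derivative (derivative (nodalPoly μ))).eval t <
      (derivative (nodalPoly μ)).eval t ^ 2 := by
  have hne : ∀ i, t - μ i ≠ 0 := by
    intro i h
    apply ht
    rw [sub_eq_zero.1 h, eval_nodalPoly]
  have hp : ∀ x, (nodalPoly μ).eval x = ∏ i, (x - μ i) := fun x ↦ by simp [nodalPoly, eval_prod]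
  have h1 : ∀ x, (∀ i, x ≠ μ i) → (derivative (nodalPoly μ)).eval x =
      (nodalPoly μ).eval x * ∑ i, (x - μ i)⁻¹ := fun x hx ↦ by
    rw [hp, nodalPoly, eval_derivative_prod_X_sub_C _ _ fun i _ ↦ hx i]
  have hev : ∀ᶠ x in nhds t, ∀ i, x ≠ μ i := by
    rw [Filter.eventually_all]
    exact fun i ↦ isOpen_ne.mem_nhds (sub_ne_zero.1 (hne i))
  -- Differentiating `p' = p ∑ 1/(x - μ i)`, which holds near `t`, gives `p p'' - p'^2 = -p^2 ∑ 1/(t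
  -- - μ i)^2 < 0`.
  have h2 : HasDerivAt (fun x ↦ (nodalPoly μ).eval x * ∑ i, (x - μ i)⁻¹)
      ((derivative (nodalPoly μ)).eval t * ∑ i, (t - μ i)⁻¹ +
        (nodalPoly μ).eval t * ∑ i, -((t - μ i) ^ 2)⁻¹) t := by
    refine ((nodalPoly μ).hasDerivAt t).mul (HasDerivAt.fun_sum fun i _ ↦ ?_)
    exact (((hasDerivAt_id t).sub_const (μ i)).fun_inv (hne i)).congr_deriv
      (by rw [neg_div, one_div]; rfl)
  have h3 : (derivative (derivative (nodalPoly μ))).eval t = _ :=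
    ((derivative (nodalPoly μ)).hasDerivAt t).unique
      (h2.congr_of_eventuallyEq (hev.mono fun x hx ↦ h1 x hx))
  rw [h3, h1 t hev.self_of_nhds, sum_neg_distrib]
  have hpos : 0 < ∑ i, ((t - μ i) ^ 2)⁻¹ :=
    sum_pos (fun i _ ↦ inv_pos.2 (sq_pos_of_ne_zero (hne i))) univ_nonempty
  nlinarith [sq_pos_of_ne_zero ht, mul_pos (sq_pos_of_ne_zero ht) hpos]

end Nodes

/-! ### Power sums determine all but the constant coefficient -/

section Newton

variable {ι : Type*} [Fintype ι]

/-- Newton's identities express `k` times the `k`-th elementary symmetric function by the earlier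
ones and the power sums up to order `k`; strong induction on `k`, dividing by `k ≠ 0`. -/
lemma aeval_esymm_eq_of_psum_eq {μ ν : ι → ℝ} {m : ℕ}
    (h : ∀ k ∈ Icc 1 m, ∑ i, μ i ^ k = ∑ i, ν i ^ k) :
    ∀ k ≤ m, MvPolynomial.aeval μ (MvPolynomial.esymm ι ℝ k) =
      MvPolynomial.aeval ν (MvPolynomial.esymm ι ℝ k) := by
  intro k
  induction k using Nat.strong_induction_on with
  | _ k ih =>
    intro hk
    rcases Nat.eq_zero_or_pos k with rfl | hpos
    · simp
    have key : ∀ ξ : ι → ℝ, (k : ℝ) * MvPolynomial.aeval ξ (MvPolynomial.esymm ι ℝ k) =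
        (-1) ^ (k + 1) * ∑ a ∈ antidiagonal k with a.1 < k, (-1) ^ a.1 *
          MvPolynomial.aeval ξ (MvPolynomial.esymm ι ℝ a.1) * ∑ i, ξ i ^ a.2 := fun ξ ↦ by
      have := congrArg (MvPolynomial.aeval ξ) (MvPolynomial.mul_esymm_eq_sum ι ℝ k)
      simpa [MvPolynomial.psum] using this
    have hk0 : (k : ℝ) ≠ 0 := by exact_mod_cast hpos.ne'
    apply mul_left_cancel₀ hk0
    rw [key, key]
    congr 1
    refine sum_congr rfl fun a ha ↦ ?_
    obtain ⟨ha1, ha2⟩ := mem_filter.1 ha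
    rw [HasAntidiagonal.mem_antidiagonal] at ha1
    rw [ih a.1 ha2 (by omega), h a.2 (mem_Icc.2 ⟨by omega, by omega⟩)]

/-- If all but the last power sums of two tuples agree, then the monic polynomials with these
roots differ by a constant. -/
lemma nodalPoly_sub_nodalPoly {μ ν : ι → ℝ}
    (h : ∀ k ∈ Icc 1 (Fintype.card ι - 1), ∑ i, μ i ^ k = ∑ i, ν i ^ k) :
    nodalPoly μ = nodalPoly ν + C ((nodalPoly μ).coeff 0 - (nodalPoly ν).coeff 0) := by
  -- By Vieta the coefficient of `X ^ k` is up to sign the elementary symmetric function of index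
  -- `card - k`. For `k ≥ 1` this index is at most `card - 1`, within reach of the given power sums.
  have hc : ∀ ξ : ι → ℝ, ∀ k ≤ Fintype.card ι, (nodalPoly ξ).coeff k =
      (-1) ^ (Fintype.card ι - k) *
        MvPolynomial.aeval ξ (MvPolynomial.esymm ι ℝ (Fintype.card ι - k)) := by
    intro ξ k hk
    have h1 : nodalPoly ξ = ((univ.val.map ξ).map fun t ↦ X - C t).prod := by
      rw [Multiset.map_map]; rfl
    rw [h1, Multiset.prod_X_sub_C_coeff _ (by simpa using hk)]
    simp [MvPolynomial.aeval_esymm_eq_multiset_esymm]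
  have hdeg : ∀ ξ : ι → ℝ, (nodalPoly ξ).natDegree = Fintype.card ι := fun ξ ↦ by
    rw [nodalPoly, natDegree_prod_of_monic _ _ fun i _ ↦ monic_X_sub_C _]; simp
  ext k
  rcases Nat.eq_zero_or_pos k with rfl | hpos
  · simp
  rw [coeff_add, coeff_C_of_ne_zero hpos.ne', add_zero]
  rcases le_or_gt k (Fintype.card ι) with hk | hk
  · rw [hc μ k hk, hc ν k hk, aeval_esymm_eq_of_psum_eq h _ (by omega)]
  · rw [coeff_eq_zero_of_natDegree_lt (by rwa [hdeg]),
      coeff_eq_zero_of_natDegree_lt (by rwa [hdeg])]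

end Newton

end

end RiemannianGeometry

/-! ### Algebra of the connection coefficients in an eigenframe -/

namespace RiemannianGeometry

noncomputable section

open Polynomial Finset

section FrameAlgebra

lemma connection_self {ι : Type*} {Γ : ι → ι → ι → ℝ} (hanti : ∀ i j k, Γ i j k = -Γ i k j)
    (i j : ι) : Γ i j j = 0 := by
  linarith [hanti i j j]

variable {ι : Type*} [Fintype ι]

/-- The scalar curvature in terms of the connection coefficients `Γ` of an orthonormal frame and
their derivatives `dΓ`. -/
lemma scalarCurvature_frame_algebra (Γ : ι → ι → ι → ℝ) (dΓ : ι → ι → ι → ι → ℝ)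
    (hanti : ∀ i j k, Γ i j k = -Γ i k j) (hdanti : ∀ l i j k, dΓ l i j k = -dΓ l i k j) :
    ∑ i, ∑ j, (dΓ i j j i - ∑ m, Γ j j m * Γ i i m - (dΓ j i j i - ∑ m, Γ i j m * Γ j i m)
      - ∑ m, (Γ i j m - Γ j i m) * Γ m j i) =
    2 * ∑ j, ∑ i, dΓ j i i j - ∑ j, (∑ i, Γ i i j) ^ 2 - ∑ i, ∑ j, ∑ m, Γ i j m * Γ m j i := by
  have h1 : ∑ i, ∑ j, dΓ i j j i = ∑ j, ∑ i, dΓ j i i j := rfl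
  have h2 : ∑ i, ∑ j, dΓ j i j i = - ∑ j, ∑ i, dΓ j i i j := by
    rw [sum_comm]
    simp only [← sum_neg_distrib]
    exact sum_congr rfl fun j _ ↦ sum_congr rfl fun i _ ↦ hdanti _ _ _ _
  have h3 : ∑ i, ∑ j, ∑ m, Γ j j m * Γ i i m = ∑ j, (∑ i, Γ i i j) ^ 2 := by
    simp only [sq, sum_mul_sum]
    calc _ = ∑ i, ∑ m, ∑ j, Γ j j m * Γ i i m := sum_congr rfl fun _ _ ↦ sum_comm
      _ = ∑ m, ∑ i, ∑ j, Γ j j m * Γ i i m := sum_comm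
      _ = _ := sum_congr rfl fun _ _ ↦ sum_comm
  -- Relabelling and antisymmetry turn this quadratic term into one that cancels against half of the
  -- bracket term `h5`; a single product sum survives.
  have h4 : ∑ i, ∑ j, ∑ m, Γ i j m * Γ j i m = - ∑ i, ∑ j, ∑ m, Γ j i m * Γ m j i := by
    calc _ = ∑ m, ∑ i, ∑ j, Γ i j m * Γ j i m := by
          rw [sum_comm]
          refine (sum_congr rfl fun _ _ ↦ sum_comm).trans ?_
          rw [sum_comm]
          exact sum_congr rfl fun _ _ ↦ sum_comm
      _ = ∑ m, ∑ i, ∑ j, -(Γ i m j * Γ j i m) := by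
          refine sum_congr rfl fun m _ ↦ sum_congr rfl fun i _ ↦ sum_congr rfl fun j _ ↦ ?_
          rw [hanti i j m]; ring
      _ = _ := by
          simp only [sum_neg_distrib]
  have h5 : ∑ i, ∑ j, ∑ m, (Γ i j m - Γ j i m) * Γ m j i =
      ∑ i, ∑ j, ∑ m, Γ i j m * Γ m j i - ∑ i, ∑ j, ∑ m, Γ j i m * Γ m j i := by
    simp only [sub_mul, sum_sub_distrib]
  simp only [sum_sub_distrib] at h5 ⊢
  rw [h1, h2, h3, h4, h5]
  ring

variable [DecidableEq ι] {Γ : ι → ι → ι → ℝ} {μ : ι → ℝ} {f : ι → ℝ}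

/-- The components of the covariant derivative of a diagonal Codazzi tensor with the eigenvalues
`μ`, whose differentials are `f k / p'(μ i)`. -/
def codazziCoeff (Γ : ι → ι → ι → ℝ) (μ f : ι → ℝ) (k i j : ι) : ℝ :=
  (if i = j then f k / (derivative (nodalPoly μ)).eval (μ i) else 0) + (μ i - μ j) * Γ k i j

/-- This is the Codazzi equation with a repeated index: the derivative of `μ i` along `e j` equals
`(μ i - μ j) Γ i i j`. -/
lemma connection_diag (hμ : Function.Injective μ) (hanti : ∀ i j k, Γ i j k = -Γ i k j)
    (hcod : ∀ k i j, codazziCoeff Γ μ f k i j = codazziCoeff Γ μ f i k j) {i j : ι}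
    (hij : i ≠ j) : Γ i i j = f j * gapCoeff μ i j := by
  have h := hcod j i i
  have h0 := sub_ne_zero.2 (hμ.ne hij)
  have h1 := eval_derivative_nodalPoly_ne_zero hμ i
  simp only [codazziCoeff, if_true, if_neg hij.symm, sub_self, zero_mul, add_zero, zero_add] at h
  rw [hanti i j i] at h
  rw [gapCoeff]
  field_simp at h ⊢
  linarith

lemma sum_connection_diag (hμ : Function.Injective μ) (hanti : ∀ i j k, Γ i j k = -Γ i k j)
    (hcod : ∀ k i j, codazziCoeff Γ μ f k i j = codazziCoeff Γ μ f i k j) (j : ι) :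
    ∑ i, Γ i i j = f j * ∑ i ∈ univ.erase j, gapCoeff μ i j := by
  rw [← add_sum_erase _ _ (mem_univ j), connection_self hanti, zero_add, mul_sum]
  exact sum_congr rfl fun i hi ↦ connection_diag hμ hanti hcod (ne_of_mem_erase hi)

/-- For pairwise distinct indices the Codazzi equation makes `b = (μ i - μ j) Γ k i j` totally
symmetric, and the products then cancel in cyclic triples. The terms with `i = m` remain; they are
squares of coefficients computed by `connection_diag`. -/
lemma sum_connection_mul (hμ : Function.Injective μ) (hanti : ∀ i j k, Γ i j k = -Γ i k j)
    (hcod : ∀ k i j, codazziCoeff Γ μ f k i j = codazziCoeff Γ μ f i k j) :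
    ∑ i, ∑ j, ∑ m, Γ i j m * Γ m j i =
      ∑ j, f j ^ 2 * ∑ i ∈ univ.erase j, gapCoeff μ i j ^ 2 := by
  have hself := connection_self hanti
  set w : ι → ι → ι → ℝ := fun i j m ↦ if i = m then 0 else Γ i j m * Γ m j i with hw
  -- If two indices coincide, all three terms vanish. Otherwise `w i j m = b^2/((μ j - μ m)(μ j - μ
  -- i))`, and the cyclic sum of these fractions is zero.
  have hcyc : ∀ i j m, w i j m + w j m i + w m i j = 0 := by
    intro i j m
    by_cases him : i = m
    · subst him; simp [hw, hself]
    by_cases hij : i = j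
    · subst hij; simp [hw, hself]
    by_cases hjm : j = m
    · subst hjm; simp [hw, hself]
    simp only [hw, if_neg him, if_neg (Ne.symm hij), if_neg (Ne.symm hjm)]
    have e1 := hcod i j m
    have e2 := hcod j m i
    have e3 := hcod m i j
    simp only [codazziCoeff, if_neg him, if_neg hij, if_neg hjm, if_neg (Ne.symm him),
      if_neg (Ne.symm hij), if_neg (Ne.symm hjm), zero_add] at e1 e2 e3
    have a1 := hanti j m i
    have a2 := hanti m i j
    have a3 := hanti i j m
    have n1 := sub_ne_zero.2 (hμ.ne him)
    have n2 := sub_ne_zero.2 (hμ.ne hij)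
    have n3 := sub_ne_zero.2 (hμ.ne hjm)
    have g1 : Γ j i m = (μ j - μ m) * Γ i j m / (μ i - μ m) := by field_simp; linarith
    have g2 : Γ m i j = (μ j - μ m) * Γ i j m / (μ i - μ j) := by
      rw [hanti i m j] at e3
      field_simp; linarith
    rw [hanti m j i, hanti i m j, a1, g1, g2]
    field_simp
    ring
  have hzero : ∑ i, ∑ j, ∑ m, w i j m = 0 := by
    have c1 : ∑ i, ∑ j, ∑ m, w j m i = ∑ i, ∑ j, ∑ m, w i j m := by
      rw [sum_comm]; exact sum_congr rfl fun _ _ ↦ sum_comm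
    have c2 : ∑ i, ∑ j, ∑ m, w m i j = ∑ i, ∑ j, ∑ m, w i j m := by
      refine (sum_congr rfl fun _ _ ↦ sum_comm).trans ?_
      rw [sum_comm]
    have : ∑ i, ∑ j, ∑ m, (w i j m + w j m i + w m i j) = 0 :=
      sum_eq_zero fun i _ ↦ sum_eq_zero fun j _ ↦ sum_eq_zero fun m _ ↦ hcyc i j m
    simp only [sum_add_distrib, c1, c2] at this
    linarith
  have hsplit : ∀ i j m, Γ i j m * Γ m j i = w i j m + if i = m then Γ i j i ^ 2 else 0 := by
    intro i j m
    by_cases him : i = m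
    · subst him; simp [hw, sq]
    · simp [hw, him]
  simp only [hsplit, sum_add_distrib, hzero, zero_add, sum_ite_eq, mem_univ, if_true]
  rw [sum_comm]
  refine sum_congr rfl fun j _ ↦ ?_
  rw [← add_sum_erase _ _ (mem_univ j), hself, mul_sum]
  simp only [ne_eq, OfNat.ofNat_ne_zero, not_false_eq_true, zero_pow, zero_add]
  refine sum_congr rfl fun i hi ↦ ?_
  rw [hanti i j i, connection_diag hμ hanti hcod (ne_of_mem_erase hi)]
  ring

/-- The integrand of the divergence formula. -/
def gapDefect (μ : ι → ℝ) (j : ι) : ℝ :=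
  ∑ i ∈ univ.erase j, gapCoeff μ i j ^ 2 - (∑ i ∈ univ.erase j, gapCoeff μ i j) ^ 2

lemma gapDefect_pos (hμ : Function.Injective μ) (hcard : 3 ≤ Fintype.card ι) (j : ι) :
    0 < gapDefect μ j :=
  sub_pos.2 (sq_sum_gapCoeff_lt_sum_sq hμ hcard j)

/-- In the application `D` is the sum of the derivatives of the components of `∑ ∇_{e i} e i` along
the frame. Each `e j` has divergence `-∑ i, Γ i i j`, so the bracket on the left is the divergence
of that field. -/
lemma divergence_frame_algebra (hμ : Function.Injective μ)
    (hanti : ∀ i j k, Γ i j k = -Γ i k j)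
    (hcod : ∀ k i j, codazziCoeff Γ μ f k i j = codazziCoeff Γ μ f i k j) {R D : ℝ}
    (hR : R = 2 * D - ∑ j, (∑ i, Γ i i j) ^ 2 - ∑ i, ∑ j, ∑ m, Γ i j m * Γ m j i) :
    2 * (D - ∑ j, (∑ i, Γ i i j) ^ 2) = R + ∑ j, f j ^ 2 * gapDefect μ j := by
  rw [sum_connection_mul hμ hanti hcod] at hR
  simp only [sum_connection_diag hμ hanti hcod, gapDefect, mul_sub, sum_sub_distrib, mul_pow]
    at hR ⊢
  linarith

end FrameAlgebra

end

end RiemannianGeometry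

/-! ### Orthonormal frames and their connection coefficients -/

namespace RiemannianGeometry

noncomputable section

set_option linter.unusedSectionVars false

variable {E : Type*} [NormedAddCommGroup E] [NormedSpace ℝ E] [FiniteDimensional ℝ E]
  [CompleteSpace E]
  {H : Type*} [TopologicalSpace H] {I : ModelWithCorners ℝ E H}
  {M : Type*} [TopologicalSpace M] [ChartedSpace H M] [IsManifold I ∞ M]
  [RiemannianBundle (fun x : M ↦ TangentSpace I x)]
  [IsContMDiffRiemannianBundle I ∞ E (fun x : M ↦ TangentSpace I x)]
  {ι : Type*} [Fintype ι]

/-- The vector fields `e i` form a smooth orthonormal frame on the open set `N`. -/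
structure IsOrthonormalFrameOn (e : ι → Π x : M, TangentSpace I x) (N : Set M) : Prop where
  isOpen : IsOpen N
  contMDiffAt : ∀ i, ∀ x ∈ N, CMDiffAt ∞ (T% (e i)) x
  orthonormal : ∀ x ∈ N, Orthonormal ℝ fun i ↦ e i x
  card_eq : Fintype.card ι = Module.finrank ℝ E

namespace IsOrthonormalFrameOn

variable {e : ι → Π x : M, TangentSpace I x} {N : Set M} {x : M}

lemma mdiffAt (he : IsOrthonormalFrameOn e N) (hx : x ∈ N) (i : ι) : MDiffAt (T% (e i)) x :=
  (he.contMDiffAt i x hx).mdifferentiableAt (by simp)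

/-- The orthonormal basis of the tangent space given by an orthonormal frame. -/
def basis (he : IsOrthonormalFrameOn e N) (hx : x ∈ N) :
    OrthonormalBasis ι ℝ (TangentSpace I x) :=
  OrthonormalBasis.mk (he.orthonormal x hx) <| by
    have hcard : Fintype.card ι = Module.finrank ℝ (TangentSpace I x) := he.card_eq
    rw [top_le_iff]
    exact (he.orthonormal x hx).linearIndependent.span_eq_top_of_card_eq_finrank' hcard

lemma basis_apply (he : IsOrthonormalFrameOn e N) (hx : x ∈ N) (i : ι) :
    he.basis hx i = e i x := by
  simp [basis]

lemma sum_inner_smul (he : IsOrthonormalFrameOn e N) (hx : x ∈ N) (v : TangentSpace I x) :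
    ∑ i, inner ℝ (e i x) v • e i x = v := by
  simpa [basis_apply] using (he.basis hx).sum_repr' v

lemma inner_eq [DecidableEq ι] (he : IsOrthonormalFrameOn e N) (hx : x ∈ N) (i j : ι) :
    inner ℝ (e i x) (e j x) = if i = j then (1 : ℝ) else 0 :=
  orthonormal_iff_ite.1 (he.orthonormal x hx) i j

lemma mvfderiv_inner (he : IsOrthonormalFrameOn e N) (hx : x ∈ N) (i j : ι) :
    mvfderiv I (fun y ↦ (inner ℝ (e i y) (e j y) : ℝ)) x = 0 := by
  classical
  have : (fun y ↦ (inner ℝ (e i y) (e j y) : ℝ)) =ᶠ[𝓝 x]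
      fun _ ↦ if i = j then (1 : ℝ) else 0 :=
    Filter.eventually_of_mem (he.isOpen.mem_nhds hx) fun y hy ↦ he.inner_eq hy i j
  rw [mvfderiv, this.mfderiv_eq]
  exact mvfderiv_const _

end IsOrthonormalFrameOn

/-- The connection coefficients `⟪∇_{e i} e j, e k⟫` of a frame. -/
def connectionCoeff (e : ι → Π x : M, TangentSpace I x) (i j k : ι) (x : M) : ℝ :=
  inner ℝ (leviCivita I M (e j) x (e i x)) (e k x)

namespace IsOrthonormalFrameOn

variable {e : ι → Π x : M, TangentSpace I x} {N : Set M} {x : M}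

lemma contMDiffAt_inner {X Y : Π x : M, TangentSpace I x} {m : ℕ∞}
    (hX : CMDiffAt m (T% X) x) (hY : CMDiffAt m (T% Y) x) :
    CMDiffAt m (fun y ↦ (inner ℝ (X y) (Y y) : ℝ)) x := by
  have : IsContMDiffRiemannianBundle I m E (fun x : M ↦ TangentSpace I x) :=
    .of_le (n := ∞) (by exact_mod_cast le_top)
  exact ContMDiffAt.inner_bundle (IB := I) (F := E) (E := fun x : M ↦ TangentSpace I x)
    (b := fun y ↦ y) hX hY

lemma contMDiffAt_mlieBracket {X Y : Π x : M, TangentSpace I x}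
    (hX : CMDiffAt ∞ (T% X) x) (hY : CMDiffAt ∞ (T% Y) x) :
    CMDiffAt ∞ (T% (VectorField.mlieBracket I X Y)) x := by
  have : IsManifold I (((⊤ : ℕ∞) : ℕ∞ω) + 1) M := by
    exact_mod_cast (inferInstance : IsManifold I ∞ M)
  have : IsManifold I (minSmoothness ℝ 2) M := by
    rw [minSmoothness_of_isRCLikeNormedField]; infer_instance
  exact ContMDiffAt.mlieBracket_vectorField (m := ⊤) (n := ⊤) hX hY (by simp)

/-- The inner products of frame fields are constant, so the Koszul formula retains only its bracket
terms, which are smooth. -/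
lemma contMDiffAt_connectionCoeff (he : IsOrthonormalFrameOn e N) (hx : x ∈ N) (i j k : ι) :
    CMDiffAt ∞ (connectionCoeff e i j k) x := by
  have key : connectionCoeff e i j k =ᶠ[𝓝 x] fun y ↦ (1 / 2 : ℝ) *
      (inner ℝ (VectorField.mlieBracket I (e i) (e j) y) (e k y)
        - inner ℝ (VectorField.mlieBracket I (e i) (e k) y) (e j y)
        - inner ℝ (VectorField.mlieBracket I (e j) (e k) y) (e i y)) := by
    refine Filter.eventually_of_mem (he.isOpen.mem_nhds hx) fun y hy ↦ ?_
    dsimp only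
    rw [connectionCoeff, inner_leviCivita (he.mdiffAt hy i) (he.mdiffAt hy j) (he.mdiffAt hy k),
      koszul]
    simp [he.mvfderiv_inner hy]
  refine ContMDiffAt.congr_of_eventuallyEq ?_ key
  have hs := fun i ↦ he.contMDiffAt i x hx
  have h := fun i j k ↦ contMDiffAt_inner (contMDiffAt_mlieBracket (hs i) (hs j)) (hs k)
  exact contMDiffAt_const.mul (((h i j k).sub (h i k j)).sub (h j k i))

lemma connectionCoeff_anti (he : IsOrthonormalFrameOn e N) (hx : x ∈ N) (i j k : ι) :
    connectionCoeff e i j k x = -connectionCoeff e i k j x := by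
  have h := mvfderiv_inner_leviCivita (he.mdiffAt hx i) (he.mdiffAt hx j) (he.mdiffAt hx k)
  rw [he.mvfderiv_inner hx] at h
  rw [connectionCoeff, connectionCoeff, eq_neg_iff_add_eq_zero,
    real_inner_comm (e j x) (leviCivita I M (e k) x (e i x))]
  exact h.symm

lemma inner_mlieBracket (he : IsOrthonormalFrameOn e N) (hx : x ∈ N) (i j k : ι) :
    inner ℝ (VectorField.mlieBracket I (e i) (e j) x) (e k x) =
      connectionCoeff e i j k x - connectionCoeff e j i k x := by
  rw [← (CovariantDerivative.torsion_eq_zero_iff _).1 torsion_leviCivita (he.mdiffAt hx i)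
    (he.mdiffAt hx j), inner_sub_left]
  rfl

lemma leviCivita_eq_sum (he : IsOrthonormalFrameOn e N) (hx : x ∈ N) (i j : ι) :
    leviCivita I M (e j) x (e i x) = ∑ k, connectionCoeff e i j k x • e k x := by
  rw [← he.sum_inner_smul hx (leviCivita I M (e j) x (e i x))]
  exact Finset.sum_congr rfl fun k _ ↦ by rw [real_inner_comm]; rfl

lemma contMDiffAt_leviCivita (he : IsOrthonormalFrameOn e N) (hx : x ∈ N) (i j : ι) :
    CMDiffAt ∞ (T% (fun y ↦ leviCivita I M (e j) y (e i y))) x := by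
  have h : CMDiffAt ∞ (T% (fun y ↦ ∑ k, connectionCoeff e i j k y • e k y)) x :=
    ContMDiffAt.sum_section fun k _ ↦
      (he.contMDiffAt_connectionCoeff hx i j k).smul_section (he.contMDiffAt k x hx)
  refine h.congr_of_eventuallyEq ?_
  exact Filter.eventually_of_mem (he.isOpen.mem_nhds hx) fun y hy ↦ by
    simp only [he.leviCivita_eq_sum hy]

end IsOrthonormalFrameOn

end

end RiemannianGeometry

/-! ### Rules for the Levi-Civita connection and the Lie bracket -/

namespace RiemannianGeometry

noncomputable section

set_option linter.unusedSectionVars false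

variable {E : Type*} [NormedAddCommGroup E] [NormedSpace ℝ E] [FiniteDimensional ℝ E]
  [CompleteSpace E]
  {H : Type*} [TopologicalSpace H] {I : ModelWithCorners ℝ E H}
  {M : Type*} [TopologicalSpace M] [ChartedSpace H M] [IsManifold I ∞ M]
  [RiemannianBundle (fun x : M ↦ TangentSpace I x)]
  [IsContMDiffRiemannianBundle I ∞ E (fun x : M ↦ TangentSpace I x)]
  {ι : Type*} [Fintype ι]

lemma leviCivita_congr {Y Y' : Π x : M, TangentSpace I x} {x : M} (hY' : MDiffAt (T% Y') x)
    (h : ∀ᶠ y in 𝓝 x, Y y = Y' y) : leviCivita I M Y x = leviCivita I M Y' x := by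
  have hY : MDiffAt (T% Y) x := hY'.congr_of_eventuallyEq (h.mono fun y hy ↦ by simp only [hy])
  exact (leviCivita I M).isCovariantDerivativeOnUniv.congr_of_eventuallyEq hY hY'
    Filter.univ_mem h

lemma leviCivita_add {Y Y' : Π x : M, TangentSpace I x} {x : M} (hY : MDiffAt (T% Y) x)
    (hY' : MDiffAt (T% Y') x) :
    leviCivita I M (Y + Y') x = leviCivita I M Y x + leviCivita I M Y' x :=
  (leviCivita I M).isCovariantDerivativeOnUniv.add hY hY'

lemma leviCivita_smul {Y : Π x : M, TangentSpace I x} {g : M → ℝ} {x : M}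
    (hg : MDiffAt g x) (hY : MDiffAt (T% Y) x) (v : TangentSpace I x) :
    leviCivita I M (g • Y) x v = g x • leviCivita I M Y x v + mvfderiv I g x v • Y x := by
  rw [(leviCivita I M).isCovariantDerivativeOnUniv.leibniz hY hg]
  rfl

lemma leviCivita_sum {κ : Type*} (s : Finset κ) {Y : κ → Π x : M, TangentSpace I x} {x : M}
    (hY : ∀ k, MDiffAt (T% (Y k)) x) :
    leviCivita I M (fun y ↦ ∑ k ∈ s, Y k y) x = ∑ k ∈ s, leviCivita I M (Y k) x := by
  classical
  induction s using Finset.induction_on with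
  | empty =>
    simp only [Finset.sum_empty]
    exact congrFun (leviCivita I M).zero x
  | insert a s ha ih =>
    simp only [Finset.sum_insert ha]
    rw [← ih]
    exact leviCivita_add (hY a) (.sum_section fun k _ ↦ hY k)

section Bracket

variable {X Y Z : Π x : M, TangentSpace I x} {g : M → ℝ} {x : M}

lemma _root_.ContMDiffAt.eventually_mdiffAt {F : Type*} [NormedAddCommGroup F] [NormedSpace ℝ F]
    {G : Type*} [TopologicalSpace G] {J : ModelWithCorners ℝ F G} {N : Type*} [TopologicalSpace N]
    [ChartedSpace G N] [IsManifold J 1 N] {f : M → N} (hf : ContMDiffAt I J ∞ f x) :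
    ∀ᶠ y in 𝓝 x, MDifferentiableAt I J f y :=
  (contMDiffAt_iff_contMDiffAt_nhds (by simp)).1 (hf.of_le (m := 1) (by simp)) |>.mono
    fun _ hy ↦ hy.mdifferentiableAt (by simp)

/-- The derivative of a smooth function along a smooth vector field is smooth. -/
lemma contMDiffAt_mvfderiv_apply (hg : CMDiffAt ∞ g x) (hX : CMDiffAt ∞ (T% X) x)
    (hZ : CMDiffAt ∞ (T% Z) x) (hZ1 : ∀ᶠ y in 𝓝 x, (inner ℝ (Z y) (Z y) : ℝ) = 1) :
    CMDiffAt ∞ (fun y ↦ mvfderiv I g y (X y)) x := by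
  -- Pairing `[X, gZ] = (Xg) Z + g [X, Z]` with the unit field `Z` expresses `Xg` through brackets,
  -- whose smoothness is known.
  have key : (fun y ↦ mvfderiv I g y (X y)) =ᶠ[𝓝 x] fun y ↦
      inner ℝ (VectorField.mlieBracket I X (g • Z) y) (Z y)
        - g y * inner ℝ (VectorField.mlieBracket I X Z y) (Z y) := by
    filter_upwards [hg.eventually_mdiffAt, hZ.eventually_mdiffAt, hZ1] with y hgy hZy hy
    rw [VectorField.mlieBracket_smul_right hgy hZy, inner_add_left, inner_smul_left,
      inner_smul_left, hy]
    simp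
  refine ContMDiffAt.congr_of_eventuallyEq ?_ key
  exact (IsOrthonormalFrameOn.contMDiffAt_inner
    (IsOrthonormalFrameOn.contMDiffAt_mlieBracket hX (hg.smul_section hZ)) hZ).sub
    (hg.mul (IsOrthonormalFrameOn.contMDiffAt_inner
      (IsOrthonormalFrameOn.contMDiffAt_mlieBracket hX hZ) hZ))

/-- The Lie bracket acts on functions as a commutator. -/
lemma mvfderiv_mlieBracket (hg : CMDiffAt ∞ g x) (hX : CMDiffAt ∞ (T% X) x)
    (hY : CMDiffAt ∞ (T% Y) x) (hZ : CMDiffAt ∞ (T% Z) x)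
    (hZ1 : ∀ᶠ y in 𝓝 x, (inner ℝ (Z y) (Z y) : ℝ) = 1) :
    mvfderiv I g x (VectorField.mlieBracket I X Y x) =
      mvfderiv I (fun y ↦ mvfderiv I g y (Y y)) x (X x)
        - mvfderiv I (fun y ↦ mvfderiv I g y (X y)) x (Y x) := by
  have : IsManifold I (minSmoothness ℝ 3) M := by
    rw [minSmoothness_of_isRCLikeNormedField]; exact .of_le (n := ∞) (WithTop.coe_le_coe.2 le_top)
  have hle : minSmoothness ℝ 2 ≤ (∞ : ℕ∞ω) := by
    rw [minSmoothness_of_isRCLikeNormedField]; exact WithTop.coe_le_coe.2 le_top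
  -- The Jacobi identity is applied to `gZ` and to `Z`. Expanding the former and subtracting `g`
  -- times the latter leaves `([X, Y]g - X(Yg) + Y(Xg)) Z = 0`.
  have h := VectorField.leibniz_identity_mlieBracket_apply (hX.of_le hle) (hY.of_le hle)
    ((hg.smul_section hZ).of_le hle)
  have h' := VectorField.leibniz_identity_mlieBracket_apply (hX.of_le hle) (hY.of_le hle)
    (hZ.of_le hle)
  have md : ∀ {W : Π x : M, TangentSpace I x}, CMDiffAt ∞ (T% W) x → MDiffAt (T% W) x :=
    fun hW ↦ hW.mdifferentiableAt (by simp)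
  have hgx : MDiffAt g x := hg.mdifferentiableAt (by simp)
  have expand : ∀ {V W : Π x : M, TangentSpace I x}, CMDiffAt ∞ (T% V) x → CMDiffAt ∞ (T% W) x →
      VectorField.mlieBracket I V (VectorField.mlieBracket I W (g • Z)) x =
        mvfderiv I (fun y ↦ mvfderiv I g y (W y)) x (V x) • Z x
        + mvfderiv I g x (W x) • VectorField.mlieBracket I V Z x
        + mvfderiv I g x (V x) • VectorField.mlieBracket I W Z x
        + g x • VectorField.mlieBracket I V (VectorField.mlieBracket I W Z) x := by
    intro V W hV hW
    have e1 : VectorField.mlieBracket I W (g • Z) =ᶠ[𝓝 x]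
        (fun y ↦ mvfderiv I g y (W y)) • Z + g • VectorField.mlieBracket I W Z := by
      filter_upwards [hg.eventually_mdiffAt, hZ.eventually_mdiffAt] with y hgy hZy
      exact VectorField.mlieBracket_smul_right hgy hZy
    have hWg := contMDiffAt_mvfderiv_apply hg hW hZ hZ1
    have hWg' : MDiffAt (fun y ↦ mvfderiv I g y (W y)) x := hWg.mdifferentiableAt (by simp)
    have hWZ := IsOrthonormalFrameOn.contMDiffAt_mlieBracket hW hZ
    refine (Filter.EventuallyEq.mlieBracket_vectorField_eq Filter.EventuallyEq.rfl e1).trans ?_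
    rw [VectorField.mlieBracket_add_right (md (hWg.smul_section hZ)) (md (hg.smul_section hWZ)),
      VectorField.mlieBracket_smul_right hWg' (md hZ),
      VectorField.mlieBracket_smul_right hgx (md hWZ)]
    module
  rw [expand hX hY, expand hY hX, VectorField.mlieBracket_smul_right hgx (md hZ), h'] at h
  have h2 : (mvfderiv I g x (VectorField.mlieBracket I X Y x)
      - (mvfderiv I (fun y ↦ mvfderiv I g y (Y y)) x (X x)
        - mvfderiv I (fun y ↦ mvfderiv I g y (X y)) x (Y x))) • Z x = 0 := by
    rw [← sub_eq_zero] at h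
    rw [← neg_eq_zero, ← h]
    module
  have hZx : Z x ≠ 0 := fun h0 ↦ by simpa [h0] using hZ1.self_of_nhds
  exact sub_eq_zero.1 ((smul_eq_zero.1 h2).resolve_right hZx)

end Bracket

namespace IsOrthonormalFrameOn

variable {e : ι → Π x : M, TangentSpace I x} {N : Set M} {x : M}
  {X Y Z : Π x : M, TangentSpace I x}

lemma eventually_inner_self (he : IsOrthonormalFrameOn e N) (hx : x ∈ N) (i : ι) :
    ∀ᶠ y in 𝓝 x, (inner ℝ (e i y) (e i y) : ℝ) = 1 := by
  classical
  exact Filter.eventually_of_mem (he.isOpen.mem_nhds hx) fun y hy ↦ by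
    rw [he.inner_eq hy, if_pos rfl]

lemma eventually_eq_sum (he : IsOrthonormalFrameOn e N) (hx : x ∈ N)
    (X : Π x : M, TangentSpace I x) :
    ∀ᶠ y in 𝓝 x, X y = ∑ i, (inner ℝ (e i y) (X y) : ℝ) • e i y :=
  Filter.eventually_of_mem (he.isOpen.mem_nhds hx) fun _ hy ↦ (he.sum_inner_smul hy _).symm

/-- The covariant derivative of a smooth vector field along a differentiable one is
differentiable. -/
lemma mdiffAt_leviCivita (he : IsOrthonormalFrameOn e N) (hx : x ∈ N)
    (hX : MDiffAt (T% X) x) (hZ : CMDiffAt ∞ (T% Z) x) :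
    MDiffAt (T% (fun y ↦ leviCivita I M Z y (X y))) x := by
  have hc : ∀ i, MDiffAt (fun y ↦ (inner ℝ (e i y) (X y) : ℝ)) x := fun i ↦
    mdiffAt_inner (he.mdiffAt hx i) hX
  have hd : ∀ k, CMDiffAt ∞ (fun y ↦ (inner ℝ (e k y) (Z y) : ℝ)) x := fun k ↦
    contMDiffAt_inner (he.contMDiffAt k x hx) hZ
  -- Both fields are expanded in the frame: the coefficients of `X` are only differentiable, but
  -- they multiply fields that are smooth.
  have h : MDiffAt (T% (fun y ↦ ∑ i, (inner ℝ (e i y) (X y) : ℝ) • ∑ k,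
      ((inner ℝ (e k y) (Z y) : ℝ) • leviCivita I M (e k) y (e i y)
        + mvfderiv I (fun z ↦ (inner ℝ (e k z) (Z z) : ℝ)) y (e i y) • e k y))) x := by
    refine MDifferentiableAt.sum_section fun i _ ↦ (hc i).smul_section ?_
    refine MDifferentiableAt.sum_section fun k _ ↦ mdifferentiableAt_add_section ?_ ?_
    · exact ((hd k).mdifferentiableAt (by simp)).smul_section
        ((he.contMDiffAt_leviCivita hx i k).mdifferentiableAt (by simp))
    · exact ((contMDiffAt_mvfderiv_apply (hd k) (he.contMDiffAt i x hx) (he.contMDiffAt i x hx)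
        (he.eventually_inner_self hx i)).mdifferentiableAt (by simp)).smul_section
        (he.mdiffAt hx k)
  refine h.congr_of_eventuallyEq ?_
  have hdy : ∀ᶠ y in 𝓝 x, ∀ k, MDiffAt (fun y ↦ (inner ℝ (e k y) (Z y) : ℝ)) y :=
    Filter.eventually_all.2 fun k ↦ (hd k).eventually_mdiffAt
  filter_upwards [he.isOpen.mem_nhds hx, hdy, hZ.eventually_mdiffAt] with y hy hdy hZy
  congr 1
  have hmd : ∀ k, MDiffAt (T% ((fun z ↦ (inner ℝ (e k z) (Z z) : ℝ)) • e k)) y := fun k ↦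
    (hdy k).smul_section (he.mdiffAt hy k)
  rw [leviCivita_congr (Y' := fun z ↦ ∑ k, ((fun z ↦ (inner ℝ (e k z) (Z z) : ℝ)) • e k) z)
    (.sum_section fun k _ ↦ hmd k) (he.eventually_eq_sum hy Z), leviCivita_sum _ hmd]
  conv_lhs => rw [← he.sum_inner_smul hy (X y), map_sum]
  refine Finset.sum_congr rfl fun i _ ↦ ?_
  rw [map_smul, sum_apply]
  congr 1
  exact Finset.sum_congr rfl fun k _ ↦ leviCivita_smul (hdy k) (he.mdiffAt hy k) _

end IsOrthonormalFrameOn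

end

end RiemannianGeometry

/-! ### Tensoriality of the curvature and the scalar curvature in a frame -/

namespace RiemannianGeometry

noncomputable section

set_option linter.unusedSectionVars false

variable {E : Type*} [NormedAddCommGroup E] [NormedSpace ℝ E] [FiniteDimensional ℝ E]
  [CompleteSpace E]
  {H : Type*} [TopologicalSpace H] {I : ModelWithCorners ℝ E H}
  {M : Type*} [TopologicalSpace M] [ChartedSpace H M] [IsManifold I ∞ M]
  [RiemannianBundle (fun x : M ↦ TangentSpace I x)]
  [IsContMDiffRiemannianBundle I ∞ E (fun x : M ↦ TangentSpace I x)]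
  {ι : Type*} [Fintype ι]

lemma curvature_swap (X Y Z : Π x : M, TangentSpace I x) (x : M) :
    curvature X Y Z x = -curvature Y X Z x := by
  rw [curvature, curvature, VectorField.mlieBracket_swap_apply (V := X) (W := Y), map_neg]
  abel

namespace IsOrthonormalFrameOn

variable {e : ι → Π x : M, TangentSpace I x} {N : Set M} {x : M}
  {X Y Z : Π x : M, TangentSpace I x}

/-- The derivatives of the factor `g` in `∇_Y ∇_{gX} Z` and in `∇_[gX, Y] Z` cancel. `TensorialAt`
tests fields that are merely differentiable at `x`; smoothness of `Z` keeps `∇_X Z` differentiable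
for those. -/
lemma tensorialAt_curvature_left (he : IsOrthonormalFrameOn e N) (hx : x ∈ N)
    (hZ : CMDiffAt ∞ (T% Z) x) :
    TensorialAt I E (curvature · Y Z x) x where
  smul {g X} hg hX := by
    have h1 := he.mdiffAt_leviCivita hx hX hZ
    have h2 : (fun y ↦ leviCivita I M Z y ((g • X) y)) =
        g • fun y ↦ leviCivita I M Z y (X y) := by
      ext1 y; exact map_smul _ _ _
    rw [curvature, h2, leviCivita_smul hg h1, VectorField.mlieBracket_smul_left hg hX, map_add,
      map_smul, map_smul, curvature]
    have h3 : (g • X) x = g x • X x := rfl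
    rw [h3, map_smul]
    module
  add {X X'} hX hX' := by
    have h1 := he.mdiffAt_leviCivita hx hX hZ
    have h1' := he.mdiffAt_leviCivita hx hX' hZ
    have h2 : (fun y ↦ leviCivita I M Z y ((X + X') y)) =
        (fun y ↦ leviCivita I M Z y (X y)) + fun y ↦ leviCivita I M Z y (X' y) := by
      ext1 y; exact map_add _ _ _
    rw [curvature, h2, leviCivita_add h1 h1', VectorField.mlieBracket_add_left hX hX', map_add,
      add_apply, curvature, curvature]
    have h3 : (X + X') x = X x + X' x := rfl
    rw [h3, map_add]
    module

lemma _root_.TensorialAt.eq_sum {Φ : (Π x : M, TangentSpace I x) → TangentSpace I x}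
    (hΦ : TensorialAt I E Φ x) (he : IsOrthonormalFrameOn e N) (hx : x ∈ N)
    (hX : MDiffAt (T% X) x) : Φ X = ∑ i, (inner ℝ (e i x) (X x) : ℝ) • Φ (e i) := by
  have hc : ∀ i, MDiffAt (fun _ : M ↦ (inner ℝ (e i x) (X x) : ℝ)) x := fun i ↦
    mdifferentiableAt_const
  have hs : ∀ i, MDiffAt (T% ((fun _ : M ↦ (inner ℝ (e i x) (X x) : ℝ)) • e i)) x := fun i ↦
    (hc i).smul_section (he.mdiffAt hx i)
  rw [hΦ.pointwise hX (.sum_section fun i _ ↦ hs i) (he.sum_inner_smul hx (X x)).symm,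
    hΦ.sum _ fun i _ ↦ hs i]
  exact Finset.sum_congr rfl fun i _ ↦ hΦ.smul (hc i) (he.mdiffAt hx i)

lemma curvature_eq_sum_left (he : IsOrthonormalFrameOn e N) (hx : x ∈ N)
    (hX : MDiffAt (T% X) x) (hZ : CMDiffAt ∞ (T% Z) x) :
    curvature X Y Z x = ∑ i, (inner ℝ (e i x) (X x) : ℝ) • curvature (e i) Y Z x :=
  (he.tensorialAt_curvature_left hx hZ).eq_sum he hx hX

lemma curvature_eq_sum_middle (he : IsOrthonormalFrameOn e N) (hx : x ∈ N)
    (hY : MDiffAt (T% Y) x) (hZ : CMDiffAt ∞ (T% Z) x) :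
    curvature X Y Z x = ∑ i, (inner ℝ (e i x) (Y x) : ℝ) • curvature X (e i) Z x := by
  rw [curvature_swap, he.curvature_eq_sum_left hx hY hZ, ← Finset.sum_neg_distrib]
  exact Finset.sum_congr rfl fun i _ ↦ by rw [curvature_swap, smul_neg, neg_neg]

lemma leviCivita_smul_eventuallyEq {g : M → ℝ} (hg : CMDiffAt ∞ g x) (hZ : CMDiffAt ∞ (T% Z) x)
    (Y : Π x : M, TangentSpace I x) :
    ∀ᶠ y in 𝓝 x, leviCivita I M (g • Z) y (Y y) =
      (g • (fun y ↦ leviCivita I M Z y (Y y)) + (fun y ↦ mvfderiv I g y (Y y)) • Z) y := by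
  filter_upwards [hg.eventually_mdiffAt, hZ.eventually_mdiffAt] with y hgy hZy
  exact leviCivita_smul hgy hZy _

/-- The first derivatives of `g` cancel by symmetry and the second ones by the commutator formula
for `[X, Y] g`. The unit length of `Z` serves only that formula and holds for frame fields, to which
the lemma is applied. -/
lemma curvature_smul_right (he : IsOrthonormalFrameOn e N) (hx : x ∈ N) {g : M → ℝ}
    (hg : CMDiffAt ∞ g x) (hX : CMDiffAt ∞ (T% X) x) (hY : CMDiffAt ∞ (T% Y) x)
    (hZ : CMDiffAt ∞ (T% Z) x) (hZ1 : ∀ᶠ y in 𝓝 x, (inner ℝ (Z y) (Z y) : ℝ) = 1) :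
    curvature X Y (g • Z) x = g x • curvature X Y Z x := by
  have md : ∀ {W : Π x : M, TangentSpace I x}, CMDiffAt ∞ (T% W) x → MDiffAt (T% W) x :=
    fun hW ↦ hW.mdifferentiableAt (by simp)
  have hgx : MDiffAt g x := hg.mdifferentiableAt (by simp)
  have hd : ∀ {W : Π x : M, TangentSpace I x}, CMDiffAt ∞ (T% W) x →
      MDiffAt (fun y ↦ mvfderiv I g y (W y)) x := fun hW ↦
    (contMDiffAt_mvfderiv_apply hg hW hZ hZ1).mdifferentiableAt (by simp)
  have key : ∀ {V W : Π x : M, TangentSpace I x}, CMDiffAt ∞ (T% W) x →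
      leviCivita I M (fun y ↦ leviCivita I M (g • Z) y (W y)) x (V x) =
      g x • leviCivita I M (fun y ↦ leviCivita I M Z y (W y)) x (V x)
        + mvfderiv I g x (V x) • leviCivita I M Z x (W x)
        + (mvfderiv I g x (W x) • leviCivita I M Z x (V x)
        + mvfderiv I (fun y ↦ mvfderiv I g y (W y)) x (V x) • Z x) := by
    intro V W hW
    have h1 := he.mdiffAt_leviCivita hx (md hW) hZ
    have a1 := hgx.smul_section h1
    have a2 := (hd hW).smul_section (md hZ)
    rw [leviCivita_congr (mdifferentiableAt_add_section a1 a2)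
      (leviCivita_smul_eventuallyEq hg hZ W), leviCivita_add a1 a2, add_apply,
      leviCivita_smul hgx h1, leviCivita_smul (hd hW) (md hZ)]
  rw [curvature, key hY, key hX, leviCivita_smul hgx (md hZ),
    mvfderiv_mlieBracket hg hX hY hZ hZ1, curvature]
  module

/-- The curvature differentiates `Z` twice, so differentiability at a point is not enough for
tensoriality in this slot. Instead `Z` is expanded in the frame on a neighbourhood, with smooth
coefficients that are pulled out one by one. -/
lemma curvature_eq_sum_right (he : IsOrthonormalFrameOn e N) (hx : x ∈ N)
    (hX : CMDiffAt ∞ (T% X) x) (hY : CMDiffAt ∞ (T% Y) x) (hZ : CMDiffAt ∞ (T% Z) x) :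
    curvature X Y Z x = ∑ i, (inner ℝ (e i x) (Z x) : ℝ) • curvature X Y (e i) x := by
  have md : ∀ {W : Π x : M, TangentSpace I x}, CMDiffAt ∞ (T% W) x → MDiffAt (T% W) x :=
    fun hW ↦ hW.mdifferentiableAt (by simp)
  set g : ι → M → ℝ := fun i y ↦ inner ℝ (e i y) (Z y) with hgdef
  have hg : ∀ i, CMDiffAt ∞ (g i) x := fun i ↦ contMDiffAt_inner (he.contMDiffAt i x hx) hZ
  have hs : ∀ i, CMDiffAt ∞ (T% (g i • e i)) x := fun i ↦
    (hg i).smul_section (he.contMDiffAt i x hx)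
  have hZs : ∀ᶠ y in 𝓝 x, ∀ᶠ z in 𝓝 y, Z z = ∑ i, (g i • e i) z :=
    (he.eventually_eq_sum hx Z).eventually_nhds
  have hsy : ∀ᶠ y in 𝓝 x, ∀ i, MDiffAt (T% (g i • e i)) y :=
    Filter.eventually_all.2 fun i ↦ (hs i).eventually_mdiffAt
  have hcov : ∀ᶠ y in 𝓝 x, leviCivita I M Z y = ∑ i, leviCivita I M (g i • e i) y := by
    filter_upwards [hZs, hsy] with y h1 h2
    rw [← leviCivita_sum _ h2]
    exact leviCivita_congr (.sum_section fun i _ ↦ h2 i) h1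
  have h2 : ∀ {V W : Π x : M, TangentSpace I x}, CMDiffAt ∞ (T% W) x →
      leviCivita I M (fun y ↦ leviCivita I M Z y (W y)) x (V x) =
      ∑ i, leviCivita I M (fun y ↦ leviCivita I M (g i • e i) y (W y)) x (V x) := by
    intro V W hW
    have h3 := fun i ↦ he.mdiffAt_leviCivita hx (md hW) (hs i)
    rw [← sum_apply, ← leviCivita_sum _ h3, leviCivita_congr (.sum_section fun i _ ↦ h3 i)]
    filter_upwards [hcov] with y hy
    rw [hy, sum_apply]
  have : curvature X Y Z x = ∑ i, curvature X Y (g i • e i) x := by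
    rw [curvature, h2 hY, h2 hX, hcov.self_of_nhds, sum_apply]
    simp only [curvature, Finset.sum_sub_distrib]
  rw [this]
  exact Finset.sum_congr rfl fun i _ ↦ he.curvature_smul_right hx (hg i) hX hY
    (he.contMDiffAt i x hx) (he.eventually_inner_self hx i)

lemma curvatureAt_eq_sum (he : IsOrthonormalFrameOn e N) (hx : x ∈ N)
    (u v w : TangentSpace I x) :
    curvatureAt x u v w = ∑ i, ∑ j, ∑ k, ((inner ℝ (e i x) u : ℝ) * inner ℝ (e j x) v *
      inner ℝ (e k x) w) • curvature (e i) (e j) (e k) x := by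
  have hext : ∀ u : TangentSpace I x,
      CMDiffAt ∞ (T% (FiberBundle.extend E u : Π y : M, TangentSpace I y)) x := fun u ↦
    FiberBundle.contMDiffAt_extend ..
  have hext' : ∀ u : TangentSpace I x,
      MDiffAt (T% (FiberBundle.extend E u : Π y : M, TangentSpace I y)) x := fun u ↦
    FiberBundle.mdifferentiableAt_extend ..
  rw [curvatureAt, he.curvature_eq_sum_left hx (hext' u) (hext w)]
  simp only [FiberBundle.extend_apply_self]
  refine Finset.sum_congr rfl fun i _ ↦ ?_
  rw [he.curvature_eq_sum_middle hx (hext' v) (hext w), Finset.smul_sum]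
  simp only [FiberBundle.extend_apply_self]
  refine Finset.sum_congr rfl fun j _ ↦ ?_
  rw [he.curvature_eq_sum_right hx (he.contMDiffAt i x hx) (he.contMDiffAt j x hx) (hext w),
    Finset.smul_sum, Finset.smul_sum]
  simp only [FiberBundle.extend_apply_self]
  exact Finset.sum_congr rfl fun k _ ↦ by rw [smul_smul, smul_smul, mul_assoc]

/-- The scalar curvature can be computed in every orthonormal frame. -/
lemma scalarCurvature_eq (he : IsOrthonormalFrameOn e N) (hx : x ∈ N) :
    scalarCurvature I x =
      ∑ i, ∑ j, (inner ℝ (curvature (e i) (e j) (e j) x) (e i x) : ℝ) := by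
  classical
  set u := stdOrthonormalBasis ℝ (TangentSpace I x) with hu
  -- Parseval's identity for the reference basis `u`: once the sums over `u` are moved inside, they
  -- collapse to Kronecker deltas.
  have hpar : ∀ i j, ∑ a, (inner ℝ (e i x) (u a) : ℝ) * inner ℝ (e j x) (u a) =
      if i = j then 1 else 0 := by
    intro i j
    rw [← he.inner_eq hx, ← u.sum_inner_mul_inner]
    exact Finset.sum_congr rfl fun a _ ↦ by rw [real_inner_comm (u a) (e j x)]
  have h1 : scalarCurvature I x = ∑ a, ∑ b, ∑ i, ∑ j, ∑ k, ∑ l,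
      ((inner ℝ (e i x) (u a) : ℝ) * inner ℝ (e l x) (u a)) *
      ((inner ℝ (e j x) (u b) : ℝ) * inner ℝ (e k x) (u b)) *
      inner ℝ (curvature (e i) (e j) (e k) x) (e l x) := by
    refine Finset.sum_congr rfl fun a _ ↦ Finset.sum_congr rfl fun b _ ↦ ?_
    rw [he.curvatureAt_eq_sum hx]
    simp only [sum_inner, inner_smul_left, RCLike.conj_to_real]
    refine Finset.sum_congr rfl fun i _ ↦ Finset.sum_congr rfl fun j _ ↦
      Finset.sum_congr rfl fun k _ ↦ ?_
    have hK : ∀ K : TangentSpace I x, (inner ℝ K (u a) : ℝ) =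
        ∑ l, inner ℝ (e l x) (u a) * inner ℝ K (e l x) := fun K ↦ by
      conv_lhs => rw [← he.sum_inner_smul hx (u a), inner_sum]
      exact Finset.sum_congr rfl fun l _ ↦ inner_smul_right _ _ _
    rw [hK (curvature (e i) (e j) (e k) x), Finset.mul_sum]
    exact Finset.sum_congr rfl fun l _ ↦ by ring
  have h2 : scalarCurvature I x = ∑ i, ∑ j, ∑ k, ∑ l,
      (∑ a, (inner ℝ (e i x) (u a) : ℝ) * inner ℝ (e l x) (u a)) *
      (∑ b, (inner ℝ (e j x) (u b) : ℝ) * inner ℝ (e k x) (u b)) *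
      inner ℝ (curvature (e i) (e j) (e k) x) (e l x) := by
    rw [h1]
    simp only [Finset.sum_mul_sum]
    simp only [Finset.sum_mul, ← Fintype.sum_prod_type']
    -- The equivalence sends `(a, b, i, j, k, l)` to `(i, j, k, l, a, b)`.
    exact Fintype.sum_equiv
      ⟨fun p ↦ (p.2.2.1, p.2.2.2.1, p.2.2.2.2.1, p.2.2.2.2.2, p.1, p.2.1),
        fun p ↦ (p.2.2.2.2.1, p.2.2.2.2.2, p.1, p.2.1, p.2.2.1, p.2.2.2.1),
        fun _ ↦ rfl, fun _ ↦ rfl⟩ _ _ fun _ ↦ rfl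
  rw [h2]
  simp [hpar]

lemma mvfderiv_connectionCoeff (he : IsOrthonormalFrameOn e N) (hx : x ∈ N) (i j k l : ι) :
    mvfderiv I (connectionCoeff e j k l) x (e i x) =
      inner ℝ (leviCivita I M (fun y ↦ leviCivita I M (e k) y (e j y)) x (e i x)) (e l x)
        + ∑ m, connectionCoeff e j k m x * connectionCoeff e i l m x := by
  have h := mvfderiv_inner_leviCivita (he.mdiffAt hx i)
    ((he.contMDiffAt_leviCivita hx j k).mdifferentiableAt (by simp)) (he.mdiffAt hx l)
  rw [he.leviCivita_eq_sum hx i l, inner_sum] at h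
  simp only [inner_smul_right] at h
  refine h.trans ?_
  congr 1
  exact Finset.sum_congr rfl fun m _ ↦ mul_comm _ _

/-- Metric compatibility trades each second covariant derivative for a derivative of a connection
coefficient minus a quadratic term; the bracket is expanded in the frame by torsion-freeness. -/
lemma inner_curvature (he : IsOrthonormalFrameOn e N) (hx : x ∈ N) (i j k l : ι) :
    (inner ℝ (curvature (e i) (e j) (e k) x) (e l x) : ℝ) =
      mvfderiv I (connectionCoeff e j k l) x (e i x)
        - ∑ m, connectionCoeff e j k m x * connectionCoeff e i l m x
        - (mvfderiv I (connectionCoeff e i k l) x (e j x)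
          - ∑ m, connectionCoeff e i k m x * connectionCoeff e j l m x)
        - ∑ m, (connectionCoeff e i j m x - connectionCoeff e j i m x) *
          connectionCoeff e m k l x := by
  rw [he.mvfderiv_connectionCoeff hx, he.mvfderiv_connectionCoeff hx, curvature, inner_sub_left,
    inner_sub_left]
  have h : (inner ℝ (leviCivita I M (e k) x (VectorField.mlieBracket I (e i) (e j) x)) (e l x) : ℝ)
      = ∑ m, (connectionCoeff e i j m x - connectionCoeff e j i m x) *
          connectionCoeff e m k l x := by
    conv_lhs => rw [← he.sum_inner_smul hx (VectorField.mlieBracket I (e i) (e j) x)]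
    rw [map_sum, sum_inner]
    refine Finset.sum_congr rfl fun m _ ↦ ?_
    rw [map_smul, real_inner_smul_left, real_inner_comm, he.inner_mlieBracket hx]
    rfl
  rw [h]
  ring

lemma mvfderiv_connectionCoeff_anti (he : IsOrthonormalFrameOn e N) (hx : x ∈ N) (i j k : ι)
    (v : TangentSpace I x) :
    mvfderiv I (connectionCoeff e i j k) x v = -mvfderiv I (connectionCoeff e i k j) x v := by
  have : connectionCoeff e i j k =ᶠ[𝓝 x] -connectionCoeff e i k j :=
    Filter.eventually_of_mem (he.isOpen.mem_nhds hx) fun y hy ↦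
      he.connectionCoeff_anti hy i j k
  have h : mvfderiv I (connectionCoeff e i j k) x = mvfderiv I (-connectionCoeff e i k j) x := by
    rw [mvfderiv, mvfderiv, this.mfderiv_eq]
    rfl
  rw [h, mvfderiv_neg]
  rfl

/-- The trace of the connection coefficients of a frame, that is, the components of
`∑ i, ∇_{e i} e i`. -/
def _root_.RiemannianGeometry.meanCoeff (e : ι → Π x : M, TangentSpace I x) (j : ι) (x : M) : ℝ :=
  ∑ i, connectionCoeff e i i j x

lemma contMDiffAt_meanCoeff (he : IsOrthonormalFrameOn e N) (hx : x ∈ N) (j : ι) :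
    CMDiffAt ∞ (meanCoeff e j) x :=
  contMDiffAt_finsetSum fun i _ ↦ he.contMDiffAt_connectionCoeff hx i i j

lemma mdiffAt_fun_sum {κ : Type*} (s : Finset κ) {g : κ → M → ℝ}
    (hg : ∀ k, MDiffAt (g k) x) : MDiffAt (fun y ↦ ∑ k ∈ s, g k y) x := by
  classical
  induction s using Finset.induction_on with
  | empty => simpa using mdifferentiableAt_const
  | insert a s ha ih =>
    simp only [Finset.sum_insert ha]
    exact (hg a).add ih

lemma mvfderiv_fun_sum {κ : Type*} (s : Finset κ) {g : κ → M → ℝ}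
    (hg : ∀ k, MDiffAt (g k) x) (v : TangentSpace I x) :
    mvfderiv I (fun y ↦ ∑ k ∈ s, g k y) x v = ∑ k ∈ s, mvfderiv I (g k) x v := by
  classical
  induction s using Finset.induction_on with
  | empty => simp [mvfderiv_const]
  | insert a s ha ih =>
    simp only [Finset.sum_insert ha]
    rw [mvfderiv_fun_add (hg a) (mdiffAt_fun_sum s hg), add_apply, ih]

lemma scalarCurvature_eq_connectionCoeff (he : IsOrthonormalFrameOn e N) (hx : x ∈ N) :
    scalarCurvature I x = 2 * ∑ j, mvfderiv I (meanCoeff e j) x (e j x)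
      - ∑ j, (∑ i, connectionCoeff e i i j x) ^ 2
      - ∑ i, ∑ j, ∑ m, connectionCoeff e i j m x * connectionCoeff e m j i x := by
  rw [he.scalarCurvature_eq hx]
  simp only [he.inner_curvature hx]
  rw [scalarCurvature_frame_algebra (fun i j k ↦ connectionCoeff e i j k x)
    (fun l i j k ↦ mvfderiv I (connectionCoeff e i j k) x (e l x)) (he.connectionCoeff_anti hx)
    (fun l i j k ↦ he.mvfderiv_connectionCoeff_anti hx i j k (e l x))]
  congr 4
  ext j
  exact (mvfderiv_fun_sum _ (fun i ↦
    (he.contMDiffAt_connectionCoeff hx i i j).mdifferentiableAt (by simp)) _).symm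

end IsOrthonormalFrameOn

end

end RiemannianGeometry

/-! ### Eigenframes of a Codazzi tensor and the divergence formula -/

namespace RiemannianGeometry

noncomputable section

set_option linter.unusedSectionVars false

variable {E : Type*} [NormedAddCommGroup E] [NormedSpace ℝ E] [FiniteDimensional ℝ E]
  [CompleteSpace E]
  {H : Type*} [TopologicalSpace H] {I : ModelWithCorners ℝ E H}
  {M : Type*} [TopologicalSpace M] [ChartedSpace H M] [IsManifold I ∞ M]
  [RiemannianBundle (fun x : M ↦ TangentSpace I x)]
  [IsContMDiffRiemannianBundle I ∞ E (fun x : M ↦ TangentSpace I x)]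
  {ι : Type*} [Fintype ι] [DecidableEq ι]

open Polynomial in
/-- An orthonormal frame diagonalizing the symmetric tensor field `a`. The eigenvalues `μ i` are
distinct and vary with the constant term `-f` of the characteristic polynomial only. -/
structure IsEigenframeOn (a : Π x : M, TangentSpace I x →L[ℝ] TangentSpace I x →L[ℝ] ℝ)
    (f : M → ℝ) (e : ι → Π x : M, TangentSpace I x) (μ : ι → M → ℝ) (N : Set M) : Prop
    extends IsOrthonormalFrameOn e N where
  injective : ∀ x ∈ N, Function.Injective fun i ↦ μ i x
  apply_left : ∀ x ∈ N, ∀ i v, a x (e i x) v = μ i x * inner ℝ (e i x) v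
  mdiffAt_eigenvalue : ∀ i, ∀ x ∈ N, MDiffAt (μ i) x
  mvfderiv_eigenvalue : ∀ x ∈ N, ∀ i v, mvfderiv I (μ i) x v =
    mvfderiv I f x v / (derivative (nodalPoly fun k ↦ μ k x)).eval (μ i x)

namespace IsEigenframeOn

variable {a : Π x : M, TangentSpace I x →L[ℝ] TangentSpace I x →L[ℝ] ℝ} {f : M → ℝ}
  {e : ι → Π x : M, TangentSpace I x} {μ : ι → M → ℝ} {N : Set M} {x : M}

lemma covDerivTensor_eq (he : IsEigenframeOn a f e μ N) (hx : x ∈ N)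
    (ha : ∀ (x : M) (v w : TangentSpace I x), a x v w = a x w v) (k i j : ι) :
    covDerivTensor a (e k) (e i) (e j) x =
      codazziCoeff (fun i j k ↦ connectionCoeff e i j k x) (fun i ↦ μ i x)
        (fun k ↦ mvfderiv I f x (e k x)) k i j := by
  have h1 : (fun y ↦ a y (e i y) (e j y)) =ᶠ[𝓝 x] if i = j then μ i else fun _ ↦ 0 := by
    refine Filter.eventually_of_mem (he.isOpen.mem_nhds hx) fun y hy ↦ ?_
    dsimp only
    rw [he.apply_left y hy, he.inner_eq hy]
    split_ifs <;> simp
  have h2 : mvfderiv I (fun y ↦ a y (e i y) (e j y)) x =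
      mvfderiv I (if i = j then μ i else fun _ ↦ 0) x := by
    have := h1.self_of_nhds
    rw [mvfderiv, mvfderiv, h1.mfderiv_eq]
    rfl
  rw [covDerivTensor, h2, ha x (leviCivita I M (e i) x (e k x)), he.apply_left x hx,
    he.apply_left x hx, codazziCoeff, real_inner_comm]
  have h3 := he.connectionCoeff_anti hx k j i
  have h4 : (inner ℝ (leviCivita I M (e i) x (e k x)) (e j x) : ℝ) = connectionCoeff e k i j x :=
    rfl
  have h5 : (inner ℝ (e i x) (leviCivita I M (e j) x (e k x)) : ℝ) = connectionCoeff e k j i x :=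
    real_inner_comm _ _
  rw [h4, h5, h3]
  split_ifs with h
  · rw [he.mvfderiv_eigenvalue x hx]; ring
  · rw [mvfderiv_const]; simp; ring

lemma codazziCoeff_symm (he : IsEigenframeOn a f e μ N) (hx : x ∈ N)
    (ha : ∀ (x : M) (v w : TangentSpace I x), a x v w = a x w v) (hcod : IsCodazzi a)
    (k i j : ι) :
    codazziCoeff (fun i j k ↦ connectionCoeff e i j k x) (fun i ↦ μ i x)
        (fun k ↦ mvfderiv I f x (e k x)) k i j =
      codazziCoeff (fun i j k ↦ connectionCoeff e i j k x) (fun i ↦ μ i x)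
        (fun k ↦ mvfderiv I f x (e k x)) i k j := by
  rw [← he.covDerivTensor_eq hx ha, ← he.covDerivTensor_eq hx ha]
  exact hcod x _ _ _ (he.mdiffAt hx k) (he.mdiffAt hx i) (he.mdiffAt hx j)

open Polynomial in
-- The partial fraction identity sums the coefficients in closed form. The result involves no
-- derivative of the frame, so it compares different eigenframes at a point, and Laguerre's
-- inequality bounds its second factor.
lemma meanCoeff_eq (he : IsEigenframeOn a f e μ N) (hx : x ∈ N)
    (ha : ∀ (x : M) (v w : TangentSpace I x), a x v w = a x w v) (hcod : IsCodazzi a) (j : ι) :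
    meanCoeff e j x = mvfderiv I f x (e j x) *
      ((derivative (derivative (nodalPoly fun k ↦ μ k x))).eval (μ j x) /
        (2 * (derivative (nodalPoly fun k ↦ μ k x)).eval (μ j x) ^ 2)) := by
  rw [← sum_gapCoeff (he.injective x hx) j]
  exact sum_connection_diag (he.injective x hx) (he.connectionCoeff_anti hx)
    (he.codazziCoeff_symm hx ha hcod) j

/-- The divergence of the vector field `∑ i, ∇_{e i} e i` of an eigenframe. -/
lemma divergence_eq (he : IsEigenframeOn a f e μ N) (hx : x ∈ N)
    (ha : ∀ (x : M) (v w : TangentSpace I x), a x v w = a x w v) (hcod : IsCodazzi a) :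
    2 * (∑ j, mvfderiv I (meanCoeff e j) x (e j x) - ∑ j, meanCoeff e j x ^ 2) =
      scalarCurvature I x +
        ∑ j, mvfderiv I f x (e j x) ^ 2 * gapDefect (fun k ↦ μ k x) j :=
  divergence_frame_algebra (he.injective x hx) (he.connectionCoeff_anti hx)
    (he.codazziCoeff_symm hx ha hcod) (he.scalarCurvature_eq_connectionCoeff hx)

end IsEigenframeOn

end

end RiemannianGeometry

/-! ### Smooth orthonormal frames and smoothness of the dual endomorphism -/

namespace RiemannianGeometry

noncomputable section

set_option linter.unusedSectionVars false

variable {E : Type*} [NormedAddCommGroup E] [NormedSpace ℝ E] [FiniteDimensional ℝ E]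
  [CompleteSpace E]
  {H : Type*} [TopologicalSpace H] {I : ModelWithCorners ℝ E H}
  {M : Type*} [TopologicalSpace M] [ChartedSpace H M] [IsManifold I ∞ M]
  [RiemannianBundle (fun x : M ↦ TangentSpace I x)]
  [IsContMDiffRiemannianBundle I ∞ E (fun x : M ↦ TangentSpace I x)]

open IsOrthonormalFrameOn (contMDiffAt_inner)

lemma contMDiffAt_inv_norm_smul {X : Π x : M, TangentSpace I x} {x : M}
    (hX : CMDiffAt ∞ (T% X) x) (h0 : X x ≠ 0) :
    CMDiffAt ∞ (T% (fun y ↦ ‖X y‖⁻¹ • X y)) x := by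
  have h1 : CMDiffAt ∞ (fun y ↦ (inner ℝ (X y) (X y) : ℝ)) x := contMDiffAt_inner hX hX
  have h2 : (inner ℝ (X x) (X x) : ℝ) ≠ 0 := inner_self_ne_zero.2 h0
  have h3 : ContDiffAt ℝ ∞ (fun t : ℝ ↦ (Real.sqrt t)⁻¹) (inner ℝ (X x) (X x)) :=
    (Real.contDiffAt_sqrt h2).inv (Real.sqrt_ne_zero'.2 (real_inner_self_pos.2 h0))
  have h4 : CMDiffAt ∞ (fun y ↦ ‖X y‖⁻¹) x := by
    have := h3.contMDiffAt.comp x h1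
    refine this.congr_of_eventuallyEq (.of_forall fun y ↦ ?_)
    exact congrArg Inv.inv (norm_eq_sqrt_real_inner (X y))
  exact h4.smul_section hX

/-- Gram–Schmidt orthogonalization preserves smoothness. -/
lemma contMDiffAt_gramSchmidt {n : ℕ} {s : Fin n → Π x : M, TangentSpace I x} {x : M}
    (hs : ∀ i, CMDiffAt ∞ (T% (s i)) x) (hli : LinearIndependent ℝ fun i ↦ s i x) (i : Fin n) :
    CMDiffAt ∞ (T% (fun y ↦ InnerProductSpace.gramSchmidt ℝ (fun j ↦ s j y) i)) x := by
  induction i using WellFoundedLT.induction with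
  | ind i ih =>
    have h : CMDiffAt ∞ (T% (fun y ↦ s i y - ∑ j ∈ Finset.Iio i,
        ((inner ℝ (InnerProductSpace.gramSchmidt ℝ (fun j ↦ s j y) j) (s i y) : ℝ) /
          (inner ℝ (InnerProductSpace.gramSchmidt ℝ (fun j ↦ s j y) j)
            (InnerProductSpace.gramSchmidt ℝ (fun j ↦ s j y) j) : ℝ)) •
          InnerProductSpace.gramSchmidt ℝ (fun j ↦ s j y) j)) x := by
      refine (hs i).sub_section (ContMDiffAt.sum_section fun j hj ↦ ?_)
      have hj' := ih j (Finset.mem_Iio.1 hj)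
      refine ContMDiffAt.smul_section ?_ hj'
      exact (contMDiffAt_inner hj' (hs i)).div₀ (contMDiffAt_inner hj' hj')
        (inner_self_ne_zero.2 (InnerProductSpace.gramSchmidt_ne_zero j hli))
    refine h.congr_of_eventuallyEq (.of_forall fun y ↦ ?_)
    refine congrArg (TotalSpace.mk' E y) ?_
    rw [InnerProductSpace.gramSchmidt_def]
    refine congrArg (s i y - ·) (Finset.sum_congr rfl fun j _ ↦ ?_)
    rw [Submodule.starProjection_singleton, real_inner_self_eq_norm_sq]
    rfl

/-- Every point has a neighbourhood with a smooth orthonormal frame. -/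
lemma exists_isOrthonormalFrameOn {n : ℕ} (hn : Module.finrank ℝ E = n) (x : M) :
    ∃ (e : Fin n → Π x : M, TangentSpace I x) (N : Set M),
      x ∈ N ∧ IsOrthonormalFrameOn e N := by
  let t := trivializationAt E (TangentSpace I : M → Type _) x
  let b : Module.Basis (Fin n) ℝ E := Module.finBasisOfFinrankEq ℝ E hn
  let s := t.localFrame b
  have hs : ∀ y ∈ t.baseSet, ∀ i, CMDiffAt ∞ (T% (s i)) y := fun y hy i ↦
    contMDiffAt_localFrame_of_mem ∞ t b i hy
  have hli : ∀ y ∈ t.baseSet, LinearIndependent ℝ fun i ↦ s i y := fun y hy ↦ by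
    have := (t.basisAt b hy).linearIndependent
    have h : (fun i ↦ s i y) = t.basisAt b hy :=
      funext fun i ↦ t.localFrame_apply_of_mem_baseSet b hy
    rw [h]
    exact this
  refine ⟨fun i y ↦ InnerProductSpace.gramSchmidtNormed ℝ (fun j ↦ s j y) i, t.baseSet,
    FiberBundle.mem_baseSet_trivializationAt E _ x, t.open_baseSet, fun i y hy ↦ ?_,
    fun y hy ↦ InnerProductSpace.gramSchmidtNormed_orthonormal (hli y hy), by simp [hn]⟩
  exact contMDiffAt_inv_norm_smul (contMDiffAt_gramSchmidt (hs y hy) (hli y hy) i)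
    (InnerProductSpace.gramSchmidt_ne_zero i (hli y hy))

lemma contMDiffAt_apply_tensor
    {a : Π x : M, TangentSpace I x →L[ℝ] TangentSpace I x →L[ℝ] ℝ} (ha : IsSmoothTensor a)
    {X Y : Π x : M, TangentSpace I x} {x : M}
    (hX : CMDiffAt ∞ (T% X) x) (hY : CMDiffAt ∞ (T% Y) x) :
    CMDiffAt ∞ (fun y ↦ a y (X y) (Y y)) x := by
  have h := ContMDiffAt.clm_bundle_apply₂ (E₃ := fun _ : M ↦ ℝ) (F₃ := ℝ) (b := fun y : M ↦ y)
    (ψ := a) ha.contMDiffAt hX hY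
  simp only [contMDiffAt_totalSpace] at h
  exact h.2

lemma sharp_eq_sum {V : Type*} [NormedAddCommGroup V] [InnerProductSpace ℝ V]
    [FiniteDimensional ℝ V] {ι : Type*} [Fintype ι] (b : OrthonormalBasis ι ℝ V)
    (B : V →L[ℝ] V →L[ℝ] ℝ) (v : V) : sharp B v = ∑ i, B v (b i) • b i := by
  rw [← b.sum_repr' (sharp B v)]
  exact Finset.sum_congr rfl fun i _ ↦ by rw [real_inner_comm, inner_sharp]

lemma contMDiffAt_dualEndo
    {a : Π x : M, TangentSpace I x →L[ℝ] TangentSpace I x →L[ℝ] ℝ} (ha : IsSmoothTensor a)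
    {X : Π x : M, TangentSpace I x} {x : M} (hX : CMDiffAt ∞ (T% X) x) :
    CMDiffAt ∞ (T% (fun y ↦ dualEndo a y (X y))) x := by
  obtain ⟨e, N, hx, he⟩ := exists_isOrthonormalFrameOn (I := I) rfl x
  have h : CMDiffAt ∞ (T% (fun y ↦ ∑ i, a y (X y) (e i y) • e i y)) x :=
    ContMDiffAt.sum_section fun i _ ↦
      (contMDiffAt_apply_tensor ha hX (he.contMDiffAt i x hx)).smul_section (he.contMDiffAt i x hx)
  refine h.congr_of_eventuallyEq ?_
  filter_upwards [he.isOpen.mem_nhds hx] with y hy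
  have := sharp_eq_sum (he.basis hy) (a y) (X y)
  simp only [he.basis_apply] at this
  simp only [← this]
  rfl

lemma contMDiff_det_dualEndo
    {a : Π x : M, TangentSpace I x →L[ℝ] TangentSpace I x →L[ℝ] ℝ} (ha : IsSmoothTensor a) :
    CMDiff ∞ (fun y ↦ LinearMap.det (dualEndo a y)) := by
  intro x
  obtain ⟨e, N, hx, he⟩ := exists_isOrthonormalFrameOn (I := I) rfl x
  have h : CMDiffAt ∞ (fun y ↦ ∑ σ : Equiv.Perm (Fin (Module.finrank ℝ E)),
      ((Equiv.Perm.sign σ : ℤ) : ℝ) * ∏ i, a y (e i y) (e (σ i) y)) x := by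
    refine ContMDiffAt.sum fun σ _ ↦ contMDiffAt_const.mul ?_
    refine ContMDiffAt.prod fun i _ ↦ ?_
    exact contMDiffAt_apply_tensor ha (he.contMDiffAt i x hx) (he.contMDiffAt (σ i) x hx)
  refine h.congr_of_eventuallyEq ?_
  filter_upwards [he.isOpen.mem_nhds hx] with y hy
  rw [← LinearMap.det_toMatrix (he.basis hy).toBasis, Matrix.det_apply']
  refine Finset.sum_congr rfl fun σ _ ↦ ?_
  congr 1
  refine Finset.prod_congr rfl fun i _ ↦ ?_
  rw [LinearMap.toMatrix_apply]
  simp only [OrthonormalBasis.coe_toBasis, OrthonormalBasis.coe_toBasis_repr_apply,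
    OrthonormalBasis.repr_apply_apply, he.basis_apply]
  rw [real_inner_comm]
  exact inner_sharp _ _ _

end

end RiemannianGeometry

/-! ### Characteristic polynomials, simple roots and existence of eigenframes -/

namespace RiemannianGeometry

noncomputable section

set_option linter.unusedSectionVars false

section Spectral

open Polynomial

variable {V : Type*} [NormedAddCommGroup V] [InnerProductSpace ℝ V] [FiniteDimensional ℝ V]
  {ι : Type*} [Fintype ι] [DecidableEq ι]

lemma charpoly_eq_nodalPoly (b : OrthonormalBasis ι ℝ V) {A : V →ₗ[ℝ] V} {μ : ι → ℝ}
    (h : ∀ i, A (b i) = μ i • b i) : A.charpoly = nodalPoly μ := by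
  have : LinearMap.toMatrix b.toBasis b.toBasis A = Matrix.diagonal μ := by
    ext i j
    rw [LinearMap.toMatrix_apply, OrthonormalBasis.coe_toBasis, h, map_smul]
    simp [Matrix.diagonal_apply, OrthonormalBasis.repr_self]
    grind
  rw [← A.charpoly_toMatrix b.toBasis, this, Matrix.charpoly_diagonal]
  rfl

lemma trace_pow_eq_sum (b : OrthonormalBasis ι ℝ V) {A : V →ₗ[ℝ] V} {μ : ι → ℝ}
    (h : ∀ i, A (b i) = μ i • b i) (k : ℕ) : LinearMap.trace ℝ V (A ^ k) = ∑ i, μ i ^ k := by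
  rw [LinearMap.trace_eq_sum_inner _ b]
  have hk : ∀ k i, (A ^ k) (b i) = μ i ^ k • b i := by
    intro k i
    induction k with
    | zero => simp
    | succ k ih => rw [pow_succ, Module.End.mul_apply, h, map_smul, ih, smul_smul, pow_succ']
  simp [hk, inner_smul_right]

lemma coeff_zero_nodalPoly (b : OrthonormalBasis ι ℝ V) {A : V →ₗ[ℝ] V} {μ : ι → ℝ}
    (h : ∀ i, A (b i) = μ i • b i) :
    (nodalPoly μ).coeff 0 = (-1) ^ Module.finrank ℝ V * LinearMap.det A := by
  rw [LinearMap.det_eq_sign_charpoly_coeff, charpoly_eq_nodalPoly b h, ← mul_assoc, ← mul_pow]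
  simp

lemma natDegree_nodalPoly (μ : ι → ℝ) : (nodalPoly μ).natDegree = Fintype.card ι := by
  rw [nodalPoly, natDegree_prod_of_monic _ _ fun _ _ ↦ monic_X_sub_C _]; simp

lemma monic_nodalPoly (μ : ι → ℝ) : (nodalPoly μ).Monic :=
  monic_prod_of_monic _ _ fun _ _ ↦ monic_X_sub_C _

lemma eq_nodalPoly {p : ℝ[X]} (hp : p.Monic) (hd : p.natDegree = Fintype.card ι) {μ : ι → ℝ}
    (hμ : Function.Injective μ) (h : ∀ i, p.eval (μ i) = 0) : p = nodalPoly μ := by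
  refine eq_of_degree_sub_lt_of_eval_finset_eq (Finset.univ.image μ) ?_ ?_
  · rw [Finset.card_image_of_injective _ hμ, Finset.card_univ]
    refine (degree_sub_lt_left ?_ hp.ne_zero ?_).trans_le ?_
    · rw [degree_eq_natDegree hp.ne_zero, degree_eq_natDegree (monic_nodalPoly μ).ne_zero, hd,
        natDegree_nodalPoly]
    · rw [hp.leadingCoeff, (monic_nodalPoly μ).leadingCoeff]
    · rw [degree_eq_natDegree hp.ne_zero, hd]
  · intro t ht
    obtain ⟨i, -, rfl⟩ := Finset.mem_image.1 ht
    rw [h, eval_nodalPoly]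

/-- Simple roots of `Q - s` depend smoothly on `s`. -/
lemma exists_contDiffAt_roots [Nonempty ι] {Q : ℝ[X]} {s₀ : ℝ} {μ : ι → ℝ} (hμ : Function.Injective μ)
    (hQ : Q - C s₀ = nodalPoly μ) :
    ∃ L : ι → ℝ → ℝ, (∀ i, L i s₀ = μ i) ∧ ∀ᶠ s in 𝓝 s₀,
      (Function.Injective fun i ↦ L i s) ∧ Q - C s = nodalPoly (fun i ↦ L i s) ∧
      ∀ i, ContDiffAt ℝ ∞ (L i) s ∧
        deriv (L i) s = ((derivative (nodalPoly fun i ↦ L i s)).eval (L i s))⁻¹ := by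
  have hQ' : Q = nodalPoly μ + C s₀ := by rw [← hQ]; ring
  have hder : ∀ t, deriv (fun t ↦ Q.eval t) t = (derivative Q).eval t := fun t ↦ Q.deriv
  have hne : ∀ i, deriv (fun t ↦ Q.eval t) (μ i) ≠ 0 := fun i ↦ by
    rw [hder, hQ', derivative_add, derivative_C, add_zero]
    exact eval_derivative_nodalPoly_ne_zero hμ i
  have han : ∀ t, AnalyticAt ℝ (fun t ↦ Q.eval t) t := fun t ↦
    AnalyticOnNhd.eval_polynomial Q t trivial
  have hval : ∀ i, Q.eval (μ i) = s₀ := fun i ↦ by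
    rw [hQ', eval_add, eval_nodalPoly]; simp
  -- At a simple root `Q` has nonzero derivative; the root branch is its analytic local inverse, so
  -- `Q (L s) = s`.
  have H : ∀ i, ∃ L : ℝ → ℝ, L s₀ = μ i ∧ AnalyticAt ℝ L s₀ ∧ ∀ᶠ s in 𝓝 s₀, Q.eval (L s) = s := by
    intro i
    refine ⟨(han (μ i)).hasStrictDerivAt.localInverse _ _ _ (hne i), ?_, ?_, ?_⟩
    · conv_lhs => rw [← hval i]
      exact HasStrictFDerivAt.localInverse_apply_image ..
    · have := (han (μ i)).analyticAt_localInverse (hne i)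
      rwa [hval] at this
    · have := HasStrictDerivAt.eventually_right_inverse (han (μ i)).hasStrictDerivAt (hne i)
      rwa [hval] at this
  choose L hL0 hLan hLr using H
  have hdeg : 0 < Q.natDegree := by
    rw [hQ', natDegree_add_C, natDegree_nodalPoly]; exact Fintype.card_pos
  refine ⟨L, hL0, ?_⟩
  have hinj : ∀ᶠ s in 𝓝 s₀, Function.Injective fun i ↦ L i s := by
    have : ∀ᶠ s in 𝓝 s₀, ∀ i j, i ≠ j → L i s ≠ L j s := by
      rw [Filter.eventually_all]; intro i
      rw [Filter.eventually_all]; intro j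
      by_cases hij : i = j
      · simp [hij]
      · have h := ((hLan i).continuousAt.sub (hLan j).continuousAt).eventually_ne
          (y := 0) (by rw [Pi.sub_apply, hL0, hL0]; exact sub_ne_zero.2 (hμ.ne hij))
        filter_upwards [h] with s hs _ using sub_ne_zero.1 hs
    filter_upwards [this] with s hs i j hij
    by_contra h
    exact hs i j h hij
  have h1 : ∀ᶠ s in 𝓝 s₀, ∀ i, ∀ᶠ s' in 𝓝 s, Q.eval (L i s') = s' := by
    rw [Filter.eventually_all]; exact fun i ↦ (hLr i).eventually_nhds
  have h2 : ∀ᶠ s in 𝓝 s₀, ∀ i, AnalyticAt ℝ (L i) s := by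
    rw [Filter.eventually_all]; exact fun i ↦ (hLan i).eventually_analyticAt
  filter_upwards [hinj, h1, h2] with s hs1 hs2 hs3
  have hnod : Q - C s = nodalPoly fun i ↦ L i s := by
    refine eq_nodalPoly ?_ ?_ hs1 fun i ↦ ?_
    · have : (nodalPoly μ + C (s₀ - s)).Monic :=
        (monic_nodalPoly μ).add_of_left (degree_C_le.trans_lt (by
          rw [degree_eq_natDegree (monic_nodalPoly μ).ne_zero, natDegree_nodalPoly]
          exact_mod_cast Fintype.card_pos))
      rw [hQ']
      convert this using 1
      rw [C_sub]; ring
    · rw [natDegree_sub_C, hQ', natDegree_add_C, natDegree_nodalPoly]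
    · rw [eval_sub, (hs2 i).self_of_nhds, eval_C, sub_self]
  refine ⟨hs1, hnod, fun i ↦ ⟨(hs3 i).contDiffAt, ?_⟩⟩
  rw [← hnod, derivative_sub, derivative_C, sub_zero]
  have hd1 := (Q.hasDerivAt (L i s)).comp s (hs3 i).differentiableAt.hasDerivAt
  have hd2 : HasDerivAt (fun s' ↦ Q.eval (L i s')) 1 s :=
    (hasDerivAt_id s).congr_of_eventuallyEq (hs2 i)
  exact eq_inv_of_mul_eq_one_right (hd1.unique hd2)

end Spectral

variable {E : Type*} [NormedAddCommGroup E] [NormedSpace ℝ E] [FiniteDimensional ℝ E]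
  [CompleteSpace E]
  {H : Type*} [TopologicalSpace H] {I : ModelWithCorners ℝ E H}
  {M : Type*} [TopologicalSpace M] [ChartedSpace H M] [IsManifold I ∞ M]
  [RiemannianBundle (fun x : M ↦ TangentSpace I x)]
  [IsContMDiffRiemannianBundle I ∞ E (fun x : M ↦ TangentSpace I x)]

open IsOrthonormalFrameOn (contMDiffAt_inner)

variable {a : Π x : M, TangentSpace I x →L[ℝ] TangentSpace I x →L[ℝ] ℝ}

lemma inner_dualEndo (x : M) (v w : TangentSpace I x) :
    inner ℝ (dualEndo a x v) w = a x v w := inner_sharp _ _ _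

lemma isSymmetric_dualEndo (ha : ∀ (x : M) (v w : TangentSpace I x), a x v w = a x w v) (x : M) :
    (dualEndo a x).IsSymmetric := fun v w ↦ by
  rw [inner_dualEndo, real_inner_comm, inner_dualEndo, ha]

-- Eigenvector fields will be built by applying such products of `A - l i` to smooth fields.
open Polynomial in
lemma contMDiffAt_aeval_prod (ha : IsSmoothTensor a) {κ : Type*} {l : κ → M → ℝ} {x : M}
    {Z : Π x : M, TangentSpace I x} (hZ : CMDiffAt ∞ (T% Z) x) (S : Finset κ)
    (hl : ∀ i ∈ S, CMDiffAt ∞ (l i) x) :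
    CMDiffAt ∞ (T% (fun y ↦ aeval (dualEndo a y) (∏ i ∈ S, (X - C (l i y)) : ℝ[X]) (Z y))) x := by
  classical
  induction S using Finset.induction_on with
  | empty => simpa using hZ
  | insert i S hi ih =>
    have ih' := ih fun j hj ↦ hl j (Finset.mem_insert_of_mem hj)
    have h := (contMDiffAt_dualEndo ha ih').sub_section
      ((hl i (Finset.mem_insert_self i S)).smul_section ih')
    refine h.congr_of_eventuallyEq (.of_forall fun y ↦ ?_)
    refine congrArg (TotalSpace.mk' E y) ?_
    rw [Finset.prod_insert hi, map_mul, Module.End.mul_apply, map_sub, aeval_X, aeval_C]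
    rfl

open Polynomial in
/-- Around a point where the eigenvalues are distinct there is a smooth eigenframe, provided that
the characteristic polynomial depends on its constant term only. -/
lemma exists_isEigenframeOn {n : ℕ} (hn : Module.finrank ℝ E = n) (hn0 : 0 < n)
    (ha_smooth : IsSmoothTensor a)
    (ha : ∀ (x : M) (v w : TangentSpace I x), a x v w = a x w v) {f : M → ℝ} (hf : CMDiff ∞ f)
    {Q : ℝ[X]} (hQ : ∀ x, (dualEndo a x).charpoly = Q - C (f x)) {x : M} {ν : Fin n → ℝ}
    (hν : Function.Injective ν) (hνx : (dualEndo a x).charpoly = nodalPoly ν) :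
    ∃ (e : Fin n → Π x : M, TangentSpace I x) (μ : Fin n → M → ℝ) (N : Set M),
      x ∈ N ∧ IsEigenframeOn a f e μ N := by
  have : Nonempty (Fin n) := ⟨⟨0, hn0⟩⟩
  obtain ⟨L, hL0, hL⟩ := exists_contDiffAt_roots hν ((hQ x).symm.trans hνx)
  obtain ⟨e, N, hxN, he⟩ := exists_isOrthonormalFrameOn (I := I) hn x
  -- By Cayley–Hamilton the product of the `A - λ k` over `k ≠ i` maps every vector into the kernel
  -- of `A - λ i`.
  have hchar : ∀ y, (Function.Injective fun i ↦ L i (f y)) →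
      Q - C (f y) = nodalPoly (fun i ↦ L i (f y)) → ∀ (i : Fin n) (v : TangentSpace I y),
      dualEndo a y (aeval (dualEndo a y)
        (∏ k ∈ Finset.univ.erase i, (X - C (L k (f y))) : ℝ[X]) v) =
        L i (f y) • aeval (dualEndo a y)
          (∏ k ∈ Finset.univ.erase i, (X - C (L k (f y))) : ℝ[X]) v := by
    intro y _ hy i v
    have h1 := congrArg (fun T ↦ T v) (LinearMap.aeval_self_charpoly (dualEndo a y))
    simp only [hQ y, hy] at h1
    rw [nodalPoly_eq_mul _ i, map_mul, Module.End.mul_apply, map_sub, aeval_X, aeval_C] at h1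
    exact sub_eq_zero.1 h1
  have hsymm := isSymmetric_dualEndo ha
  have hfin : Module.finrank ℝ (TangentSpace I x) = n := hn
  obtain ⟨b, hb⟩ : ∃ b : Fin n → TangentSpace I x, ∀ i, b i ≠ 0 ∧
      dualEndo a x (b i) = ν i • b i := by
    have : ∀ i, ∃ v : TangentSpace I x, v ≠ 0 ∧ dualEndo a x v = ν i • v := by
      intro i
      have : (dualEndo a x).HasEigenvalue (ν i) := by
        rw [Module.End.hasEigenvalue_iff_isRoot_charpoly, hνx, IsRoot, eval_nodalPoly]
      obtain ⟨v, hv⟩ := this.exists_hasEigenvector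
      exact ⟨v, hv.2, hv.apply_eq_smul⟩
    choose b hb using this
    exact ⟨b, hb⟩
  -- The eigenvector `b i` at `x` is extended with constant coefficients in the smooth frame; the
  -- product above then turns it into a smooth field of eigenvectors.
  let Z : Fin n → Π y : M, TangentSpace I y := fun i y ↦
    ∑ j, (inner ℝ (e j x) (b i) : ℝ) • e j y
  have hZx : ∀ i, Z i x = b i := fun i ↦ he.sum_inner_smul hxN (b i)
  have hZ : ∀ i, ∀ y ∈ N, CMDiffAt ∞ (T% (Z i)) y := fun i y hy ↦
    ContMDiffAt.sum_section fun j _ ↦ contMDiffAt_const.smul_section (he.contMDiffAt j y hy)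
  let w : Fin n → Π y : M, TangentSpace I y := fun i y ↦ aeval (dualEndo a y)
    (∏ k ∈ Finset.univ.erase i, (X - C (L k (f y))) : ℝ[X]) (Z i y)
  have hev : ∀ᶠ y in 𝓝 x, (Function.Injective fun i ↦ L i (f y)) ∧
      Q - C (f y) = nodalPoly (fun i ↦ L i (f y)) ∧
      ∀ i, ContDiffAt ℝ ∞ (L i) (f y) ∧
        deriv (L i) (f y) = ((derivative (nodalPoly fun i ↦ L i (f y))).eval (L i (f y)))⁻¹ :=
    (hf.continuous.tendsto x).eventually hL
  have hLf : ∀ y, (∀ i, ContDiffAt ℝ ∞ (L i) (f y) ∧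
        deriv (L i) (f y) = ((derivative (nodalPoly fun i ↦ L i (f y))).eval (L i (f y)))⁻¹) →
      ∀ i, CMDiffAt ∞ (fun z ↦ L i (f z)) y := fun y hy i ↦
    (hy i).1.contMDiffAt.comp y (hf y)
  have hw : ∀ y ∈ N, (∀ i, ContDiffAt ℝ ∞ (L i) (f y) ∧
        deriv (L i) (f y) = ((derivative (nodalPoly fun i ↦ L i (f y))).eval (L i (f y)))⁻¹) →
      ∀ i, CMDiffAt ∞ (T% (w i)) y := fun y hy hy' i ↦
    contMDiffAt_aeval_prod ha_smooth (hZ i y hy) _ fun j _ ↦ hLf y hy' j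
  -- At `x` the product multiplies `b i` by the product of the `ν i - ν k`, which is nonzero as the
  -- `ν k` are distinct.
  have hw0 : ∀ i, w i x ≠ 0 := by
    intro i
    have h1 : w i x = (∏ k ∈ Finset.univ.erase i, (ν i - ν k)) • b i := by
      have h2 : ∀ S : Finset (Fin n), aeval (dualEndo a x)
          (∏ k ∈ S, (X - C (ν k)) : ℝ[X]) (b i) = (∏ k ∈ S, (ν i - ν k)) • b i := by
        intro S
        induction S using Finset.induction_on with
        | empty => simp
        | insert k S hk ih =>
          rw [Finset.prod_insert hk, Finset.prod_insert hk, map_mul, Module.End.mul_apply, ih,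
            map_smul, map_sub, aeval_X, aeval_C, mul_comm, ← smul_smul]
          refine congrArg _ ?_
          rw [sub_smul, ← (hb i).2]
          rfl
      have h3 : (fun k ↦ L k (f x)) = ν := funext hL0
      rw [← h2]
      simp only [w, hZx, hL0]
    rw [h1]
    refine smul_ne_zero (Finset.prod_ne_zero_iff.2 fun k hk ↦ ?_) (hb i).1
    exact sub_ne_zero.2 (hν.ne (Finset.ne_of_mem_erase hk).symm)
  have hwev : ∀ᶠ y in 𝓝 x, ∀ i, w i y ≠ 0 := by
    rw [Filter.eventually_all]
    intro i
    have hs := hw x hxN hev.self_of_nhds.2.2 i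
    have h1 : ContinuousAt (fun y ↦ (inner ℝ (w i y) (w i y) : ℝ)) x :=
      (contMDiffAt_inner hs hs).continuousAt
    filter_upwards [h1.eventually_ne (inner_self_ne_zero.2 (hw0 i))] with y hy
    exact inner_self_ne_zero.1 hy
  obtain ⟨N', hN', hN'o, hxN'⟩ := eventually_nhds_iff.1
    (hev.and (hwev.and (he.isOpen.mem_nhds hxN)))
  refine ⟨fun i y ↦ ‖w i y‖⁻¹ • w i y, fun i y ↦ L i (f y), N', hxN', ?_⟩
  have hortho : ∀ y ∈ N', ∀ i, dualEndo a y (‖w i y‖⁻¹ • w i y) =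
      L i (f y) • ‖w i y‖⁻¹ • w i y := by
    intro y hy i
    rw [map_smul, hchar y (hN' y hy).1.1 (hN' y hy).1.2.1 i (Z i y), smul_comm]
  refine { isOpen := hN'o, contMDiffAt := fun i y hy ↦ ?_, orthonormal := fun y hy ↦ ?_,
           card_eq := by simp [hn], injective := fun y hy ↦ (hN' y hy).1.1,
           apply_left := fun y hy i v ↦ ?_, mdiffAt_eigenvalue := fun i y hy ↦ ?_,
           mvfderiv_eigenvalue := fun y hy i v ↦ ?_ }
  · exact contMDiffAt_inv_norm_smul (hw y (hN' y hy).2.2 (hN' y hy).1.2.2 i) ((hN' y hy).2.1 i)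
  · refine ⟨fun i ↦ ?_, fun i j hij ↦ ?_⟩
    · rw [norm_smul, norm_inv, norm_norm, inv_mul_cancel₀ (norm_ne_zero_iff.2 ((hN' y hy).2.1 i))]
    · have h := hsymm y (‖w i y‖⁻¹ • w i y) (‖w j y‖⁻¹ • w j y)
      have hi := hortho y hy i
      have hj := hortho y hy j
      have h' := sub_ne_zero.2 ((hN' y hy).1.1.ne hij)
      dsimp only
      generalize ‖w i y‖⁻¹ • w i y = u at h hi ⊢
      generalize ‖w j y‖⁻¹ • w j y = v at h hj ⊢
      rw [hi, hj, real_inner_smul_left, real_inner_smul_right] at h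
      refine (mul_eq_zero.1 ?_).resolve_left h'
      rw [sub_mul, h, sub_self]
  · rw [← inner_dualEndo, hortho y hy, real_inner_smul_left]
  · exact (hLf y (hN' y hy).1.2.2 i).mdifferentiableAt (by simp)
  · have h1 := ((hN' y hy).1.2.2 i)
    have h2 : HasMFDerivAt 𝓘(ℝ, ℝ) 𝓘(ℝ, ℝ) (L i) (f y) (fderiv ℝ (L i) (f y)) :=
      (h1.1.differentiableAt (by simp)).hasFDerivAt.hasMFDerivAt
    have h3 := (hf y).mdifferentiableAt (by simp)
    have h4 := (h2.comp y h3.hasMFDerivAt).mfderiv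
    have h5 : mvfderiv I (fun z ↦ L i (f z)) y v = fderiv ℝ (L i) (f y) (mvfderiv I f y v) := by
      rw [mvfderiv, mvfderiv]
      exact congrArg (fun T ↦ T v) h4
    rw [h5, ← mul_one (mvfderiv I f y v), ← smul_eq_mul, map_smul, fderiv_apply_one_eq_deriv, h1.2,
      smul_eq_mul, smul_eq_mul, mul_one, div_eq_mul_inv]

end

end RiemannianGeometry

/-! ### The Riemannian volume density in charts -/

namespace RiemannianGeometry

noncomputable section

set_option linter.unusedSectionVars false

section LinearAlgebra

open Module

variable {E V : Type*} [NormedAddCommGroup E] [NormedSpace ℝ E]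
  [NormedAddCommGroup V] [InnerProductSpace ℝ V] {ι : Type*} [Fintype ι] [DecidableEq ι]

/-- The change of basis has determinant `1` or `-1`. This makes the volume density independent of
the orthonormal basis used to define it. -/
lemma abs_det_orthonormalBasis_congr (b b' : OrthonormalBasis ι ℝ V) (v : ι → V) :
    |b.toBasis.det v| = |b'.toBasis.det v| := by
  have h := congrArg (fun f ↦ f v) (AlternatingMap.eq_smul_basis_det b'.toBasis b.toBasis.det)
  rw [h]
  simp only [AlternatingMap.smul_apply, smul_eq_mul, abs_mul]
  rcases b.det_to_matrix_orthonormalBasis_real b' with h | h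
  · simp [h]
  · simp [h]

lemma det_mul_det_symm (c : Basis ι ℝ E) (b : Basis ι ℝ V) (T : E ≃ₗ[ℝ] V) :
    b.det (T ∘ c) * c.det (T.symm ∘ b) = 1 := by
  have h1 : c.det (T.symm ∘ b) = (c.map T).det b := by rw [Basis.det_map]
  have h2 : b.det (T ∘ c) = b.det (c.map T) := by congr 1
  rw [h1, h2, Basis.det_apply, Basis.det_apply, ← Matrix.det_mul, Basis.toMatrix_mul_toMatrix_flip,
    Matrix.det_one]

lemma continuous_basis_det [FiniteDimensional ℝ E] (c : Basis ι ℝ E) :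
    Continuous fun v : ι → E ↦ c.det v := by
  simp only [Basis.det_apply]
  refine Continuous.matrix_det (continuous_matrix fun i j ↦ ?_)
  exact (LinearMap.continuous_of_finiteDimensional (c.coord i)).comp (continuous_apply j)

end LinearAlgebra

variable {E : Type*} [NormedAddCommGroup E] [NormedSpace ℝ E] [FiniteDimensional ℝ E]
  [CompleteSpace E]
  {M : Type*} [TopologicalSpace M] [ChartedSpace E M] [IsManifold 𝓘(ℝ, E) ∞ M]

variable {p : M} {z : E}

lemma contMDiffAt_extChartAt_symm_of_mem (hz : z ∈ (extChartAt 𝓘(ℝ, E) p).target) :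
    CMDiffAt ∞ (extChartAt 𝓘(ℝ, E) p).symm z :=
  (contMDiffOn_extChartAt_symm p).contMDiffAt ((isOpen_extChartAt_target p).mem_nhds hz)

lemma isInvertible_mfderiv_extChartAt_symm_of_mem (hz : z ∈ (extChartAt 𝓘(ℝ, E) p).target) :
    (mfderiv 𝓘(ℝ, E) 𝓘(ℝ, E) (extChartAt 𝓘(ℝ, E) p).symm z).IsInvertible := by
  have := isInvertible_mfderivWithin_extChartAt_symm hz
  simpa using this

/-- The derivative of the inverse of a chart as a linear equivalence. -/
def chartSymmDeriv (hz : z ∈ (extChartAt 𝓘(ℝ, E) p).target) :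
    E ≃ₗ[ℝ] TangentSpace 𝓘(ℝ, E) ((extChartAt 𝓘(ℝ, E) p).symm z) :=
  (isInvertible_mfderiv_extChartAt_symm_of_mem hz).choose.toLinearEquiv

lemma chartSymmDeriv_apply (hz : z ∈ (extChartAt 𝓘(ℝ, E) p).target) (v : E) :
    chartSymmDeriv hz v = mfderiv 𝓘(ℝ, E) 𝓘(ℝ, E) (extChartAt 𝓘(ℝ, E) p).symm z v :=
  congrArg (fun T ↦ T v) (isInvertible_mfderiv_extChartAt_symm_of_mem hz).choose_spec

lemma chartSymmDeriv_symm_apply (hz : z ∈ (extChartAt 𝓘(ℝ, E) p).target)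
    (X : Π x : M, TangentSpace 𝓘(ℝ, E) x) :
    (chartSymmDeriv hz).symm (X ((extChartAt 𝓘(ℝ, E) p).symm z)) =
      VectorField.mpullback 𝓘(ℝ, E) 𝓘(ℝ, E) (extChartAt 𝓘(ℝ, E) p).symm X z := by
  have h := (isInvertible_mfderiv_extChartAt_symm_of_mem hz).choose_spec
  rw [VectorField.mpullback_apply, ← h, ContinuousLinearMap.inverse_equiv]
  rfl

variable [RiemannianBundle (fun x : M ↦ TangentSpace 𝓘(ℝ, E) x)]
  [IsContMDiffRiemannianBundle 𝓘(ℝ, E) ∞ E (fun x : M ↦ TangentSpace 𝓘(ℝ, E) x)]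
  {ι : Type*} [Fintype ι] [DecidableEq ι]

/-- An orthonormal basis of the tangent space indexed like a basis of the model space. -/
def tangentOrthonormalBasis (c : Module.Basis ι ℝ E) (x : M) :
    OrthonormalBasis ι ℝ (TangentSpace 𝓘(ℝ, E) x) :=
  (stdOrthonormalBasis ℝ (TangentSpace 𝓘(ℝ, E) x)).reindex
    (Fintype.equivFinOfCardEq (Module.finrank_eq_card_basis c).symm).symm

/-- The density of the Riemannian volume in the chart at `p`. -/
def chartDensity (c : Module.Basis ι ℝ E) (p : M) (z : E) : ℝ :=
  |(tangentOrthonormalBasis c ((extChartAt 𝓘(ℝ, E) p).symm z)).toBasis.det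
    fun i ↦ mfderiv 𝓘(ℝ, E) 𝓘(ℝ, E) (extChartAt 𝓘(ℝ, E) p).symm z (c i)|

variable {c : Module.Basis ι ℝ E}

lemma chartDensity_eq (hz : z ∈ (extChartAt 𝓘(ℝ, E) p).target)
    (b : OrthonormalBasis ι ℝ (TangentSpace 𝓘(ℝ, E) ((extChartAt 𝓘(ℝ, E) p).symm z))) :
    chartDensity c p z = |b.toBasis.det (chartSymmDeriv hz ∘ c)| := by
  rw [chartDensity, abs_det_orthonormalBasis_congr _ b]
  congr 2
  exact funext fun i ↦ (chartSymmDeriv_apply hz (c i)).symm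

lemma chartDensity_eq_inv (hz : z ∈ (extChartAt 𝓘(ℝ, E) p).target)
    (b : OrthonormalBasis ι ℝ (TangentSpace 𝓘(ℝ, E) ((extChartAt 𝓘(ℝ, E) p).symm z))) :
    chartDensity c p z = |c.det ((chartSymmDeriv hz).symm ∘ b)|⁻¹ := by
  rw [chartDensity_eq hz b]
  refine eq_inv_of_mul_eq_one_left ?_
  have := det_mul_det_symm c b.toBasis (chartSymmDeriv hz)
  rw [OrthonormalBasis.coe_toBasis] at this
  rw [← abs_mul, this, abs_one]

lemma chartDensity_pos (hz : z ∈ (extChartAt 𝓘(ℝ, E) p).target) : 0 < chartDensity c p z := by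
  have h := chartDensity_eq_inv (c := c) hz (tangentOrthonormalBasis c _)
  have h' := chartDensity_eq (c := c) hz (tangentOrthonormalBasis c _)
  have := det_mul_det_symm c (tangentOrthonormalBasis c ((extChartAt 𝓘(ℝ, E) p).symm z)).toBasis
    (chartSymmDeriv hz)
  rw [h', abs_pos]
  exact left_ne_zero_of_mul_eq_one this

/-- The density is defined with an orthonormal basis chosen separately at each point. A smooth frame
gives the same value in a form that can be differentiated. -/
lemma chartDensity_eq_frame {e : ι → Π x : M, TangentSpace 𝓘(ℝ, E) x} {N : Set M}
    (he : IsOrthonormalFrameOn e N) (hz : z ∈ (extChartAt 𝓘(ℝ, E) p).target)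
    (hzN : (extChartAt 𝓘(ℝ, E) p).symm z ∈ N) :
    chartDensity c p z = |c.det fun i ↦ VectorField.mpullback 𝓘(ℝ, E) 𝓘(ℝ, E)
      (extChartAt 𝓘(ℝ, E) p).symm (e i) z|⁻¹ := by
  rw [chartDensity_eq_inv hz (he.basis hzN)]
  congr 3
  funext i
  rw [Function.comp_apply, he.basis_apply, chartSymmDeriv_symm_apply]

lemma contDiffAt_mpullback {X : Π x : M, TangentSpace 𝓘(ℝ, E) x}
    (hz : z ∈ (extChartAt 𝓘(ℝ, E) p).target)
    (hX : CMDiffAt ∞ (T% X) ((extChartAt 𝓘(ℝ, E) p).symm z)) :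
    ContDiffAt ℝ ∞ (fun z ↦ (VectorField.mpullback 𝓘(ℝ, E) 𝓘(ℝ, E)
      (extChartAt 𝓘(ℝ, E) p).symm X z : E)) z := by
  have h := ContMDiffAt.mpullback_vectorField_preimage hX
    (contMDiffAt_extChartAt_symm_of_mem hz) (isInvertible_mfderiv_extChartAt_symm_of_mem hz)
    (m := ∞) (by simp)
  exact contMDiffAt_vectorSpace_iff_contDiffAt.1 h

lemma continuousOn_chartDensity (p : M) :
    ContinuousOn (chartDensity c p) (extChartAt 𝓘(ℝ, E) p).target := by
  intro z hz
  refine ContinuousAt.continuousWithinAt ?_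
  obtain ⟨e, N, hN, he⟩ := exists_isOrthonormalFrameOn (I := 𝓘(ℝ, E)) rfl
    ((extChartAt 𝓘(ℝ, E) p).symm z)
  let σ := (Fintype.equivFinOfCardEq (Module.finrank_eq_card_basis c).symm)
  let e' : ι → Π x : M, TangentSpace 𝓘(ℝ, E) x := fun i ↦ e (σ i)
  have he' : IsOrthonormalFrameOn e' N := ⟨he.isOpen, fun i ↦ he.contMDiffAt (σ i),
    fun x hx ↦ (he.orthonormal x hx).comp σ σ.injective, (Module.finrank_eq_card_basis c).symm⟩
  have hev : ∀ᶠ y in 𝓝 z, y ∈ (extChartAt 𝓘(ℝ, E) p).target ∧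
      (extChartAt 𝓘(ℝ, E) p).symm y ∈ N :=
    Filter.Eventually.and ((isOpen_extChartAt_target p).mem_nhds hz)
      ((contMDiffAt_extChartAt_symm_of_mem hz).continuousAt.eventually
        (he.isOpen.mem_nhds hN))
  refine ContinuousAt.congr ?_
    (hev.mono fun y hy ↦ (chartDensity_eq_frame (c := c) he' hy.1 hy.2).symm)
  have h0 := chartDensity_pos (c := c) hz
  rw [chartDensity_eq_frame he' hz hN] at h0
  refine ContinuousAt.inv₀ (ContinuousAt.abs ?_) (inv_pos.1 h0).ne'
  have : ContinuousAt (fun y ↦ fun i ↦ (VectorField.mpullback 𝓘(ℝ, E) 𝓘(ℝ, E)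
      (extChartAt 𝓘(ℝ, E) p).symm (e' i) y : E)) z :=
    continuousAt_pi.2 fun i ↦ (contDiffAt_mpullback hz (he'.contMDiffAt i _ hN)).continuousAt
  exact (continuous_basis_det c).continuousAt.comp this

/-- Brings the densities of two charts to one and the same tangent space, with a fixed orthonormal
basis. -/
lemma chartDensity_of_eq {x : M} (hx : (extChartAt 𝓘(ℝ, E) p).symm z = x) :
    chartDensity c p z = |(tangentOrthonormalBasis c x).toBasis.det
      fun i ↦ (mfderiv 𝓘(ℝ, E) 𝓘(ℝ, E) (extChartAt 𝓘(ℝ, E) p).symm z (c i) : E)| := by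
  subst hx
  rfl

/-- The transition map between two charts. -/
abbrev chartTransition (p q : M) (z : E) : E :=
  extChartAt 𝓘(ℝ, E) q ((extChartAt 𝓘(ℝ, E) p).symm z)

lemma differentiableAt_chartTransition {q : M} (hz : z ∈ (extChartAt 𝓘(ℝ, E) p).target)
    (hq : (extChartAt 𝓘(ℝ, E) p).symm z ∈ (extChartAt 𝓘(ℝ, E) q).source) :
    DifferentiableAt ℝ (chartTransition p q) z := by
  rw [extChartAt_source] at hq
  exact ((mdifferentiableAt_extChartAt hq).comp z
    ((contMDiffAt_extChartAt_symm_of_mem hz).mdifferentiableAt (by simp))).differentiableAt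

/-- The chain rule factors the derivative of one inverse chart through the transition map, whose
determinant comes out of the top-degree form. -/
lemma chartDensity_transition {q : M} (hz : z ∈ (extChartAt 𝓘(ℝ, E) p).target)
    (hq : (extChartAt 𝓘(ℝ, E) p).symm z ∈ (extChartAt 𝓘(ℝ, E) q).source) :
    chartDensity c p z = |(fderiv ℝ (chartTransition p q) z).det| *
      chartDensity c q (chartTransition p q z) := by
  set x := (extChartAt 𝓘(ℝ, E) p).symm z with hx
  have hqx : (extChartAt 𝓘(ℝ, E) q).symm (chartTransition p q z) = x :=
    (extChartAt 𝓘(ℝ, E) q).left_inv hq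
  have hq' : chartTransition p q z ∈ (extChartAt 𝓘(ℝ, E) q).target :=
    (extChartAt 𝓘(ℝ, E) q).map_source hq
  rw [chartDensity_of_eq hx.symm, chartDensity_of_eq hqx]
  let β : E [⋀^ι]→ₗ[ℝ] ℝ := (tangentOrthonormalBasis c x).toBasis.det
  let Tq : E →ₗ[ℝ] E := (mfderiv 𝓘(ℝ, E) 𝓘(ℝ, E) (extChartAt 𝓘(ℝ, E) q).symm
    (chartTransition p q z)).toLinearMap
  have hτ := differentiableAt_chartTransition hz hq
  have hchain : ∀ v : E, (mfderiv 𝓘(ℝ, E) 𝓘(ℝ, E) (extChartAt 𝓘(ℝ, E) p).symm z v : E) =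
      Tq (fderiv ℝ (chartTransition p q) z v) := by
    intro v
    have h1 := ((contMDiffAt_extChartAt_symm_of_mem hq').mdifferentiableAt
      (by simp)).hasMFDerivAt.comp z hτ.hasFDerivAt.hasMFDerivAt
    have h2 : (extChartAt 𝓘(ℝ, E) p).symm =ᶠ[𝓝 z]
        (extChartAt 𝓘(ℝ, E) q).symm ∘ chartTransition p q := by
      have h3 := (contMDiffAt_extChartAt_symm_of_mem hz).continuousAt.eventually
        ((isOpen_extChartAt_source q).mem_nhds hq)
      exact h3.mono fun y hy ↦ ((extChartAt 𝓘(ℝ, E) q).left_inv hy).symm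
    have h4 := (h1.congr_of_eventuallyEq h2).mfderiv
    exact congrArg (fun T ↦ T v) h4
  -- An alternating form of top degree is determined by its value on one basis.
  have key : ∀ v : ι → E, β (fun i ↦ Tq (v i)) = β (fun i ↦ Tq (c i)) * c.det v := fun v ↦
    congrArg (fun f ↦ f v) (AlternatingMap.eq_smul_basis_det c (β.compLinearMap Tq))
  have hdet : c.det (fun i ↦ fderiv ℝ (chartTransition p q) z (c i)) =
      (fderiv ℝ (chartTransition p q) z).det := by
    have := c.det_comp (fderiv ℝ (chartTransition p q) z).toLinearMap c
    rw [c.det_self, mul_one] at this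
    exact this
  have h5 : β (fun i ↦ (mfderiv 𝓘(ℝ, E) 𝓘(ℝ, E) (extChartAt 𝓘(ℝ, E) p).symm z (c i) : E)) =
      β (fun i ↦ Tq (c i)) * (fderiv ℝ (chartTransition p q) z).det := by
    rw [← hdet, ← key]
    exact congrArg β (funext fun i ↦ hchain (c i))
  rw [mul_comm, ← abs_mul]
  exact congrArg abs h5

end

end RiemannianGeometry

/-! ### Divergence in coordinates -/

namespace RiemannianGeometry

noncomputable section

set_option linter.unusedSectionVars false

section Euclidean

open Module MeasureTheory

variable {E : Type*} [NormedAddCommGroup E] [NormedSpace ℝ E] [FiniteDimensional ℝ E]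
  {ι : Type*} [Fintype ι] [DecidableEq ι]

lemma basis_det_update (c B : Basis ι ℝ E) (k : ι) (w : E) :
    c.det (Function.update B k w) = B.coord k w * c.det B := by
  have h : c.det.toMultilinearMap.toLinearMap B k = c.det B • B.coord k := by
    refine B.ext fun m ↦ ?_
    rcases eq_or_ne m k with rfl | hm
    · simp
    · have h0 : c.det (Function.update B k (B m)) = 0 := by
        refine c.det.map_eq_zero_of_eq _ (i := k) (j := m) ?_ hm.symm
        simp [Function.update_of_ne hm]
      simpa [Finsupp.single_eq_of_ne hm.symm] using h0
  have := congrArg (fun f ↦ f w) h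
  simpa [mul_comm] using this

lemma trace_eq_sum_coord (B : Basis ι ℝ E) (T : E →ₗ[ℝ] E) :
    LinearMap.trace ℝ E T = ∑ k, B.coord k (T (B k)) := by
  rw [LinearMap.trace_eq_matrix_trace ℝ B, Matrix.trace]
  simp [LinearMap.toMatrix_apply]

/-- Jacobi's formula: the determinant is differentiated one slot at a time, and Cramer's rule
(`basis_det_update`) evaluates each resulting determinant. -/
lemma hasFDerivAt_det (c : Basis ι ℝ E) {F : Type*} [NormedAddCommGroup F] [NormedSpace ℝ F]
    {Y : ι → F → E} {z : F} (hY : ∀ i, DifferentiableAt ℝ (Y i) z) (B : Basis ι ℝ E)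
    (hB : ∀ i, B i = Y i z) :
    ∃ d : F →L[ℝ] ℝ, HasFDerivAt (fun y ↦ c.det fun i ↦ Y i y) d z ∧
      ∀ v, d v = (∑ k, B.coord k (fderiv ℝ (Y k) z v)) * c.det B := by
  let f : ContinuousMultilinearMap ℝ (fun _ : ι ↦ E) ℝ :=
    ⟨c.det.toMultilinearMap, continuous_basis_det c⟩
  refine ⟨_, HasFDerivAt.multilinear_comp (f := f) fun i ↦ (hY i).hasFDerivAt, fun v ↦ ?_⟩
  have hB' : (fun i ↦ Y i z) = B := funext fun i ↦ (hB i).symm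
  rw [Finset.sum_mul, sum_apply]
  refine Finset.sum_congr rfl fun k _ ↦ ?_
  rw [← basis_det_update]
  simp [hB', f]
  rfl

/-- The divergence theorem for compactly supported vector fields. -/
lemma integral_trace_fderiv_eq_zero [MeasurableSpace E] [BorelSpace E] (ν : Measure E)
    [ν.IsAddHaarMeasure] {X : E → E} (hX : ContDiff ℝ 1 X) (hc : HasCompactSupport X) :
    ∫ z, LinearMap.trace ℝ E (fderiv ℝ X z).toLinearMap ∂ν = 0 := by
  let c := Module.finBasis ℝ E
  have hcoord : ∀ k, Continuous (c.coord k) := fun k ↦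
    LinearMap.continuous_of_finiteDimensional (c.coord k)
  let ck : ∀ k, E →L[ℝ] ℝ := fun k ↦ ⟨c.coord k, hcoord k⟩
  have hd : ∀ z, DifferentiableAt ℝ X z := fun z ↦ hX.differentiable (by simp) z
  have h1 : ∀ k z, ck k (fderiv ℝ X z (c k)) = fderiv ℝ (fun z ↦ ck k (X z)) z (c k) := by
    intro k z
    have := ((ck k).hasFDerivAt.comp z (hd z).hasFDerivAt).fderiv
    exact (congrArg (fun T ↦ T (c k)) this).symm
  have h2 : ∀ k, ContDiff ℝ 1 fun z ↦ ck k (X z) := fun k ↦ (ck k).contDiff.comp hX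
  have h3 : ∀ k, HasCompactSupport fun z ↦ ck k (X z) := fun k ↦
    hc.comp_left (map_zero (ck k))
  have h4 : ∀ k, Integrable (fun z ↦ fderiv ℝ (fun z ↦ ck k (X z)) z (c k)) ν := fun k ↦
    (((h2 k).continuous_fderiv (by simp)).clm_apply continuous_const).integrable_of_hasCompactSupport
      ((h3 k).fderiv_apply (𝕜 := ℝ) (c k))
  have h5 : ∀ k, ∫ z, fderiv ℝ (fun z ↦ ck k (X z)) z (c k) ∂ν = 0 := by
    intro k
    obtain ⟨D, hD⟩ := (h2 k).lipschitzWith_of_hasCompactSupport (h3 k) (by simp)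
    -- Integration by parts against the constant `1`. The direction is `-c k` because the formula
    -- reverses it on the other factor.
    have h := LipschitzWith.integral_lineDeriv_mul_eq (μ := ν) (LipschitzWith.const (1 : ℝ)) hD (h3 k) (-c k)
    simp only [mul_one, neg_neg] at h
    have h6 : ∀ z, lineDeriv ℝ (fun z ↦ ck k (X z)) z (c k) =
        fderiv ℝ (fun z ↦ ck k (X z)) z (c k) := fun z ↦
      ((h2 k).differentiable (by simp) z).lineDeriv_eq_fderiv
    have h7 : ∀ z v : E, lineDeriv ℝ (fun _ : E ↦ (1 : ℝ)) z v = 0 := fun z v ↦ by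
      simp [lineDeriv]
    simp only [h6, h7, zero_mul, integral_zero] at h
    exact h.symm
  have h6 : ∀ z, LinearMap.trace ℝ E (fderiv ℝ X z).toLinearMap =
      ∑ k, fderiv ℝ (fun z ↦ ck k (X z)) z (c k) := by
    intro z
    rw [trace_eq_sum_coord c]
    exact Finset.sum_congr rfl fun k _ ↦ h1 k z
  simp only [h6]
  rw [integral_finsetSum _ fun k _ ↦ h4 k]
  simp [h5]

end Euclidean

variable {E : Type*} [NormedAddCommGroup E] [NormedSpace ℝ E] [FiniteDimensional ℝ E]
  [CompleteSpace E]
  {M : Type*} [TopologicalSpace M] [ChartedSpace E M] [IsManifold 𝓘(ℝ, E) ∞ M]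
  [RiemannianBundle (fun x : M ↦ TangentSpace 𝓘(ℝ, E) x)]
  [IsContMDiffRiemannianBundle 𝓘(ℝ, E) ∞ E (fun x : M ↦ TangentSpace 𝓘(ℝ, E) x)]
  {ι : Type*} [Fintype ι] [DecidableEq ι] {c : Module.Basis ι ℝ E}
  {p : M} {z : E} {e : ι → Π x : M, TangentSpace 𝓘(ℝ, E) x} {N : Set M}

/-- The coordinate expression of a vector field in the chart at `p`. -/
def chartField (p : M) (X : Π x : M, TangentSpace 𝓘(ℝ, E) x) (z : E) : E :=
  VectorField.mpullback 𝓘(ℝ, E) 𝓘(ℝ, E) (extChartAt 𝓘(ℝ, E) p).symm X z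

lemma exists_basis_chartField (he : IsOrthonormalFrameOn e N)
    (hz : z ∈ (extChartAt 𝓘(ℝ, E) p).target) (hzN : (extChartAt 𝓘(ℝ, E) p).symm z ∈ N) :
    ∃ B : Module.Basis ι ℝ E, (∀ i, B i = chartField p (e i) z) ∧
      ∀ k (X : Π x : M, TangentSpace 𝓘(ℝ, E) x), B.coord k (chartField p X z) =
        inner ℝ (e k ((extChartAt 𝓘(ℝ, E) p).symm z)) (X ((extChartAt 𝓘(ℝ, E) p).symm z)) := by
  refine ⟨(he.basis hzN).toBasis.map (chartSymmDeriv hz).symm, fun i ↦ ?_, fun k X ↦ ?_⟩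
  · rw [Module.Basis.map_apply, OrthonormalBasis.coe_toBasis, he.basis_apply,
      chartSymmDeriv_symm_apply]
    rfl
  · have h : chartField p X z =
      (chartSymmDeriv hz).symm (X ((extChartAt 𝓘(ℝ, E) p).symm z)) :=
      (chartSymmDeriv_symm_apply hz X).symm
    rw [h, Module.Basis.coord_apply, Module.Basis.map_repr, LinearEquiv.trans_apply,
      LinearEquiv.symm_symm, LinearEquiv.apply_symm_apply,
      OrthonormalBasis.coe_toBasis_repr_apply, OrthonormalBasis.repr_apply_apply, he.basis_apply]

lemma mlieBracket_chartField (he : IsOrthonormalFrameOn e N)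
    (hz : z ∈ (extChartAt 𝓘(ℝ, E) p).target) (hzN : (extChartAt 𝓘(ℝ, E) p).symm z ∈ N) (i j : ι) :
    fderiv ℝ (chartField p (e j)) z (chartField p (e i) z) -
      fderiv ℝ (chartField p (e i)) z (chartField p (e j) z) =
    chartField p (VectorField.mlieBracket 𝓘(ℝ, E) (e i) (e j)) z := by
  have : IsManifold 𝓘(ℝ, E) (minSmoothness ℝ 2) M := by
    rw [minSmoothness_of_isRCLikeNormedField]; infer_instance
  have : IsManifold 𝓘(ℝ, E) (minSmoothness ℝ 3) M := by
    rw [minSmoothness_of_isRCLikeNormedField]; infer_instance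
  have h := VectorField.mpullback_mlieBracket (he.mdiffAt hzN i) (he.mdiffAt hzN j)
    (contMDiffAt_extChartAt_symm_of_mem hz)
    (by rw [minSmoothness_of_isRCLikeNormedField]; exact WithTop.coe_le_coe.2 le_top)
  rw [← VectorField.mlieBracketWithin_univ (I := 𝓘(ℝ, E)) (M := E),
    VectorField.mlieBracketWithin_eq_lieBracketWithin] at h
  exact (h.trans (congrFun VectorField.lieBracketWithin_univ z)).symm

lemma contDiffAt_chartField {X : Π x : M, TangentSpace 𝓘(ℝ, E) x}
    (hz : z ∈ (extChartAt 𝓘(ℝ, E) p).target)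
    (hX : CMDiffAt ∞ (T% X) ((extChartAt 𝓘(ℝ, E) p).symm z)) :
    ContDiffAt ℝ ∞ (chartField p X) z :=
  contDiffAt_mpullback hz hX

lemma eventually_mem_target_and (hz : z ∈ (extChartAt 𝓘(ℝ, E) p).target) {U : Set M}
    (hU : IsOpen U) (hzU : (extChartAt 𝓘(ℝ, E) p).symm z ∈ U) :
    ∀ᶠ y in 𝓝 z, y ∈ (extChartAt 𝓘(ℝ, E) p).target ∧ (extChartAt 𝓘(ℝ, E) p).symm y ∈ U :=
  Filter.Eventually.and ((isOpen_extChartAt_target p).mem_nhds hz)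
    ((contMDiffAt_extChartAt_symm_of_mem hz).continuousAt.eventually (hU.mem_nhds hzU))

lemma basis_det_ne_zero (c B : Module.Basis ι ℝ E) : c.det B ≠ 0 := by
  have := c.isUnit_det B
  exact this.ne_zero

lemma hasFDerivAt_abs_inv {F : Type*} [NormedAddCommGroup F] [NormedSpace ℝ F] {h : F → ℝ}
    {d : F →L[ℝ] ℝ} {z : F} (hh : HasFDerivAt h d z) (h0 : h z ≠ 0) :
    HasFDerivAt (fun y ↦ |h y|⁻¹) (-(|h z|⁻¹ * (h z)⁻¹) • d) z := by
  have h1 : HasDerivAt (fun t : ℝ ↦ |t|⁻¹) (-(|h z|⁻¹ * (h z)⁻¹)) (h z) := by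
    refine ((hasDerivAt_abs h0).inv (abs_ne_zero.2 h0)).congr_deriv ?_
    rcases lt_or_gt_of_ne h0 with h | h
    · rw [abs_of_neg h, sign_neg h]
      field_simp
      simp
    · rw [abs_of_pos h, sign_pos h]
      field_simp
      simp
  exact h1.comp_hasFDerivAt z hh

lemma contDiffAt_chartDensity (he : IsOrthonormalFrameOn e N)
    (hz : z ∈ (extChartAt 𝓘(ℝ, E) p).target) (hzN : (extChartAt 𝓘(ℝ, E) p).symm z ∈ N) :
    ContDiffAt ℝ 1 (chartDensity c p) z := by
  obtain ⟨B, hB, -⟩ := exists_basis_chartField he hz hzN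
  have hev : chartDensity c p =ᶠ[𝓝 z] fun y ↦ |c.det fun i ↦ chartField p (e i) y|⁻¹ :=
    (eventually_mem_target_and hz he.isOpen hzN).mono fun y hy ↦
      chartDensity_eq_frame (c := c) he hy.1 hy.2
  refine ContDiffAt.congr_of_eventuallyEq ?_ hev
  have hBz : (fun i ↦ chartField p (e i) z) = B := funext fun i ↦ (hB i).symm
  have h0 : (c.det fun i ↦ chartField p (e i) z) ≠ 0 := by
    rw [hBz]; exact basis_det_ne_zero c B
  refine ContDiffAt.inv (ContDiffAt.comp z (contDiffAt_abs h0) ?_) (abs_ne_zero.2 h0)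
  let f : ContinuousMultilinearMap ℝ (fun _ : ι ↦ E) ℝ :=
    ⟨c.det.toMultilinearMap, continuous_basis_det c⟩
  have h1 : ContDiffAt ℝ 1 (fun y ↦ fun i ↦ chartField p (e i) y) z :=
    contDiffAt_pi.2 fun i ↦ (contDiffAt_chartField hz (he.contMDiffAt i _ hzN)).of_le (by simp)
  exact f.contDiff.contDiffAt.comp z h1

/-- The logarithmic derivative of the volume density in terms of a frame. -/
lemma fderiv_chartDensity (he : IsOrthonormalFrameOn e N)
    (hz : z ∈ (extChartAt 𝓘(ℝ, E) p).target) (hzN : (extChartAt 𝓘(ℝ, E) p).symm z ∈ N)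
    {B : Module.Basis ι ℝ E} (hB : ∀ i, B i = chartField p (e i) z) (v : E) :
    fderiv ℝ (chartDensity c p) z v =
      -chartDensity c p z * ∑ k, B.coord k (fderiv ℝ (chartField p (e k)) z v) := by
  have hev : chartDensity c p =ᶠ[𝓝 z] fun y ↦ |c.det fun i ↦ chartField p (e i) y|⁻¹ :=
    (eventually_mem_target_and hz he.isOpen hzN).mono fun y hy ↦
      chartDensity_eq_frame (c := c) he hy.1 hy.2
  have hY : ∀ i, DifferentiableAt ℝ (chartField p (e i)) z := fun i ↦
    (contDiffAt_chartField hz (he.contMDiffAt i _ hzN)).differentiableAt (by simp)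
  obtain ⟨d, hd, hdv⟩ := hasFDerivAt_det c hY B hB
  have hBz : (fun i ↦ chartField p (e i) z) = B := funext fun i ↦ (hB i).symm
  have h0 : (c.det fun i ↦ chartField p (e i) z) ≠ 0 := by
    rw [hBz]; exact basis_det_ne_zero c B
  have h1 := (hasFDerivAt_abs_inv hd h0).congr_of_eventuallyEq hev
  have hval : chartDensity c p z = |c.det B|⁻¹ := by rw [← hBz]; exact hev.self_of_nhds
  rw [h1.fderiv, hval, smul_apply, hdv, smul_eq_mul, hBz]
  rw [hBz] at h0
  field_simp

/-- The divergence of a multiple of a frame field, in a chart. -/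
lemma trace_fderiv_chartField (he : IsOrthonormalFrameOn e N)
    (hz : z ∈ (extChartAt 𝓘(ℝ, E) p).target) (hzN : (extChartAt 𝓘(ℝ, E) p).symm z ∈ N)
    {w : M → ℝ} (hw : MDiffAt w ((extChartAt 𝓘(ℝ, E) p).symm z)) (j : ι) :
    LinearMap.trace ℝ E (fderiv ℝ (fun y ↦ (w ((extChartAt 𝓘(ℝ, E) p).symm y) *
      chartDensity c p y) • chartField p (e j) y) z).toLinearMap =
    (mvfderiv 𝓘(ℝ, E) w ((extChartAt 𝓘(ℝ, E) p).symm z) (e j ((extChartAt 𝓘(ℝ, E) p).symm z)) -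
      w ((extChartAt 𝓘(ℝ, E) p).symm z) * meanCoeff e j ((extChartAt 𝓘(ℝ, E) p).symm z)) *
      chartDensity c p z := by
  obtain ⟨B, hB, hBX⟩ := exists_basis_chartField he hz hzN
  have hψ := (contMDiffAt_extChartAt_symm_of_mem hz).mdifferentiableAt (n := ∞) (by simp)
  have hdens := (contDiffAt_chartDensity (c := c) he hz hzN).differentiableAt (by simp)
  have hY : ∀ i, DifferentiableAt ℝ (chartField p (e i)) z := fun i ↦
    (contDiffAt_chartField hz (he.contMDiffAt i _ hzN)).differentiableAt (by simp)
  have hwψ : DifferentiableAt ℝ (fun y ↦ w ((extChartAt 𝓘(ℝ, E) p).symm y)) z :=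
    (hw.comp z hψ).differentiableAt
  have hu := hwψ.hasFDerivAt.mul hdens.hasFDerivAt
  have hX := hu.smul (hY j).hasFDerivAt
  have hwe : fderiv ℝ (fun y ↦ w ((extChartAt 𝓘(ℝ, E) p).symm y)) z (B j) =
      mvfderiv 𝓘(ℝ, E) w ((extChartAt 𝓘(ℝ, E) p).symm z)
        (e j ((extChartAt 𝓘(ℝ, E) p).symm z)) := by
    have h1 := (hw.hasMFDerivAt.comp z hψ.hasMFDerivAt).mfderiv
    rw [mfderiv_eq_fderiv] at h1
    have h2 : chartSymmDeriv hz (B j) = e j ((extChartAt 𝓘(ℝ, E) p).symm z) := by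
      rw [hB, chartField, ← chartSymmDeriv_symm_apply hz, LinearEquiv.apply_symm_apply]
    rw [chartSymmDeriv_apply] at h2
    rw [← h2]
    exact congrArg (fun T : E →L[ℝ] ℝ ↦ T (B j)) h1
  -- This is the divergence of `e j`: the coordinate trace and the logarithmic derivative of the
  -- density combine to the sum of `⟪[e k, e j], e k⟫`, and antisymmetry reduces that to `-meanCoeff
  -- e j`.
  have hbr : ∑ k, B.coord k (fderiv ℝ (chartField p (e j)) z (B k)) -
      ∑ k, B.coord k (fderiv ℝ (chartField p (e k)) z (B j)) =
      -meanCoeff e j ((extChartAt 𝓘(ℝ, E) p).symm z) := by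
    rw [meanCoeff, ← Finset.sum_sub_distrib, ← Finset.sum_neg_distrib]
    refine Finset.sum_congr rfl fun k _ ↦ ?_
    rw [← map_sub, hB, hB, mlieBracket_chartField he hz hzN, hBX, real_inner_comm,
      he.inner_mlieBracket hzN]
    have h1 := he.connectionCoeff_anti hzN k k j
    have h2 := he.connectionCoeff_anti hzN j k k
    linarith
  have hfd : fderiv ℝ (fun y ↦ (w ((extChartAt 𝓘(ℝ, E) p).symm y) *
      chartDensity c p y) • chartField p (e j) y) z = _ := hX.fderiv
  rw [hfd, trace_eq_sum_coord B]
  have hterm : ∀ k, B.coord k (((w ((extChartAt 𝓘(ℝ, E) p).symm z) * chartDensity c p z) •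
      fderiv ℝ (chartField p (e j)) z +
      (w ((extChartAt 𝓘(ℝ, E) p).symm z) • fderiv ℝ (chartDensity c p) z +
        chartDensity c p z • fderiv ℝ (fun y ↦ w ((extChartAt 𝓘(ℝ, E) p).symm y)) z).smulRight
        (chartField p (e j) z)) (B k)) =
      w ((extChartAt 𝓘(ℝ, E) p).symm z) * chartDensity c p z *
        B.coord k (fderiv ℝ (chartField p (e j)) z (B k)) +
      if k = j then (w ((extChartAt 𝓘(ℝ, E) p).symm z) * fderiv ℝ (chartDensity c p) z (B j) +
        chartDensity c p z * fderiv ℝ (fun y ↦ w ((extChartAt 𝓘(ℝ, E) p).symm y)) z (B j))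
      else 0 := by
    intro k
    simp only [add_apply, smul_apply, ContinuousLinearMap.smulRight_apply, map_add, map_smul,
      smul_eq_mul, ← hB j]
    congr 1
    rw [Module.Basis.coord_apply, Module.Basis.repr_self]
    split_ifs with h
    · subst h; simp
    · simp [Finsupp.single_eq_of_ne h]
  refine (Finset.sum_congr rfl fun k _ ↦ hterm k).trans ?_
  rw [Finset.sum_add_distrib, ← Finset.mul_sum, Finset.sum_ite_eq' Finset.univ j]
  simp only [Finset.mem_univ, if_true]
  rw [fderiv_chartDensity he hz hzN hB, hwe]
  linear_combination w ((extChartAt 𝓘(ℝ, E) p).symm z) * chartDensity c p z * hbr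

end

end RiemannianGeometry

/-! ### Integration over a closed Riemannian manifold -/

namespace RiemannianGeometry

noncomputable section

set_option linter.unusedSectionVars false

open MeasureTheory

variable {E : Type*} [NormedAddCommGroup E] [NormedSpace ℝ E] [FiniteDimensional ℝ E]
  [CompleteSpace E]
  {M : Type*} [TopologicalSpace M] [ChartedSpace E M] [IsManifold 𝓘(ℝ, E) ∞ M]
  [RiemannianBundle (fun x : M ↦ TangentSpace 𝓘(ℝ, E) x)]
  [IsContMDiffRiemannianBundle 𝓘(ℝ, E) ∞ E (fun x : M ↦ TangentSpace 𝓘(ℝ, E) x)]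
  {ι : Type*} [Fintype ι] [DecidableEq ι] {c : Module.Basis ι ℝ E}
  {p : M} {z : E} {e : ι → Π x : M, TangentSpace 𝓘(ℝ, E) x} {N : Set M}
  [MeasurableSpace E] [BorelSpace E] {ν : Measure E} [ν.IsAddHaarMeasure]

variable (ν c) in
/-- The integral of a function over the chart domain at `p` for the Riemannian volume. -/
def chartIntegral (p : M) (g : M → ℝ) : ℝ :=
  ∫ z in (extChartAt 𝓘(ℝ, E) p).target,
    g ((extChartAt 𝓘(ℝ, E) p).symm z) * chartDensity c p z ∂ν

lemma isCompact_image_extChartAt {K : Set M} (hK : IsCompact K)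
    (h : K ⊆ (extChartAt 𝓘(ℝ, E) p).source) : IsCompact (extChartAt 𝓘(ℝ, E) p '' K) :=
  hK.image_of_continuousOn ((continuousOn_extChartAt p).mono h)

lemma symm_notMem_of_notMem_image {K : Set M} (hz : z ∈ (extChartAt 𝓘(ℝ, E) p).target)
    (hzK : z ∉ extChartAt 𝓘(ℝ, E) p '' K) : (extChartAt 𝓘(ℝ, E) p).symm z ∉ K := fun h ↦
  hzK ⟨_, h, (extChartAt 𝓘(ℝ, E) p).right_inv hz⟩

/-- Times the density, the integrand is the coordinate divergence of the weighted field `w e j`, so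
the Euclidean divergence theorem applies. -/
lemma chartIntegral_divergence (he : IsOrthonormalFrameOn e N) {w : M → ℝ}
    (hw : CMDiff ∞ w) (hc : IsCompact (tsupport w)) (hwN : tsupport w ⊆ N)
    (hwp : tsupport w ⊆ (extChartAt 𝓘(ℝ, E) p).source) (j : ι) :
    chartIntegral c ν p (fun x ↦ mvfderiv 𝓘(ℝ, E) w x (e j x) - w x * meanCoeff e j x) = 0 := by
  let K := extChartAt 𝓘(ℝ, E) p '' tsupport w
  have hK : IsCompact K := isCompact_image_extChartAt hc hwp
  let Y : E → E := fun y ↦ (w ((extChartAt 𝓘(ℝ, E) p).symm y) * chartDensity c p y) •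
    chartField p (e j) y
  -- Extension by zero outside the chart. As `w` has compact support in the chart domain, the
  -- extended field is still `C^1`.
  let X : E → E := (extChartAt 𝓘(ℝ, E) p).target.indicator Y
  have hX0 : ∀ z ∉ K, X z = 0 := by
    intro z hz
    by_cases hzt : z ∈ (extChartAt 𝓘(ℝ, E) p).target
    · have : w ((extChartAt 𝓘(ℝ, E) p).symm z) = 0 :=
        image_eq_zero_of_notMem_tsupport (symm_notMem_of_notMem_image hzt hz)
      have hY : Y z = 0 := by simp only [Y, this, zero_mul, zero_smul]
      rw [← hY]
      exact Set.indicator_of_mem hzt Y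
    · exact Set.indicator_of_notMem hzt Y
  have hXev : ∀ z ∉ K, X =ᶠ[𝓝 z] 0 := fun z hz ↦
    Filter.eventually_of_mem (hK.isClosed.isOpen_compl.mem_nhds hz) hX0
  have hKt : K ⊆ (extChartAt 𝓘(ℝ, E) p).target := by
    rintro _ ⟨x, hx, rfl⟩
    exact (extChartAt 𝓘(ℝ, E) p).map_source (hwp hx)
  have hKN : ∀ z ∈ K, (extChartAt 𝓘(ℝ, E) p).symm z ∈ N := by
    rintro _ ⟨x, hx, rfl⟩
    rw [(extChartAt 𝓘(ℝ, E) p).left_inv (hwp hx)]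
    exact hwN hx
  have hXY : ∀ z ∈ (extChartAt 𝓘(ℝ, E) p).target, X =ᶠ[𝓝 z] Y := fun z hz ↦
    Filter.eventually_of_mem ((isOpen_extChartAt_target p).mem_nhds hz) fun y hy ↦
      Set.indicator_of_mem hy Y
  have hXs : ContDiff ℝ 1 X := by
    rw [contDiff_iff_contDiffAt]
    intro z
    by_cases hz : z ∈ K
    · refine ContDiffAt.congr_of_eventuallyEq ?_ (hXY z (hKt hz))
      have h1 : ContDiffAt ℝ 1 (fun y ↦ w ((extChartAt 𝓘(ℝ, E) p).symm y)) z :=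
        (((hw _).comp z (contMDiffAt_extChartAt_symm_of_mem (hKt hz))).contDiffAt).of_le (by simp)
      exact (h1.mul (contDiffAt_chartDensity he (hKt hz) (hKN z hz))).smul
        ((contDiffAt_chartField (hKt hz) (he.contMDiffAt j _ (hKN z hz))).of_le (by simp))
    · exact contDiffAt_const.congr_of_eventuallyEq (hXev z hz)
  have hXc : HasCompactSupport X := HasCompactSupport.intro hK hX0
  have hint := integral_trace_fderiv_eq_zero ν hXs hXc
  have hout : ∀ z ∉ K, LinearMap.trace ℝ E (fderiv ℝ X z).toLinearMap = 0 := by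
    intro z hz
    rw [(hXev z hz).fderiv_eq]
    simp
  rw [chartIntegral, ← hint, ← setIntegral_eq_integral_of_forall_compl_eq_zero
    (s := (extChartAt 𝓘(ℝ, E) p).target) fun z hz ↦ hout z fun h ↦ hz (hKt h)]
  refine setIntegral_congr_fun (isOpen_extChartAt_target p).measurableSet fun z hz ↦ ?_
  by_cases hzK : z ∈ K
  · rw [(hXY z hz).fderiv_eq]
    exact (trace_fderiv_chartField he hz (hKN z hzK) ((hw _).mdifferentiableAt (by simp)) j).symm
  · rw [hout z hzK]
    have hz' := symm_notMem_of_notMem_image hz hzK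
    have h1 : w =ᶠ[𝓝 ((extChartAt 𝓘(ℝ, E) p).symm z)] fun _ ↦ 0 :=
      notMem_tsupport_iff_eventuallyEq.1 hz'
    have h2 : mvfderiv 𝓘(ℝ, E) w ((extChartAt 𝓘(ℝ, E) p).symm z) = 0 := by
      rw [mvfderiv, h1.mfderiv_eq]
      exact mvfderiv_const _
    have h3 : mvfderiv 𝓘(ℝ, E) w ((extChartAt 𝓘(ℝ, E) p).symm z)
        (e j ((extChartAt 𝓘(ℝ, E) p).symm z)) = 0 := by rw [h2]; rfl
    rw [h3, h1.self_of_nhds, zero_mul, sub_zero, zero_mul]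

/-- Change of variables by the transition map; its Jacobian is absorbed by the transformation rule
of the density. -/
lemma chartIntegral_congr_chart {q : M} {g : M → ℝ}
    (hp : ∀ x, g x ≠ 0 → x ∈ (extChartAt 𝓘(ℝ, E) p).source)
    (hq : ∀ x, g x ≠ 0 → x ∈ (extChartAt 𝓘(ℝ, E) q).source) :
    chartIntegral c ν p g = chartIntegral c ν q g := by
  let S := (extChartAt 𝓘(ℝ, E) p).target ∩
    (extChartAt 𝓘(ℝ, E) p).symm ⁻¹' (extChartAt 𝓘(ℝ, E) q).source
  have hSo : IsOpen S := (continuousOn_extChartAt_symm p).isOpen_inter_preimage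
    (isOpen_extChartAt_target p) (isOpen_extChartAt_source q)
  have h1 : chartIntegral c ν p g = ∫ z in S,
      g ((extChartAt 𝓘(ℝ, E) p).symm z) * chartDensity c p z ∂ν := by
    refine setIntegral_eq_of_subset_of_forall_sdiff_eq_zero
      (isOpen_extChartAt_target p).measurableSet Set.inter_subset_left fun z hz ↦ ?_
    have : g ((extChartAt 𝓘(ℝ, E) p).symm z) = 0 := by
      by_contra h
      exact hz.2 ⟨hz.1, hq _ h⟩
    rw [this, zero_mul]
  have hST : chartTransition p q '' S ⊆ (extChartAt 𝓘(ℝ, E) q).target := by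
    rintro _ ⟨z, hz, rfl⟩
    exact (extChartAt 𝓘(ℝ, E) q).map_source hz.2
  have hleft : ∀ z ∈ S, chartTransition q p (chartTransition p q z) = z := by
    intro z hz
    simp only [chartTransition]
    rw [(extChartAt 𝓘(ℝ, E) q).left_inv hz.2, (extChartAt 𝓘(ℝ, E) p).right_inv hz.1]
  have h2 : chartIntegral c ν q g = ∫ z in chartTransition p q '' S,
      g ((extChartAt 𝓘(ℝ, E) q).symm z) * chartDensity c q z ∂ν := by
    refine setIntegral_eq_of_subset_of_forall_sdiff_eq_zero
      (isOpen_extChartAt_target q).measurableSet hST fun z hz ↦ ?_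
    have : g ((extChartAt 𝓘(ℝ, E) q).symm z) = 0 := by
      by_contra h
      have hp' := hp _ h
      refine hz.2 ⟨chartTransition q p z, ⟨(extChartAt 𝓘(ℝ, E) p).map_source hp', ?_⟩, ?_⟩
      · simp only [Set.mem_preimage, chartTransition]
        rw [(extChartAt 𝓘(ℝ, E) p).left_inv hp']
        exact (extChartAt 𝓘(ℝ, E) q).map_target hz.1
      · simp only [chartTransition]
        rw [(extChartAt 𝓘(ℝ, E) p).left_inv hp', (extChartAt 𝓘(ℝ, E) q).right_inv hz.1]
    rw [this, zero_mul]
  rw [h1, h2, integral_image_eq_integral_abs_det_fderiv_smul ν hSo.measurableSet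
    (fun z hz ↦ (differentiableAt_chartTransition hz.1 hz.2).hasFDerivAt.hasFDerivWithinAt)
    (Set.LeftInvOn.injOn hleft)]
  refine setIntegral_congr_fun hSo.measurableSet fun z hz ↦ ?_
  rw [chartDensity_transition hz.1 hz.2, smul_eq_mul]
  simp only [chartTransition]
  rw [(extChartAt 𝓘(ℝ, E) q).left_inv hz.2]
  ring

lemma continuousOn_chartIntegrand {g : M → ℝ} (hg : Continuous g) :
    ContinuousOn (fun z ↦ g ((extChartAt 𝓘(ℝ, E) p).symm z) * chartDensity c p z)
      (extChartAt 𝓘(ℝ, E) p).target :=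
  (hg.comp_continuousOn (continuousOn_extChartAt_symm p)).mul (continuousOn_chartDensity p)

lemma integrableOn_chartIntegrand {g : M → ℝ} (hg : Continuous g) (hc : IsCompact (tsupport g))
    (hgp : tsupport g ⊆ (extChartAt 𝓘(ℝ, E) p).source) :
    IntegrableOn (fun z ↦ g ((extChartAt 𝓘(ℝ, E) p).symm z) * chartDensity c p z)
      (extChartAt 𝓘(ℝ, E) p).target ν := by
  have hK := isCompact_image_extChartAt hc hgp
  have hKt : extChartAt 𝓘(ℝ, E) p '' tsupport g ⊆ (extChartAt 𝓘(ℝ, E) p).target := by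
    rintro _ ⟨x, hx, rfl⟩
    exact (extChartAt 𝓘(ℝ, E) p).map_source (hgp hx)
  refine (((continuousOn_chartIntegrand hg).mono hKt).integrableOn_compact
    hK).of_forall_sdiff_eq_zero (isOpen_extChartAt_target p).measurableSet fun z hz ↦ ?_
  rw [image_eq_zero_of_notMem_tsupport (symm_notMem_of_notMem_image hz.1 hz.2), zero_mul]

lemma chartIntegral_nonneg {g : M → ℝ} (hg : ∀ x, 0 ≤ g x) : 0 ≤ chartIntegral c ν p g :=
  setIntegral_nonneg (isOpen_extChartAt_target p).measurableSet fun _ hz ↦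
    mul_nonneg (hg _) (chartDensity_pos hz).le

lemma eq_zero_of_chartIntegral_eq_zero {g : M → ℝ} (hg : Continuous g)
    (hc : IsCompact (tsupport g)) (hgp : tsupport g ⊆ (extChartAt 𝓘(ℝ, E) p).source)
    (hg0 : ∀ x, 0 ≤ g x) (h : chartIntegral c ν p g = 0) : ∀ x, g x = 0 := by
  have hms := (isOpen_extChartAt_target (I := 𝓘(ℝ, E)) p).measurableSet
  have h1 := (setIntegral_eq_zero_iff_of_nonneg_ae
    (ae_restrict_of_forall_mem hms fun z hz ↦ mul_nonneg (hg0 _) (chartDensity_pos hz).le)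
    (integrableOn_chartIntegrand hg hc hgp)).1 h
  have h2 := Measure.eqOn_open_of_ae_eq h1 (isOpen_extChartAt_target p)
    (continuousOn_chartIntegrand hg) continuousOn_const
  intro x
  by_cases hx : x ∈ (extChartAt 𝓘(ℝ, E) p).source
  · have h3 := h2 ((extChartAt 𝓘(ℝ, E) p).map_source hx)
    dsimp only at h3
    rw [(extChartAt 𝓘(ℝ, E) p).left_inv hx] at h3
    exact (mul_eq_zero.1 h3).resolve_right
      (chartDensity_pos ((extChartAt 𝓘(ℝ, E) p).map_source hx)).ne'
  · exact image_eq_zero_of_notMem_tsupport fun h ↦ hx (hgp h)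

lemma chartIntegral_add {g h : M → ℝ} (hg : Continuous g) (hgc : IsCompact (tsupport g))
    (hgp : tsupport g ⊆ (extChartAt 𝓘(ℝ, E) p).source) (hh : Continuous h)
    (hhc : IsCompact (tsupport h)) (hhp : tsupport h ⊆ (extChartAt 𝓘(ℝ, E) p).source) :
    chartIntegral c ν p (fun x ↦ g x + h x) = chartIntegral c ν p g + chartIntegral c ν p h := by
  simp only [chartIntegral, add_mul]
  exact integral_add (integrableOn_chartIntegrand hg hgc hgp)
    (integrableOn_chartIntegrand hh hhc hhp)

lemma chartIntegral_smul (r : ℝ) (g : M → ℝ) :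
    chartIntegral c ν p (fun x ↦ r * g x) = r * chartIntegral c ν p g := by
  simp only [chartIntegral, mul_assoc]
  exact integral_const_mul _ _

lemma chartIntegral_sum {κ : Type*} (s : Finset κ) {g : κ → M → ℝ} (hg : ∀ i ∈ s, Continuous (g i))
    (hgc : ∀ i ∈ s, IsCompact (tsupport (g i)))
    (hgp : ∀ i ∈ s, tsupport (g i) ⊆ (extChartAt 𝓘(ℝ, E) p).source) :
    chartIntegral c ν p (fun x ↦ ∑ i ∈ s, g i x) = ∑ i ∈ s, chartIntegral c ν p (g i) := by
  simp only [chartIntegral, Finset.sum_mul]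
  exact integral_finsetSum _ fun i hi ↦ integrableOn_chartIntegrand (hg i hi) (hgc i hi) (hgp i hi)

variable (ν c M) in
/-- The Riemannian volume of a compact manifold, as a positive linear functional. -/
theorem exists_volumeFunctional [CompactSpace M] [T2Space M] :
    ∃ J : C(M, ℝ) →ₗ[ℝ] ℝ, (∀ g : C(M, ℝ), (∀ x, 0 ≤ g x) → 0 ≤ J g) ∧
      (∀ g : C(M, ℝ), (∀ x, 0 ≤ g x) → J g ≤ 0 → ∀ x, g x = 0) ∧
      ∀ (p : M) (g : C(M, ℝ)), tsupport g ⊆ (extChartAt 𝓘(ℝ, E) p).source →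
        J g = chartIntegral c ν p g := by
  obtain ⟨t, ht⟩ := isCompact_univ.elim_finite_subcover
    (fun p : M ↦ (extChartAt 𝓘(ℝ, E) p).source) (fun p ↦ isOpen_extChartAt_source p)
    fun x _ ↦ Set.mem_iUnion.2 ⟨x, mem_extChartAt_source x⟩
  obtain ⟨ρ, hρ⟩ := PartitionOfUnity.exists_isSubordinate (s := Set.univ) isClosed_univ
    (fun p : t ↦ (extChartAt 𝓘(ℝ, E) (p : M)).source) (fun p ↦ isOpen_extChartAt_source _)
    (fun x hx ↦ by simpa using ht hx)
  have hsum : ∀ x, ∑ i, ρ i x = 1 := fun x ↦ by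
    rw [← finsum_eq_sum_of_fintype]; exact ρ.sum_eq_one (Set.mem_univ x)
  have hcomp : ∀ g : M → ℝ, IsCompact (tsupport g) := fun g ↦ (isClosed_tsupport g).isCompact
  have hsub : ∀ (i : t) (g : M → ℝ), tsupport (fun x ↦ ρ i x * g x) ⊆
      (extChartAt 𝓘(ℝ, E) (i : M)).source := fun i g ↦
    (tsupport_mul_subset_left (f := ρ i) (g := g)).trans (hρ i)
  have hcont : ∀ (i : t) (g : C(M, ℝ)), Continuous fun x ↦ ρ i x * g x := fun i g ↦
    (ρ i).continuous.mul g.continuous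
  -- The functional adds up the chart integrals of the pieces `ρ i * g` of a partition of unity.
  refine ⟨{ toFun := fun g ↦ ∑ i : t, chartIntegral c ν (i : M) (fun x ↦ ρ i x * g x)
            map_add' := fun g h ↦ ?_, map_smul' := fun r g ↦ ?_ }, fun g hg ↦ ?_,
    fun g hg hg0 x ↦ ?_, fun p g hgp ↦ ?_⟩
  · rw [← Finset.sum_add_distrib]
    refine Finset.sum_congr rfl fun i _ ↦ ?_
    rw [← chartIntegral_add (hcont i g) (hcomp _) (hsub i g) (hcont i h) (hcomp _) (hsub i h)]
    simp [mul_add]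
  · simp only [RingHom.id_apply, smul_eq_mul, Finset.mul_sum]
    refine Finset.sum_congr rfl fun i _ ↦ ?_
    rw [← chartIntegral_smul]
    congr 1
    funext x
    simp only [ContinuousMap.smul_apply, smul_eq_mul]
    ring
  · exact Finset.sum_nonneg fun i _ ↦ chartIntegral_nonneg fun x ↦ mul_nonneg (ρ.nonneg i x) (hg x)
  · have h0 : ∀ i : t, 0 ≤ chartIntegral c ν (i : M) (fun x ↦ ρ i x * g x) := fun i ↦
      chartIntegral_nonneg fun x ↦ mul_nonneg (ρ.nonneg i x) (hg x)
    have h1 := (Finset.sum_eq_zero_iff_of_nonneg fun i _ ↦ h0 i).1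
      (le_antisymm hg0 (Finset.sum_nonneg fun i _ ↦ h0 i))
    have h2 : ∀ i, ρ i x * g x = 0 := fun i ↦
      eq_zero_of_chartIntegral_eq_zero (hcont i g) (hcomp _) (hsub i g)
        (fun x ↦ mul_nonneg (ρ.nonneg i x) (hg x)) (h1 i (Finset.mem_univ i)) x
    have h3 := hsum x
    have h4 : (∑ i, ρ i x) * g x = 0 := by
      rw [Finset.sum_mul]; exact Finset.sum_eq_zero fun i _ ↦ h2 i
    rwa [h3, one_mul] at h4
  · have h1 : ∀ i : t, tsupport (fun x ↦ ρ i x * g x) ⊆ (extChartAt 𝓘(ℝ, E) p).source := fun i ↦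
      (tsupport_mul_subset_right (f := ρ i) (g := g)).trans hgp
    -- If `g` is supported in one chart domain, each piece may be integrated in that chart instead,
    -- where the `ρ i` sum to one again.
    have h2 : ∀ i : t, chartIntegral c ν (i : M) (fun x ↦ ρ i x * g x) =
        chartIntegral c ν p (fun x ↦ ρ i x * g x) := fun i ↦
      chartIntegral_congr_chart (fun x hx ↦ hsub i g (subset_tsupport _ hx))
        fun x hx ↦ h1 i (subset_tsupport _ hx)
    simp only [LinearMap.coe_mk, AddHom.coe_mk, h2]
    rw [← chartIntegral_sum _ (fun i _ ↦ hcont i g) (fun i _ ↦ hcomp _) fun i _ ↦ h1 i]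
    congr 1
    funext x
    rw [← Finset.sum_mul, hsum, one_mul]

end

end RiemannianGeometry

/-! ### Gradient bounds for nonnegative functions -/

namespace RiemannianGeometry

noncomputable section

set_option linter.unusedSectionVars false

/-- A nonnegative `C²` function controls the square of its derivative. -/
lemma exists_sq_fderiv_le {E : Type*} [NormedAddCommGroup E] [NormedSpace ℝ E] {g : E → ℝ} {z₀ : E}
    (hg : ContDiffAt ℝ 2 g z₀) (h0 : ∀ᶠ z in 𝓝 z₀, 0 ≤ g z) :
    ∃ C, 0 ≤ C ∧ ∀ᶠ z in 𝓝 z₀, ∀ v, fderiv ℝ g z v ^ 2 ≤ C * g z * ‖v‖ ^ 2 := by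
  have hg1 : ContDiffAt ℝ 1 (fderiv ℝ g) z₀ := hg.fderiv_right (by norm_num)
  obtain ⟨K₀, t, ht, hK₀⟩ := hg1.exists_lipschitzOnWith
  have hbound : ∀ᶠ z in 𝓝 z₀, ‖fderiv ℝ g z‖ < ‖fderiv ℝ g z₀‖ + 1 :=
    hg1.continuousAt.norm.eventually_lt continuousAt_const (by simp)
  have hdiff : ∀ᶠ z in 𝓝 z₀, DifferentiableAt ℝ g z :=
    (hg.eventually (by simp)).mono fun z hz ↦ hz.differentiableAt (by simp)
  obtain ⟨r, hr, hball⟩ := Metric.eventually_nhds_iff_ball.1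
    ((Filter.eventually_mem_set.2 ht).and (h0.and (hbound.and hdiff)))
  set G := ‖fderiv ℝ g z₀‖ + 1 with hG
  have hG0 : 0 < G := by positivity
  -- The Lipschitz constant `K₀` of the derivative bounds the Taylor remainder. The summand `G / r`
  -- keeps the displacement chosen below shorter than `r / 2`, and `1` makes this strict and `K`
  -- positive.
  set K : ℝ := K₀ + G / r + 1 with hK
  have hKpos : 0 < K := by positivity
  refine ⟨4 * K, by positivity, ?_⟩
  filter_upwards [Metric.ball_mem_nhds z₀ (half_pos hr)] with z hz v
  have hball' : ∀ s : E, ‖s‖ < r / 2 → z + s ∈ Metric.ball z₀ r := fun s hs ↦ by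
    rw [Metric.mem_ball] at hz ⊢
    calc dist (z + s) z₀ ≤ dist (z + s) z + dist z z₀ := dist_triangle _ _ _
      _ < r / 2 + r / 2 := by
        gcongr
        simpa [dist_eq_norm] using hs
      _ = r := by ring
  have hz0 : z ∈ Metric.ball z₀ r := by simpa using hball' 0 (by simpa using half_pos hr)
  -- Nonnegativity of `g` at `z + s` bounds a quadratic expression in `s` from below.
  have htaylor : ∀ s : E, ‖s‖ < r / 2 → 0 ≤ g z + fderiv ℝ g z s + K * ‖s‖ ^ 2 := by
    intro s hs
    have hsub : Metric.closedBall z ‖s‖ ⊆ Metric.ball z₀ r := fun y hy ↦ by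
      have := hball' (y - z) (by
        rw [← dist_eq_norm]
        exact (Metric.mem_closedBall.1 hy).trans_lt hs)
      simpa using this
    have h1 := (convex_closedBall z ‖s‖).norm_image_sub_le_of_norm_fderiv_le' (f := g)
      (φ := fderiv ℝ g z) (C := K₀ * ‖s‖) (𝕜 := ℝ) (x := z) (y := z + s)
      (fun y hy ↦ (hball y (hsub hy)).2.2.2) (fun y hy ↦ by
        rw [← dist_eq_norm]
        refine (hK₀.dist_le_mul y (hball y (hsub hy)).1 z (hball z hz0).1).trans ?_
        gcongr
        exact Metric.mem_closedBall.1 hy)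
      (Metric.mem_closedBall_self (norm_nonneg s)) (by simp [dist_eq_norm])
    rw [add_sub_cancel_left, Real.norm_eq_abs] at h1
    have h2 := (hball _ (hball' s hs)).2.1
    have h3 := (abs_le.1 h1).2
    have h4 : (K₀ : ℝ) * ‖s‖ * ‖s‖ ≤ K * ‖s‖ ^ 2 := by
      rw [mul_assoc, ← sq]
      gcongr
      rw [hK]
      have : 0 ≤ G / r := by positivity
      linarith
    linarith
  rcases eq_or_ne v 0 with rfl | hv
  · simp
  have hv' : 0 < ‖v‖ := norm_pos_iff.2 hv
  set D := fderiv ℝ g z v with hD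
  have hDle : |D| ≤ G * ‖v‖ := by
    refine (Real.norm_eq_abs D ▸ (fderiv ℝ g z).le_opNorm v).trans ?_
    gcongr
    exact (hball z hz0).2.2.1.le
  -- This displacement minimizes the quadratic along the line through `v`; nonnegativity there is
  -- the bound on `D ^ 2`, with the constant `4 * K`.
  have h1 := htaylor (-(D / (2 * K * ‖v‖ ^ 2)) • v) (by
    rw [norm_smul, norm_neg, Real.norm_eq_abs, abs_div, abs_of_pos (by positivity : 0 < 2 * K * ‖v‖ ^ 2)]
    have h2 : |D| / (2 * K * ‖v‖ ^ 2) * ‖v‖ = |D| / ‖v‖ / (2 * K) := by field_simp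
    rw [h2]
    have h3 : |D| / ‖v‖ ≤ G := (div_le_iff₀ hv').2 hDle
    have h4 : G < r * K := by
      rw [hK, mul_add, mul_add, mul_div_cancel₀ _ hr.ne']
      have : 0 ≤ r * (K₀ : ℝ) := by positivity
      linarith
    rw [div_lt_div_iff₀ (by positivity) two_pos]
    linarith)
  rw [map_smul, norm_smul, norm_neg, Real.norm_eq_abs, mul_pow, sq_abs, smul_eq_mul, ← hD] at h1
  have h2 : g z + -(D / (2 * K * ‖v‖ ^ 2)) * D + K * ((D / (2 * K * ‖v‖ ^ 2)) ^ 2 * ‖v‖ ^ 2) =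
      g z - D ^ 2 / (4 * K * ‖v‖ ^ 2) := by
    field_simp
    ring
  rw [h2, sub_nonneg, div_le_iff₀ (by positivity)] at h1
  linarith

variable {E : Type*} [NormedAddCommGroup E] [NormedSpace ℝ E] [FiniteDimensional ℝ E]
  [CompleteSpace E]
  {M : Type*} [TopologicalSpace M] [ChartedSpace E M] [IsManifold 𝓘(ℝ, E) ∞ M]

lemma mvfderiv_eq_fderiv_chartField {p : M} {z : E} (hz : z ∈ (extChartAt 𝓘(ℝ, E) p).target)
    {w : M → ℝ} (hw : MDiffAt w ((extChartAt 𝓘(ℝ, E) p).symm z))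
    (X : Π x : M, TangentSpace 𝓘(ℝ, E) x) :
    mvfderiv 𝓘(ℝ, E) w ((extChartAt 𝓘(ℝ, E) p).symm z) (X ((extChartAt 𝓘(ℝ, E) p).symm z)) =
      fderiv ℝ (fun y ↦ w ((extChartAt 𝓘(ℝ, E) p).symm y)) z (chartField p X z) := by
  have hψ := (contMDiffAt_extChartAt_symm_of_mem hz).mdifferentiableAt (n := ∞) (by simp)
  have h1 := (hw.hasMFDerivAt.comp z hψ.hasMFDerivAt).mfderiv
  rw [mfderiv_eq_fderiv] at h1
  have h2 : chartSymmDeriv hz (chartField p X z) = X ((extChartAt 𝓘(ℝ, E) p).symm z) := by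
    rw [chartField, ← chartSymmDeriv_symm_apply hz, LinearEquiv.apply_symm_apply]
  rw [chartSymmDeriv_apply] at h2
  rw [← h2]
  exact (congrArg (fun T : E →L[ℝ] ℝ ↦ T (chartField p X z)) h1).symm

variable [RiemannianBundle (fun x : M ↦ TangentSpace 𝓘(ℝ, E) x)]
  [IsContMDiffRiemannianBundle 𝓘(ℝ, E) ∞ E (fun x : M ↦ TangentSpace 𝓘(ℝ, E) x)]

/-- The Euclidean estimate is applied to the coordinate expressions of an orthonormal frame, which
are locally bounded; Cauchy–Schwarz then passes to arbitrary tangent vectors with their Riemannian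
norm. -/
lemma exists_sq_mvfderiv_le_nhds {f : M → ℝ} (hf : CMDiff ∞ f) (h0 : ∀ x, 0 ≤ f x) (p : M) :
    ∃ C, 0 ≤ C ∧ ∀ᶠ x in 𝓝 p, ∀ v : TangentSpace 𝓘(ℝ, E) x,
      mvfderiv 𝓘(ℝ, E) f x v ^ 2 ≤ C * f x * ‖v‖ ^ 2 := by
  obtain ⟨e, N, hpN, he⟩ := exists_isOrthonormalFrameOn (I := 𝓘(ℝ, E)) rfl p
  have hz₀ := mem_extChartAt_target (I := 𝓘(ℝ, E)) p
  have hfψ : ContDiffAt ℝ ∞ (fun y ↦ f ((extChartAt 𝓘(ℝ, E) p).symm y)) (extChartAt 𝓘(ℝ, E) p p) :=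
    ((hf _).comp _ (contMDiffAt_extChartAt_symm_of_mem hz₀)).contDiffAt
  obtain ⟨C, hC, hCz⟩ := exists_sq_fderiv_le (hfψ.of_le (WithTop.coe_le_coe.2 le_top))
    (.of_forall fun z ↦ h0 _)
  have hpz : (extChartAt 𝓘(ℝ, E) p).symm (extChartAt 𝓘(ℝ, E) p p) = p := extChartAt_to_inv p
  have hb : ∀ i, ∀ᶠ z in 𝓝 (extChartAt 𝓘(ℝ, E) p p), ‖chartField p (e i) z‖ <
      ‖chartField p (e i) (extChartAt 𝓘(ℝ, E) p p)‖ + 1 := fun i ↦ by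
    have h1 : ContinuousAt (chartField p (e i)) (extChartAt 𝓘(ℝ, E) p p) :=
      (contDiffAt_chartField hz₀ (he.contMDiffAt i _ (by rwa [hpz]))).continuousAt
    exact h1.norm.eventually_lt continuousAt_const (by simp)
  let m : ℝ := ∑ i, (‖chartField p (e i) (extChartAt 𝓘(ℝ, E) p p)‖ + 1) ^ 2
  refine ⟨C * m, by positivity, ?_⟩
  have hev := (continuousAt_extChartAt (I := 𝓘(ℝ, E)) p).eventually
    (hCz.and (Filter.eventually_all.2 hb))
  filter_upwards [hev, he.isOpen.mem_nhds hpN, extChartAt_source_mem_nhds (I := 𝓘(ℝ, E)) p]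
    with x hx hxN hxs v
  obtain ⟨hx1, hx2⟩ := hx
  have hxz := (extChartAt 𝓘(ℝ, E) p).left_inv hxs
  have hzt := (extChartAt 𝓘(ℝ, E) p).map_source hxs
  have hei : ∀ i, mvfderiv 𝓘(ℝ, E) f x (e i x) ^ 2 ≤ C * f x *
      (‖chartField p (e i) (extChartAt 𝓘(ℝ, E) p p)‖ + 1) ^ 2 := by
    intro i
    have h1 := mvfderiv_eq_fderiv_chartField hzt (w := f) ((hf _).mdifferentiableAt (by simp)) (e i)
    have h2 := hx1 (chartField p (e i) (extChartAt 𝓘(ℝ, E) p x))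
    rw [← h1, hxz] at h2
    refine h2.trans ?_
    have := h0 x
    gcongr
    exact (hx2 i).le
  have hv : mvfderiv 𝓘(ℝ, E) f x v = ∑ i, inner ℝ (e i x) v * mvfderiv 𝓘(ℝ, E) f x (e i x) := by
    conv_lhs => rw [← he.sum_inner_smul hxN v]
    rw [map_sum]
    exact Finset.sum_congr rfl fun i _ ↦ map_smul _ _ _
  have hn : ∑ i, (inner ℝ (e i x) v : ℝ) ^ 2 = ‖v‖ ^ 2 := by
    have := (he.basis hxN).sum_sq_norm_inner_right v
    simpa [he.basis_apply] using this
  rw [hv]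
  refine (Finset.sum_mul_sq_le_sq_mul_sq _ _ _).trans ?_
  rw [hn, mul_comm]
  gcongr
  refine (Finset.sum_le_sum fun i _ ↦ hei i).trans (le_of_eq ?_)
  rw [← Finset.mul_sum]
  ring

lemma exists_sq_mvfderiv_le [CompactSpace M] {f : M → ℝ} (hf : CMDiff ∞ f) (h0 : ∀ x, 0 ≤ f x) :
    ∃ C, 0 ≤ C ∧ ∀ x, ∀ v : TangentSpace 𝓘(ℝ, E) x,
      mvfderiv 𝓘(ℝ, E) f x v ^ 2 ≤ C * f x * ‖v‖ ^ 2 := by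
  have key : ∃ C, 0 ≤ C ∧ ∀ x ∈ (Set.univ : Set M), ∀ v : TangentSpace 𝓘(ℝ, E) x,
      mvfderiv 𝓘(ℝ, E) f x v ^ 2 ≤ C * f x * ‖v‖ ^ 2 := by
    refine isCompact_univ.induction_on
      (p := fun s ↦ ∃ C, 0 ≤ C ∧ ∀ x ∈ s, ∀ v : TangentSpace 𝓘(ℝ, E) x,
        mvfderiv 𝓘(ℝ, E) f x v ^ 2 ≤ C * f x * ‖v‖ ^ 2) ⟨0, le_rfl, by simp⟩ ?_ ?_ ?_
    · rintro s t hst ⟨C, hC, h⟩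
      exact ⟨C, hC, fun x hx ↦ h x (hst hx)⟩
    · rintro s t ⟨C, hC, h⟩ ⟨C', hC', h'⟩
      refine ⟨C + C', add_nonneg hC hC', fun x hx v ↦ ?_⟩
      have h1 : 0 ≤ C * f x * ‖v‖ ^ 2 := mul_nonneg (mul_nonneg hC (h0 x)) (sq_nonneg _)
      have h2 : 0 ≤ C' * f x * ‖v‖ ^ 2 := mul_nonneg (mul_nonneg hC' (h0 x)) (sq_nonneg _)
      rw [add_mul, add_mul]
      rcases hx with hx | hx
      · linarith [h x hx v]
      · linarith [h' x hx v]
    · intro x _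
      obtain ⟨C, hC, h⟩ := exists_sq_mvfderiv_le_nhds hf h0 x
      exact ⟨_, mem_nhdsWithin_of_mem_nhds h, C, hC, fun y hy ↦ hy⟩
  obtain ⟨C, hC, h⟩ := key
  exact ⟨C, hC, fun x ↦ h x trivial⟩

end

end RiemannianGeometry

/-! ### Independence of the choice of eigenframe -/

namespace RiemannianGeometry

noncomputable section

set_option linter.unusedSectionVars false

section Permutation

open Polynomial

variable {ι : Type*} [Fintype ι] [DecidableEq ι]

lemma nodalPoly_comp_perm (μ : ι → ℝ) (σ : Equiv.Perm ι) :
    nodalPoly (fun i ↦ μ (σ i)) = nodalPoly μ :=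
  Equiv.prod_comp σ fun i ↦ X - C (μ i)

lemma gapDefect_comp_perm (μ : ι → ℝ) (σ : Equiv.Perm ι) (j : ι) :
    gapDefect (fun i ↦ μ (σ i)) j = gapDefect μ (σ j) := by
  have h1 : ∀ i, gapCoeff (fun i ↦ μ (σ i)) i j = gapCoeff μ (σ i) (σ j) := fun i ↦ by
    rw [gapCoeff, gapCoeff, nodalPoly_comp_perm]
  have h2 : ∀ F : ι → ℝ, ∑ i ∈ Finset.univ.erase j, F (σ i) =
      ∑ i ∈ Finset.univ.erase (σ j), F i := fun F ↦
    Finset.sum_equiv σ (by simp) (by simp)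
  simp only [gapDefect, h1]
  rw [h2 fun i ↦ gapCoeff μ i (σ j) ^ 2, h2 fun i ↦ gapCoeff μ i (σ j)]

end Permutation

variable {E : Type*} [NormedAddCommGroup E] [NormedSpace ℝ E] [FiniteDimensional ℝ E]
  [CompleteSpace E]
  {H : Type*} [TopologicalSpace H] {I : ModelWithCorners ℝ E H}
  {M : Type*} [TopologicalSpace M] [ChartedSpace H M] [IsManifold I ∞ M]
  [RiemannianBundle (fun x : M ↦ TangentSpace I x)]
  [IsContMDiffRiemannianBundle I ∞ E (fun x : M ↦ TangentSpace I x)]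
  {ι : Type*} [Fintype ι] [DecidableEq ι]

namespace IsEigenframeOn

variable {a : Π x : M, TangentSpace I x →L[ℝ] TangentSpace I x →L[ℝ] ℝ} {f : M → ℝ}
  {e e' : ι → Π x : M, TangentSpace I x} {μ μ' : ι → M → ℝ} {N N' : Set M} {x : M}

lemma dualEndo_apply (he : IsEigenframeOn a f e μ N) (hx : x ∈ N) (i : ι) :
    dualEndo a x (e i x) = μ i x • e i x := by
  refine ext_inner_right ℝ fun v ↦ ?_
  rw [inner_dualEndo, he.apply_left x hx, real_inner_smul_left]

lemma charpoly_eq (he : IsEigenframeOn a f e μ N) (hx : x ∈ N) :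
    (dualEndo a x).charpoly = nodalPoly fun i ↦ μ i x :=
  charpoly_eq_nodalPoly (he.basis hx) fun i ↦ by
    rw [he.basis_apply, he.dualEndo_apply hx]

/-- Two eigenframes agree at each point up to permutation and signs. -/
lemma exists_perm (he : IsEigenframeOn a f e μ N) (he' : IsEigenframeOn a f e' μ' N')
    (ha : ∀ (x : M) (v w : TangentSpace I x), a x v w = a x w v) (hx : x ∈ N) (hx' : x ∈ N') :
    ∃ σ : Equiv.Perm ι, (∀ i, μ' i x = μ (σ i) x) ∧
      ∀ i, ∃ s : ℝ, s ^ 2 = 1 ∧ e' i x = s • e (σ i) x := by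
  have hpoly : nodalPoly (fun i ↦ μ i x) = nodalPoly fun i ↦ μ' i x := by
    rw [← he.charpoly_eq hx, he'.charpoly_eq hx']
  have hex : ∀ i, ∃ j, μ' i x = μ j x := by
    intro i
    have h : (nodalPoly fun i ↦ μ i x).eval (μ' i x) = 0 := by
      rw [hpoly]; exact eval_nodalPoly (fun i ↦ μ' i x) i
    rw [nodalPoly, Polynomial.eval_prod, Finset.prod_eq_zero_iff] at h
    obtain ⟨j, -, hj⟩ := h
    exact ⟨j, sub_eq_zero.1 (by simpa using hj)⟩
  choose σ hσ using hex
  have hinj : Function.Injective σ := fun i j hij ↦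
    he'.injective x hx' (show μ' i x = μ' j x by rw [hσ i, hσ j, hij])
  refine ⟨Equiv.ofBijective σ (Finite.injective_iff_bijective.1 hinj), hσ, fun i ↦ ?_⟩
  have hperp : ∀ k ≠ σ i, (inner ℝ (e k x) (e' i x) : ℝ) = 0 := by
    intro k hk
    have h1 := he.apply_left x hx k (e' i x)
    rw [ha, he'.apply_left x hx', hσ i, real_inner_comm] at h1
    have h2 : μ (σ i) x - μ k x ≠ 0 := sub_ne_zero.2 ((he.injective x hx).ne hk.symm)
    refine (mul_eq_zero.1 ?_).resolve_left h2
    rw [sub_mul, h1, sub_self]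
  have hsum : e' i x = (inner ℝ (e (σ i) x) (e' i x) : ℝ) • e (σ i) x := by
    conv_lhs => rw [← he.sum_inner_smul hx (e' i x)]
    refine Finset.sum_eq_single (σ i) (fun k _ hk ↦ ?_) (by simp)
    rw [hperp k hk, zero_smul]
  refine ⟨inner ℝ (e (σ i) x) (e' i x), ?_, hsum⟩
  have h1 := he'.inner_eq hx' i i
  rw [hsum, real_inner_smul_left, real_inner_smul_right, he.inner_eq hx] at h1
  simpa [sq] using h1

end IsEigenframeOn

variable {a : Π x : M, TangentSpace I x →L[ℝ] TangentSpace I x →L[ℝ] ℝ} {f : M → ℝ}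

variable (ι a f) in
/-- The vector field `V` and the function `S` are, on the domain of each eigenframe `e`, the field
`∑ i, ∇_{e i} e i` and twice its divergence. -/
def IsEigenDivergence (V : Π x : M, TangentSpace I x) (S : M → ℝ) : Prop :=
  ∀ (e : ι → Π x : M, TangentSpace I x) (μ : ι → M → ℝ) (N : Set M), IsEigenframeOn a f e μ N →
    ∀ x ∈ N, V x = ∑ j, meanCoeff e j x • e j x ∧
      S x = scalarCurvature I x +
        ∑ j, mvfderiv I f x (e j x) ^ 2 * gapDefect (fun k ↦ μ k x) j

/-- Two eigenframes at a point differ by a permutation and signs. By `meanCoeff_eq` each summand of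
either expression contains `e j` exactly twice, so the signs square to one, and the permutation only
reorders the sum. Points without an eigenframe receive the value `0`. -/
lemma exists_isEigenDivergence (ha : ∀ (x : M) (v w : TangentSpace I x), a x v w = a x w v)
    (hcod : IsCodazzi a) : ∃ V S, IsEigenDivergence ι a f V S := by
  have key : ∀ x : M, ∃ (v : TangentSpace I x) (s : ℝ),
      ∀ (e : ι → Π x : M, TangentSpace I x) (μ : ι → M → ℝ) (N : Set M),
        IsEigenframeOn a f e μ N → x ∈ N → v = ∑ j, meanCoeff e j x • e j x ∧
          s = scalarCurvature I x +
            ∑ j, mvfderiv I f x (e j x) ^ 2 * gapDefect (fun k ↦ μ k x) j := by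
    intro x
    by_cases h : ∃ (e : ι → Π x : M, TangentSpace I x) (μ : ι → M → ℝ) (N : Set M),
        IsEigenframeOn a f e μ N ∧ x ∈ N
    · obtain ⟨e, μ, N, he, hx⟩ := h
      refine ⟨∑ j, meanCoeff e j x • e j x, scalarCurvature I x +
        ∑ j, mvfderiv I f x (e j x) ^ 2 * gapDefect (fun k ↦ μ k x) j, fun e' μ' N' he' hx' ↦ ?_⟩
      obtain ⟨σ, hσ, hs⟩ := he.exists_perm he' ha hx hx'
      choose s hs2 hse using hs
      have hμ : (fun k ↦ μ' k x) = fun k ↦ μ (σ k) x := funext hσ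
      constructor
      · symm
        rw [← Equiv.sum_comp σ fun j ↦ meanCoeff e j x • e j x]
        refine Finset.sum_congr rfl fun j _ ↦ ?_
        rw [he'.meanCoeff_eq hx' ha hcod, he.meanCoeff_eq hx ha hcod, hse j, map_smul, hμ, hσ j,
          nodalPoly_comp_perm (fun k ↦ μ k x), smul_smul, smul_eq_mul]
        congr 1
        linear_combination (mvfderiv I f x (e (σ j) x) *
          ((Polynomial.derivative (Polynomial.derivative
            (nodalPoly fun k ↦ μ k x))).eval (μ (σ j) x) /
          (2 * (Polynomial.derivative (nodalPoly fun k ↦ μ k x)).eval (μ (σ j) x) ^ 2))) * hs2 j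
      · congr 1
        symm
        rw [← Equiv.sum_comp σ fun j ↦ mvfderiv I f x (e j x) ^ 2 * gapDefect (fun k ↦ μ k x) j]
        refine Finset.sum_congr rfl fun j _ ↦ ?_
        rw [hse j, map_smul, hμ, gapDefect_comp_perm (fun k ↦ μ k x), smul_eq_mul, mul_pow, hs2,
          one_mul]
    · exact ⟨0, 0, fun e μ N he hx ↦ (h ⟨e, μ, N, he, hx⟩).elim⟩
  choose V S h using key
  exact ⟨V, S, fun e μ N he x hx ↦ h x e μ N he hx⟩

end

end RiemannianGeometry

/-! ### The integral of `div (ψ V)` vanishes -/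

namespace RiemannianGeometry

noncomputable section

set_option linter.unusedSectionVars false

open MeasureTheory

variable {E : Type*} [NormedAddCommGroup E] [NormedSpace ℝ E] [FiniteDimensional ℝ E]
  [CompleteSpace E]
  {M : Type*} [TopologicalSpace M] [ChartedSpace E M] [IsManifold 𝓘(ℝ, E) ∞ M]
  [RiemannianBundle (fun x : M ↦ TangentSpace 𝓘(ℝ, E) x)]
  [IsContMDiffRiemannianBundle 𝓘(ℝ, E) ∞ E (fun x : M ↦ TangentSpace 𝓘(ℝ, E) x)]
  {ι : Type*} [Fintype ι] [DecidableEq ι] {e : ι → Π x : M, TangentSpace 𝓘(ℝ, E) x} {N : Set M} {μ : ι → M → ℝ}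
  {a : Π x : M, TangentSpace 𝓘(ℝ, E) x →L[ℝ] TangentSpace 𝓘(ℝ, E) x →L[ℝ] ℝ} {f : M → ℝ}
  {V : Π x : M, TangentSpace 𝓘(ℝ, E) x} {S : M → ℝ}

/-- The divergence of `ψ V`, when `S` is twice the divergence of `V`. -/
def testDivergence (V : Π x : M, TangentSpace 𝓘(ℝ, E) x) (S ψ : M → ℝ) (x : M) : ℝ :=
  mvfderiv 𝓘(ℝ, E) ψ x (V x) + ψ x * (S x / 2)

lemma mvfderiv_eq_zero_of_notMem_tsupport {ψ : M → ℝ} {x : M} (hx : x ∉ tsupport ψ)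
    (v : TangentSpace 𝓘(ℝ, E) x) : mvfderiv 𝓘(ℝ, E) ψ x v = 0 := by
  have h1 : ψ =ᶠ[𝓝 x] fun _ ↦ 0 := notMem_tsupport_iff_eventuallyEq.1 hx
  have h2 : mvfderiv 𝓘(ℝ, E) ψ x = 0 := by
    rw [mvfderiv, h1.mfderiv_eq]
    exact mvfderiv_const _
  rw [h2]
  rfl

lemma testDivergence_eq_zero {ψ : M → ℝ} {x : M} (hx : x ∉ tsupport ψ) :
    testDivergence V S ψ x = 0 := by
  rw [testDivergence, mvfderiv_eq_zero_of_notMem_tsupport hx,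
    image_eq_zero_of_notMem_tsupport hx]
  simp

lemma IsEigenDivergence.half_eq (hVS : IsEigenDivergence ι a f V S)
    (he : IsEigenframeOn a f e μ N)
    (ha : ∀ (x : M) (v w : TangentSpace 𝓘(ℝ, E) x), a x v w = a x w v) (hcod : IsCodazzi a)
    {x : M} (hx : x ∈ N) :
    S x / 2 = ∑ j, (mvfderiv 𝓘(ℝ, E) (meanCoeff e j) x (e j x) - meanCoeff e j x ^ 2) := by
  have h := he.divergence_eq hx ha hcod
  rw [← (hVS e μ N he x hx).2] at h
  rw [Finset.sum_sub_distrib]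
  linarith

lemma IsEigenDivergence.testDivergence_eq (hVS : IsEigenDivergence ι a f V S)
    (he : IsEigenframeOn a f e μ N)
    (ha : ∀ (x : M) (v w : TangentSpace 𝓘(ℝ, E) x), a x v w = a x w v) (hcod : IsCodazzi a)
    (ψ : M → ℝ) {x : M} (hx : x ∈ N) :
    testDivergence V S ψ x = ∑ j, (meanCoeff e j x * mvfderiv 𝓘(ℝ, E) ψ x (e j x) +
      ψ x * (mvfderiv 𝓘(ℝ, E) (meanCoeff e j) x (e j x) - meanCoeff e j x ^ 2)) := by
  rw [testDivergence, hVS.half_eq he ha hcod hx, (hVS e μ N he x hx).1, map_sum, Finset.mul_sum,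
    ← Finset.sum_add_distrib]
  refine Finset.sum_congr rfl fun j _ ↦ ?_
  rw [map_smul, smul_eq_mul]

lemma IsOrthonormalFrameOn.contMDiffAt_mvfderiv_frame (he : IsOrthonormalFrameOn e N) {x : M}
    (hx : x ∈ N) {g : M → ℝ} (hg : CMDiffAt ∞ g x) (j : ι) :
    CMDiffAt ∞ (fun y ↦ mvfderiv 𝓘(ℝ, E) g y (e j y)) x :=
  contMDiffAt_mvfderiv_apply hg (he.contMDiffAt j x hx) (he.contMDiffAt j x hx)
    (by
      filter_upwards [he.isOpen.mem_nhds hx] with y hy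
      simpa using he.inner_eq hy j j)

lemma IsEigenDivergence.continuous_testDivergence (hVS : IsEigenDivergence ι a f V S)
    (ha : ∀ (x : M) (v w : TangentSpace 𝓘(ℝ, E) x), a x v w = a x w v) (hcod : IsCodazzi a)
    {ψ : M → ℝ} (hψ : CMDiff ∞ ψ)
    (hU : ∀ x ∈ tsupport ψ, ∃ (e : ι → Π x : M, TangentSpace 𝓘(ℝ, E) x) (μ : ι → M → ℝ)
      (N : Set M), x ∈ N ∧ IsEigenframeOn a f e μ N) :
    Continuous (testDivergence V S ψ) := by
  rw [continuous_iff_continuousAt]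
  intro x
  by_cases hx : x ∈ tsupport ψ
  · obtain ⟨e, μ, N, hxN, he⟩ := hU x hx
    have h : ContinuousAt (fun x ↦ ∑ j, (meanCoeff e j x * mvfderiv 𝓘(ℝ, E) ψ x (e j x) +
      ψ x * (mvfderiv 𝓘(ℝ, E) (meanCoeff e j) x (e j x) - meanCoeff e j x ^ 2))) x := by
      refine tendsto_finsetSum _ fun j _ ↦ ?_
      have h1 := he.contMDiffAt_meanCoeff hxN j
      have h2 := (he.contMDiffAt_mvfderiv_frame hxN (hψ x) j).continuousAt
      have h3 := (he.contMDiffAt_mvfderiv_frame hxN h1 j).continuousAt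
      exact (h1.continuousAt.mul h2).add (hψ.continuous.continuousAt.mul
        (h3.sub (h1.continuousAt.pow 2)))
    refine h.congr ?_
    filter_upwards [he.isOpen.mem_nhds hxN] with y hy
    exact (hVS.testDivergence_eq he ha hcod ψ hy).symm
  · refine (continuousAt_const (y := (0 : ℝ))).congr ?_
    filter_upwards [(isClosed_tsupport ψ).isOpen_compl.mem_nhds hx] with y hy
    exact (testDivergence_eq_zero hy).symm

variable {c : Module.Basis ι ℝ E} {p : M} [MeasurableSpace E] [BorelSpace E] {ν : Measure E}
  [ν.IsAddHaarMeasure]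

/-- On a single frame `ψ V` is the sum of the fields `w j e j` with `w j = ψ * meanCoeff e j`, and
`chartIntegral_divergence` applies to each. The `w j` are smooth on all of `M` because `ψ` vanishes
near every point off its support. -/
lemma IsEigenDivergence.chartIntegral_testDivergence [CompactSpace M]
    (hVS : IsEigenDivergence ι a f V S) (he : IsEigenframeOn a f e μ N)
    (ha : ∀ (x : M) (v w : TangentSpace 𝓘(ℝ, E) x), a x v w = a x w v) (hcod : IsCodazzi a)
    {ψ : M → ℝ} (hψ : CMDiff ∞ ψ) (hN : tsupport ψ ⊆ N)
    (hp : tsupport ψ ⊆ (extChartAt 𝓘(ℝ, E) p).source) :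
    chartIntegral c ν p (testDivergence V S ψ) = 0 := by
  let w : ι → M → ℝ := fun j x ↦ ψ x * meanCoeff e j x
  have hsub : ∀ j, tsupport (w j) ⊆ tsupport ψ := fun j ↦
    tsupport_mul_subset_left (f := ψ) (g := meanCoeff e j)
  have hw : ∀ j, CMDiff ∞ (w j) := by
    intro j x
    by_cases hx : x ∈ tsupport ψ
    · exact (hψ x).mul (he.contMDiffAt_meanCoeff (hN hx) j)
    · have : w j =ᶠ[𝓝 x] fun _ ↦ 0 := notMem_tsupport_iff_eventuallyEq.1 fun h ↦ hx (hsub j h)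
      exact contMDiffAt_const.congr_of_eventuallyEq this
  have hzero : ∀ j, ∀ x ∉ tsupport ψ,
      mvfderiv 𝓘(ℝ, E) (w j) x (e j x) - w j x * meanCoeff e j x = 0 := by
    intro j x hx
    have hx' : x ∉ tsupport (w j) := fun h ↦ hx (hsub j h)
    rw [mvfderiv_eq_zero_of_notMem_tsupport hx', image_eq_zero_of_notMem_tsupport hx']
    simp
  have hsum : testDivergence V S ψ =
      fun x ↦ ∑ j, (mvfderiv 𝓘(ℝ, E) (w j) x (e j x) - w j x * meanCoeff e j x) := by
    funext x
    by_cases hx : x ∈ tsupport ψ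
    · rw [hVS.testDivergence_eq he ha hcod ψ (hN hx)]
      refine Finset.sum_congr rfl fun j _ ↦ ?_
      have h1 : mvfderiv 𝓘(ℝ, E) (w j) x (e j x) =
          ψ x * mvfderiv 𝓘(ℝ, E) (meanCoeff e j) x (e j x) +
            meanCoeff e j x * mvfderiv 𝓘(ℝ, E) ψ x (e j x) := by
        have := mvfderiv_fun_mul ((hψ x).mdifferentiableAt (by simp))
          ((he.contMDiffAt_meanCoeff (hN hx) j).mdifferentiableAt (by simp))
        exact congrArg (fun T ↦ T (e j x)) this
      rw [h1]
      ring
    · rw [testDivergence_eq_zero hx, Finset.sum_eq_zero fun j _ ↦ hzero j x hx]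
  have hts : ∀ j, tsupport (fun x ↦ mvfderiv 𝓘(ℝ, E) (w j) x (e j x) - w j x * meanCoeff e j x) ⊆
      tsupport ψ := fun j ↦ closure_minimal (fun x hx ↦ by
        by_contra h
        exact hx (hzero j x h)) (isClosed_tsupport ψ)
  have hcont : ∀ j, Continuous fun x ↦
      mvfderiv 𝓘(ℝ, E) (w j) x (e j x) - w j x * meanCoeff e j x := by
    intro j
    rw [continuous_iff_continuousAt]
    intro x
    by_cases hx : x ∈ tsupport ψ
    · exact (he.contMDiffAt_mvfderiv_frame (hN hx) (hw j x) j).continuousAt.sub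
        ((hw j).continuous.continuousAt.mul (he.contMDiffAt_meanCoeff (hN hx) j).continuousAt)
    · refine (continuousAt_const (y := (0 : ℝ))).congr ?_
      filter_upwards [(isClosed_tsupport ψ).isOpen_compl.mem_nhds hx] with y hy
      exact (hzero j y hy).symm
  rw [hsum, chartIntegral_sum _ (fun j _ ↦ hcont j) (fun j _ ↦ (isClosed_tsupport _).isCompact)
    fun j _ ↦ (hts j).trans hp]
  exact Finset.sum_eq_zero fun j _ ↦ chartIntegral_divergence he.toIsOrthonormalFrameOn (hw j)
    (isClosed_tsupport _).isCompact ((hsub j).trans hN) ((hsub j).trans hp) j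

/-- The integral of the divergence of `ψ V` vanishes. -/
theorem IsEigenDivergence.functional_testDivergence [CompactSpace M] [T2Space M]
    (hVS : IsEigenDivergence ι a f V S)
    (ha : ∀ (x : M) (v w : TangentSpace 𝓘(ℝ, E) x), a x v w = a x w v) (hcod : IsCodazzi a)
    {J : C(M, ℝ) →ₗ[ℝ] ℝ}
    (hJ : ∀ (p : M) (g : C(M, ℝ)), tsupport g ⊆ (extChartAt 𝓘(ℝ, E) p).source →
        J g = chartIntegral c ν p g)
    {ψ : M → ℝ} (hψ : CMDiff ∞ ψ)
    (hU : ∀ x ∈ tsupport ψ, ∃ (e : ι → Π x : M, TangentSpace 𝓘(ℝ, E) x) (μ : ι → M → ℝ)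
      (N : Set M), x ∈ N ∧ IsEigenframeOn a f e μ N) :
    J ⟨testDivergence V S ψ, hVS.continuous_testDivergence ha hcod hψ hU⟩ = 0 := by
  have hU₂ := hU
  choose! e μ N hN he using hU₂
  let W : tsupport ψ → Set M := fun x ↦ N x ∩ (extChartAt 𝓘(ℝ, E) (x : M)).source
  have hWo : ∀ x, IsOpen (W x) := fun x ↦ (he x x.2).isOpen.inter (isOpen_extChartAt_source _)
  obtain ⟨t, ht⟩ := (isClosed_tsupport ψ).isCompact.elim_finite_subcover W hWo fun x hx ↦
    Set.mem_iUnion.2 ⟨⟨x, hx⟩, hN x hx, mem_extChartAt_source x⟩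
  -- `ψ` is cut into smooth pieces, each supported in the domain of one eigenframe and of one chart;
  -- `testDivergence` is additive in `ψ`.
  obtain ⟨ρ, hρ⟩ := SmoothPartitionOfUnity.exists_isSubordinate 𝓘(ℝ, E) (isClosed_tsupport ψ)
    (fun x : t ↦ W x) (fun x ↦ hWo x) (fun x hx ↦ by simpa using ht hx)
  let φ : t → M → ℝ := fun i x ↦ ρ i x * ψ x
  have hφ : ∀ i, CMDiff ∞ (φ i) := fun i ↦ ((ρ i).contMDiff).mul hψ
  have hφs : ∀ i, tsupport (φ i) ⊆ tsupport ψ := fun i ↦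
    tsupport_mul_subset_right (f := ρ i) (g := ψ)
  have hφW : ∀ i, tsupport (φ i) ⊆ W i := fun i ↦
    (tsupport_mul_subset_left (f := ρ i) (g := ψ)).trans (hρ i)
  have hsum : ∀ x, ψ x = ∑ i, φ i x := by
    intro x
    by_cases hx : x ∈ tsupport ψ
    · have := ρ.sum_eq_one hx
      rw [finsum_eq_sum_of_fintype] at this
      rw [← Finset.sum_mul, this, one_mul]
    · rw [image_eq_zero_of_notMem_tsupport hx]
      refine (Finset.sum_eq_zero fun i _ ↦ ?_).symm
      exact image_eq_zero_of_notMem_tsupport fun h ↦ hx (hφs i h)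
  have hU' : ∀ i, ∀ x ∈ tsupport (φ i), ∃ (e : ι → Π x : M, TangentSpace 𝓘(ℝ, E) x)
      (μ : ι → M → ℝ) (N : Set M), x ∈ N ∧ IsEigenframeOn a f e μ N := fun i x hx ↦
    ⟨e x, μ x, N x, hN x (hφs i hx), he x (hφs i hx)⟩
  have hcont := fun i ↦ hVS.continuous_testDivergence ha hcod (hφ i) (hU' i)
  have htd : ∀ x, testDivergence V S ψ x = ∑ i, testDivergence V S (φ i) x := by
    intro x
    have h1 : mvfderiv 𝓘(ℝ, E) ψ x (V x) = ∑ i, mvfderiv 𝓘(ℝ, E) (φ i) x (V x) := by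
      rw [← IsOrthonormalFrameOn.mvfderiv_fun_sum _
        fun i ↦ (hφ i x).mdifferentiableAt (by simp), ← funext hsum]
    simp only [testDivergence]
    rw [h1, Finset.sum_add_distrib, ← Finset.sum_mul, ← hsum]
  have hfun : (⟨testDivergence V S ψ, hVS.continuous_testDivergence ha hcod hψ
      fun x hx ↦ ⟨e x, μ x, N x, hN x hx, he x hx⟩⟩ : C(M, ℝ)) =
      ∑ i, ⟨testDivergence V S (φ i), hcont i⟩ := by
    ext x
    rw [ContinuousMap.sum_apply]
    exact htd x
  refine (congrArg J hfun).trans ?_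
  rw [map_sum]
  refine Finset.sum_eq_zero fun i _ ↦ ?_
  have hts : tsupport (testDivergence V S (φ i)) ⊆ tsupport (φ i) :=
    closure_minimal (fun x hx ↦ by
      by_contra h
      exact hx (testDivergence_eq_zero h)) (isClosed_tsupport _)
  rw [hJ (i : tsupport ψ) _ (hts.trans ((hφW i).trans Set.inter_subset_right))]
  exact hVS.chartIntegral_testDivergence (he _ (i : tsupport ψ).2) ha hcod (hφ i)
    ((hφW i).trans Set.inter_subset_left) ((hφW i).trans Set.inter_subset_right)

end

end RiemannianGeometry

/-! ### Root bounds from Laguerre's inequality, and the logarithmic cutoff -/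

namespace RiemannianGeometry

noncomputable section

set_option linter.unusedSectionVars false

section RootBounds

open Polynomial

variable {ι : Type*} [Fintype ι] [DecidableEq ι] [Nonempty ι]

lemma injective_of_eval_derivative_nodalPoly_ne_zero {μ : ι → ℝ}
    (h : ∀ j, (derivative (nodalPoly μ)).eval (μ j) ≠ 0) : Function.Injective μ := by
  intro i j hij
  by_contra hne
  refine h i ?_
  rw [eval_derivative_nodalPoly]
  exact Finset.prod_eq_zero (Finset.mem_erase.2 ⟨Ne.symm hne, Finset.mem_univ j⟩)
    (sub_eq_zero.2 hij)

/-- If `Q - s` has only real roots for `s = α` and for `s = β`, then its roots are simple for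
`α < s < β`, with bounds on the second derivative of `Q` there. -/
lemma nodalPoly_root_bounds {Q : ℝ[X]} {α β s : ℝ} {κ τ μ : ι → ℝ} (hα : Q - C α = nodalPoly κ)
    (hβ : Q - C β = nodalPoly τ) (hs : Q - C s = nodalPoly μ) (h1 : α < s) (h2 : s < β) :
    Function.Injective μ ∧ ∀ j,
      -(1 / (2 * (β - s))) ≤ (derivative (derivative (nodalPoly μ))).eval (μ j) /
        (2 * (derivative (nodalPoly μ)).eval (μ j) ^ 2) ∧
      (derivative (derivative (nodalPoly μ))).eval (μ j) /
        (2 * (derivative (nodalPoly μ)).eval (μ j) ^ 2) ≤ 1 / (2 * (s - α)) := by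
  have hQ : ∀ j, Q.eval (μ j) = s := fun j ↦ by
    have := congrArg (eval (μ j)) hs
    rw [eval_nodalPoly, eval_sub, eval_C, sub_eq_zero] at this
    exact this
  have hd : ∀ r (ξ : ι → ℝ), Q - C r = nodalPoly ξ → derivative (nodalPoly ξ) = derivative Q := by
    rintro r ξ h
    rw [← h, derivative_sub, derivative_C, sub_zero]
  -- Laguerre's inequality for `Q - r`, evaluated at a root of `Q - s`: there `Q - r` has the value
  -- `s - r`, and subtracting a constant leaves the derivatives of `Q` unchanged.
  have hlag : ∀ r (ξ : ι → ℝ), Q - C r = nodalPoly ξ → s ≠ r → ∀ j,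
      (s - r) * (derivative (derivative Q)).eval (μ j) < (derivative Q).eval (μ j) ^ 2 := by
    intro r ξ h hr j
    have he : (nodalPoly ξ).eval (μ j) = s - r := by rw [← h, eval_sub, eval_C, hQ]
    have := laguerre_nodalPoly ξ (t := μ j) (by rw [he]; exact sub_ne_zero.2 hr)
    rwa [he, hd r ξ h] at this
  have hA := hlag α κ hα h1.ne'
  have hB := hlag β τ hβ h2.ne
  have hp : 0 < s - α := sub_pos.2 h1
  have hq : 0 < β - s := sub_pos.2 h2
  -- If the first derivative vanished, the inequalities for `α` and for `β` would make the second
  -- derivative both negative and positive.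
  have hne : ∀ j, (derivative Q).eval (μ j) ≠ 0 := by
    intro j h0
    have h3 := hA j
    have h4 := hB j
    rw [h0] at h3 h4
    nlinarith
  rw [hd s μ hs]
  refine ⟨injective_of_eval_derivative_nodalPoly_ne_zero fun j ↦ by rw [hd s μ hs]; exact hne j,
    fun j ↦ ?_⟩
  have hpos : 0 < (derivative Q).eval (μ j) ^ 2 := by have := hne j; positivity
  constructor
  · rw [← neg_div, div_le_div_iff₀ (by positivity) (by positivity)]
    nlinarith [hB j]
  · rw [div_le_div_iff₀ (by positivity) (by positivity)]
    nlinarith [hA j]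

end RootBounds

section Cutoff

open Real

/-- A smooth cutoff function vanishing near the nonpositive half-line, equal to one on `[1, ∞)`,
whose logarithmic derivative is of size `ε`. -/
def logCutoff (ε t : ℝ) : ℝ := if t ≤ 0 then 0 else smoothTransition (1 + ε * log t)

lemma logCutoff_of_pos {ε t : ℝ} (ht : 0 < t) :
    logCutoff ε t = smoothTransition (1 + ε * log t) := if_neg ht.not_ge

lemma logCutoff_eq_zero {ε t : ℝ} (hε : 0 < ε) (ht : t ≤ exp (-ε⁻¹)) : logCutoff ε t = 0 := by
  rcases le_or_gt t 0 with h | h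
  · exact if_pos h
  · rw [logCutoff_of_pos h]
    refine smoothTransition.zero_of_nonpos ?_
    have h1 : log t ≤ -ε⁻¹ := (log_le_iff_le_exp h).2 ht
    have h2 : ε * log t ≤ ε * -ε⁻¹ := by gcongr
    rw [mul_neg, mul_inv_cancel₀ hε.ne'] at h2
    linarith

lemma logCutoff_nonneg (ε t : ℝ) : 0 ≤ logCutoff ε t := by
  unfold logCutoff
  split_ifs
  · exact le_rfl
  · exact smoothTransition.nonneg _

lemma logCutoff_le_one (ε t : ℝ) : logCutoff ε t ≤ 1 := by
  unfold logCutoff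
  split_ifs
  · exact zero_le_one
  · exact smoothTransition.le_one _

/-- For `t ≤ 1` the logarithm is nonpositive, and for `t > 1` the cutoff with the smaller parameter
equals one. The cutoffs thus grow as the parameter tends to zero, which lets a fixed one be compared
with all later ones. -/
lemma logCutoff_anti {ε ε' t : ℝ} (h : ε ≤ ε') (hε : 0 ≤ ε) : logCutoff ε' t ≤ logCutoff ε t := by
  rcases le_or_gt t 0 with ht | ht
  · simp [logCutoff, ht]
  rw [logCutoff_of_pos ht, logCutoff_of_pos ht]
  rcases le_or_gt t 1 with h1 | h1
  · refine smoothTransition.monotone ?_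
    have := log_nonpos ht.le h1
    nlinarith
  · have := log_pos h1
    rw [smoothTransition.one_of_one_le (x := 1 + ε * log t) (by nlinarith)]
    exact smoothTransition.le_one _

lemma exists_logCutoff_pos {t : ℝ} (ht : 0 < t) : ∃ ε₀ > 0, ∀ ε ∈ Set.Ioc 0 ε₀, 0 < logCutoff ε t := by
  refine ⟨(|log t| + 1)⁻¹, by positivity, fun ε hε ↦ ?_⟩
  rw [logCutoff_of_pos ht]
  refine smoothTransition.pos_of_pos ?_
  have h1 : ε * (|log t| + 1) ≤ 1 := by
    have := hε.2
    rwa [le_inv_comm₀ hε.1 (by positivity), ← one_div, le_div_iff₀ hε.1, mul_comm] at this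
  have h2 := neg_abs_le (log t)
  nlinarith [hε.1]

lemma contDiff_logCutoff {ε : ℝ} (hε : 0 < ε) : ContDiff ℝ ∞ (logCutoff ε) := by
  rw [contDiff_iff_contDiffAt]
  intro t
  rcases le_or_gt t 0 with ht | ht
  · refine (contDiffAt_const (c := (0 : ℝ))).congr_of_eventuallyEq ?_
    filter_upwards [Iio_mem_nhds (ht.trans_lt (exp_pos (-ε⁻¹)))] with s hs
    exact logCutoff_eq_zero hε (le_of_lt hs)
  · have h1 : ContDiffAt ℝ ∞ (fun s ↦ smoothTransition (1 + ε * log s)) t :=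
      smoothTransition.contDiff.contDiffAt.comp t
        (contDiffAt_const.add (contDiffAt_const.mul (contDiffAt_log.2 ht.ne')))
    refine h1.congr_of_eventuallyEq ?_
    filter_upwards [Ioi_mem_nhds ht] with s hs
    exact logCutoff_of_pos hs

/-- The operator `t d/dt` turns a function of `ε * log t` into `ε` times its derivative, and the
derivative of the transition function is bounded. Hence `C` does not depend on `ε`. -/
lemma exists_mul_deriv_logCutoff_le : ∃ C, 0 ≤ C ∧ ∀ ε > 0, ∀ t > 0,
    0 ≤ deriv (logCutoff ε) t ∧ t * deriv (logCutoff ε) t ≤ C * ε := by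
  have hcd : ContDiff ℝ 1 smoothTransition := smoothTransition.contDiff
  have hd : Continuous (deriv smoothTransition) := hcd.continuous_deriv le_rfl
  obtain ⟨C, hC⟩ := (isCompact_Icc (a := (-1 : ℝ)) (b := 2)).exists_bound_of_continuousOn hd.continuousOn
  have hbound : ∀ s, deriv smoothTransition s ≤ max C 0 := by
    intro s
    by_cases hs : s ∈ Set.Icc (-1 : ℝ) 2
    · exact ((le_abs_self _).trans (hC s hs)).trans (le_max_left _ _)
    · refine le_trans (le_of_eq ?_) (le_max_right _ _)
      rw [Set.mem_Icc, not_and_or, not_le, not_le] at hs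
      rcases hs with hs | hs
      · have : smoothTransition =ᶠ[𝓝 s] fun _ ↦ 0 := by
          filter_upwards [Iio_mem_nhds hs] with r hr
          exact smoothTransition.zero_of_nonpos (by linarith [Set.mem_Iio.1 hr])
        rw [this.deriv_eq, deriv_const]
      · have : smoothTransition =ᶠ[𝓝 s] fun _ ↦ 1 := by
          filter_upwards [Ioi_mem_nhds hs] with r hr
          exact smoothTransition.one_of_one_le (by linarith [Set.mem_Ioi.1 hr])
        rw [this.deriv_eq, deriv_const]
  refine ⟨max C 0, le_max_right _ _, fun ε hε t ht ↦ ?_⟩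
  have hder : deriv (logCutoff ε) t = deriv smoothTransition (1 + ε * log t) * (ε * t⁻¹) := by
    have h1 : logCutoff ε =ᶠ[𝓝 t] fun s ↦ smoothTransition (1 + ε * log s) := by
      filter_upwards [Ioi_mem_nhds ht] with s hs
      exact logCutoff_of_pos hs
    rw [h1.deriv_eq]
    have h2 : HasDerivAt (fun s ↦ 1 + ε * log s) (ε * t⁻¹) t :=
      ((hasDerivAt_log ht.ne').const_mul ε).const_add 1
    exact ((hcd.differentiable (by simp) _).hasDerivAt.comp t h2).deriv
  rw [hder]
  constructor
  · have : 0 ≤ deriv smoothTransition (1 + ε * log t) := smoothTransition.monotone.deriv_nonneg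
    positivity
  · have h1 : t * (deriv smoothTransition (1 + ε * log t) * (ε * t⁻¹)) =
        deriv smoothTransition (1 + ε * log t) * ε := by field_simp
    rw [h1]
    gcongr
    exact hbound _

end Cutoff

end

end RiemannianGeometry

/-! ### Cutoffs of the values of `f` and the estimate of their gradient term -/

namespace RiemannianGeometry

noncomputable section

set_option linter.unusedSectionVars false

open MeasureTheory Polynomial

variable {E : Type*} [NormedAddCommGroup E] [NormedSpace ℝ E] [FiniteDimensional ℝ E]
  [CompleteSpace E]
  {M : Type*} [TopologicalSpace M] [ChartedSpace E M] [IsManifold 𝓘(ℝ, E) ∞ M]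
  [RiemannianBundle (fun x : M ↦ TangentSpace 𝓘(ℝ, E) x)]
  [IsContMDiffRiemannianBundle 𝓘(ℝ, E) ∞ E (fun x : M ↦ TangentSpace 𝓘(ℝ, E) x)]
  {ι : Type*} [Fintype ι] [DecidableEq ι]
  {e : ι → Π x : M, TangentSpace 𝓘(ℝ, E) x} {N : Set M} {μ : ι → M → ℝ}
  {a : Π x : M, TangentSpace 𝓘(ℝ, E) x →L[ℝ] TangentSpace 𝓘(ℝ, E) x →L[ℝ] ℝ} {f : M → ℝ}
  {V : Π x : M, TangentSpace 𝓘(ℝ, E) x} {S : M → ℝ}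

lemma IsEigenDivergence.continuous_mul_half (hVS : IsEigenDivergence ι a f V S)
    (ha : ∀ (x : M) (v w : TangentSpace 𝓘(ℝ, E) x), a x v w = a x w v) (hcod : IsCodazzi a)
    {ψ : M → ℝ} (hψ : Continuous ψ)
    (hU : ∀ x ∈ tsupport ψ, ∃ (e : ι → Π x : M, TangentSpace 𝓘(ℝ, E) x) (μ : ι → M → ℝ)
      (N : Set M), x ∈ N ∧ IsEigenframeOn a f e μ N) :
    Continuous fun x ↦ ψ x * (S x / 2) := by
  rw [continuous_iff_continuousAt]
  intro x
  by_cases hx : x ∈ tsupport ψ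
  · obtain ⟨e, μ, N, hxN, he⟩ := hU x hx
    have h : ContinuousAt (fun x ↦ ψ x *
        ∑ j, (mvfderiv 𝓘(ℝ, E) (meanCoeff e j) x (e j x) - meanCoeff e j x ^ 2)) x := by
      refine hψ.continuousAt.mul (tendsto_finsetSum _ fun j _ ↦ ?_)
      have h1 := he.contMDiffAt_meanCoeff hxN j
      have h3 := (he.contMDiffAt_mvfderiv_frame hxN h1 j).continuousAt
      exact h3.sub (h1.continuousAt.pow 2)
    refine h.congr ?_
    filter_upwards [he.isOpen.mem_nhds hxN] with y hy
    rw [hVS.half_eq he ha hcod hy]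
  · refine (continuousAt_const (y := (0 : ℝ))).congr ?_
    filter_upwards [(isClosed_tsupport ψ).isOpen_compl.mem_nhds hx] with y hy
    rw [image_eq_zero_of_notMem_tsupport hy, zero_mul]

lemma exists_forall_eq_of_mvfderiv_eq_zero [ConnectedSpace M] (hf : CMDiff ∞ f)
    (h : ∀ (x : M) (v : TangentSpace 𝓘(ℝ, E) x), mvfderiv 𝓘(ℝ, E) f x v = 0) :
    ∃ c, ∀ x, f x = c := by
  have hloc : IsLocallyConstant f := by
    rw [IsLocallyConstant.iff_eventually_eq]
    intro p
    have hdiff : ∀ z ∈ (extChartAt 𝓘(ℝ, E) p).target, ContDiffAt ℝ ∞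
        (fun y ↦ f ((extChartAt 𝓘(ℝ, E) p).symm y)) z := fun z hz ↦
      ((hf _).comp _ (contMDiffAt_extChartAt_symm_of_mem hz)).contDiffAt
    have hzero : (extChartAt 𝓘(ℝ, E) p).target.EqOn
        (fderiv ℝ fun y ↦ f ((extChartAt 𝓘(ℝ, E) p).symm y)) 0 := by
      intro z hz
      have hψ := (contMDiffAt_extChartAt_symm_of_mem hz).mdifferentiableAt (n := ∞) (by simp)
      have h1 := (((hf _).mdifferentiableAt (by simp)).hasMFDerivAt.comp z hψ.hasMFDerivAt).mfderiv
      rw [mfderiv_eq_fderiv] at h1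
      ext v
      exact (congrArg (fun T ↦ T v) h1).trans (h _ _)
    have hopen := (isOpen_extChartAt_target (I := 𝓘(ℝ, E)) p).isOpen_inter_preimage_of_fderiv_eq_zero
      (fun z hz ↦ ((hdiff z hz).differentiableAt (by simp)).differentiableWithinAt) hzero {f p}
    have hmem := (continuousAt_extChartAt (I := 𝓘(ℝ, E)) p).preimage_mem_nhds
      (hopen.mem_nhds ⟨mem_extChartAt_target p, by simp⟩)
    filter_upwards [hmem, extChartAt_source_mem_nhds (I := 𝓘(ℝ, E)) p] with x hx hxs
    have := hx.2
    simp only [Set.mem_preimage, Set.mem_singleton_iff] at this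
    rwa [(extChartAt 𝓘(ℝ, E) p).left_inv hxs] at this
  obtain ⟨x₀⟩ := (inferInstance : Nonempty M)
  exact ⟨f x₀, fun x ↦ hloc.apply_eq_of_isPreconnected isPreconnected_univ trivial trivial⟩

/-- A cutoff of the values of `f` to the interval `(α, β)`. -/
def bandCutoff (α β ε s : ℝ) : ℝ := logCutoff ε (s - α) * logCutoff ε (β - s)

lemma bandCutoff_nonneg (α β ε s : ℝ) : 0 ≤ bandCutoff α β ε s :=
  mul_nonneg (logCutoff_nonneg _ _) (logCutoff_nonneg _ _)

lemma bandCutoff_anti {α β ε ε' : ℝ} (h : ε ≤ ε') (hε : 0 ≤ ε) (s : ℝ) :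
    bandCutoff α β ε' s ≤ bandCutoff α β ε s :=
  mul_le_mul (logCutoff_anti h hε) (logCutoff_anti h hε) (logCutoff_nonneg _ _)
    (logCutoff_nonneg _ _)

lemma exists_bandCutoff_pos {α β s : ℝ} (h1 : α < s) (h2 : s < β) :
    ∃ ε > 0, 0 < bandCutoff α β ε s := by
  obtain ⟨ε₁, h1, h1'⟩ := exists_logCutoff_pos (sub_pos.2 h1)
  obtain ⟨ε₂, h2, h2'⟩ := exists_logCutoff_pos (sub_pos.2 h2)
  exact ⟨min ε₁ ε₂, lt_min h1 h2, mul_pos (h1' _ ⟨lt_min h1 h2, min_le_left _ _⟩)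
    (h2' _ ⟨lt_min h1 h2, min_le_right _ _⟩)⟩

lemma contDiff_bandCutoff (α β : ℝ) {ε : ℝ} (hε : 0 < ε) : ContDiff ℝ ∞ (bandCutoff α β ε) :=
  ((contDiff_logCutoff hε).comp (contDiff_id.sub contDiff_const)).mul
    ((contDiff_logCutoff hε).comp (contDiff_const.sub contDiff_id))

lemma deriv_bandCutoff (α β : ℝ) {ε : ℝ} (hε : 0 < ε) (s : ℝ) :
    deriv (bandCutoff α β ε) s = deriv (logCutoff ε) (s - α) * logCutoff ε (β - s) -
      logCutoff ε (s - α) * deriv (logCutoff ε) (β - s) := by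
  have h : ∀ t, HasDerivAt (logCutoff ε) (deriv (logCutoff ε) t) t := fun t ↦
    ((contDiff_logCutoff hε).differentiable (by simp) t).hasDerivAt
  have h1 : HasDerivAt (fun s ↦ logCutoff ε (s - α)) (deriv (logCutoff ε) (s - α)) s := by
    simpa [Function.comp_def] using (h (s - α)).comp s ((hasDerivAt_id s).sub_const α)
  have h2 : HasDerivAt (fun s ↦ logCutoff ε (β - s)) (-deriv (logCutoff ε) (β - s)) s := by
    simpa [Function.comp_def] using (h (β - s)).comp s ((hasDerivAt_id s).const_sub β)
  have := (h1.mul h2).deriv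
  refine Eq.trans this ?_
  ring

lemma tsupport_bandCutoff_comp_subset (hf : Continuous f) (α β : ℝ) {ε : ℝ} (hε : 0 < ε) :
    tsupport (fun x ↦ bandCutoff α β ε (f x)) ⊆ {x | α < f x ∧ f x < β} := by
  have hcl : IsClosed {x | Real.exp (-ε⁻¹) ≤ f x - α ∧ Real.exp (-ε⁻¹) ≤ β - f x} :=
    (isClosed_le continuous_const (hf.sub continuous_const)).inter
      (isClosed_le continuous_const (continuous_const.sub hf))
  refine (closure_minimal (fun x hx ↦ ?_) hcl).trans fun x hx ↦ ?_
  · by_contra hcon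
    rw [Set.mem_ofPred_eq, not_and_or, not_le, not_le] at hcon
    rcases hcon with h | h
    · exact hx (by simp [bandCutoff, logCutoff_eq_zero hε h.le])
    · exact hx (by simp [bandCutoff, logCutoff_eq_zero hε h.le])
  · have := Real.exp_pos (-ε⁻¹)
    exact ⟨by linarith [hx.1], by linarith [hx.2]⟩

lemma mvfderiv_comp_apply_eq_deriv_mul {g : ℝ → ℝ} (hg : Differentiable ℝ g) {x : M}
    (hf : MDiffAt f x) (v : TangentSpace 𝓘(ℝ, E) x) :
    mvfderiv 𝓘(ℝ, E) (fun y ↦ g (f y)) x v = deriv g (f x) * mvfderiv 𝓘(ℝ, E) f x v := by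
  have h := (((hg (f x)).hasFDerivAt.hasMFDerivAt).comp x hf.hasMFDerivAt).mfderiv
  refine (congrArg (fun T ↦ T v) h).trans ?_
  have h2 := (fderiv ℝ g (f x)).map_smul (mvfderiv 𝓘(ℝ, E) f x v) 1
  rw [smul_eq_mul, mul_one, fderiv_apply_one_eq_deriv, smul_eq_mul, mul_comm] at h2
  exact h2

/-- On the band where `f` avoids its extreme values, the squared differential of `f` is bounded by
the product of the distances to them. -/
lemma exists_sq_mvfderiv_le_mul [CompactSpace M] (hf : CMDiff ∞ f) {α β : ℝ} (hαβ : α < β)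
    (hα : ∀ x, α ≤ f x) (hβ : ∀ x, f x ≤ β) :
    ∃ K, 0 ≤ K ∧ ∀ x, ∀ v : TangentSpace 𝓘(ℝ, E) x,
      mvfderiv 𝓘(ℝ, E) f x v ^ 2 ≤ K * ((f x - α) * (β - f x)) * ‖v‖ ^ 2 := by
  obtain ⟨C₁, hC₁, h1⟩ := exists_sq_mvfderiv_le (E := E) (hf.sub (contMDiff_const (c := α)))
    fun x ↦ sub_nonneg.2 (hα x)
  obtain ⟨C₂, hC₂, h2⟩ := exists_sq_mvfderiv_le (E := E) ((contMDiff_const (c := β)).sub hf)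
    fun x ↦ sub_nonneg.2 (hβ x)
  have hαβ' := sub_pos.2 hαβ
  refine ⟨(C₁ + C₂) / (β - α), by positivity, fun x v ↦ ?_⟩
  have hfx : MDiffAt f x := (hf x).mdifferentiableAt (by simp)
  have e1 := mvfderiv_comp_apply_eq_deriv_mul (g := fun s ↦ s - α) (differentiable_id.sub_const α) hfx v
  have e2 := mvfderiv_comp_apply_eq_deriv_mul (g := fun s ↦ β - s) (differentiable_id.const_sub β) hfx v
  have d1 : deriv (fun s : ℝ ↦ s - α) (f x) = 1 := ((hasDerivAt_id (f x)).sub_const α).deriv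
  have d2 : deriv (fun s : ℝ ↦ β - s) (f x) = -1 := ((hasDerivAt_id (f x)).const_sub β).deriv
  rw [d1, one_mul] at e1
  rw [d2] at e2
  have h1 := (congrArg (· ^ 2) e1).symm.le.trans (h1 x v)
  have h2 := (congrArg (· ^ 2) e2).symm.le.trans (h2 x v)
  have p0 := sub_nonneg.2 (hα x)
  have q0 := sub_nonneg.2 (hβ x)
  set D := mvfderiv 𝓘(ℝ, E) f x v
  simp only [neg_mul, one_mul, neg_sq] at h1 h2
  -- The bounds from `f - α ≥ 0` and `β - f ≥ 0` are weighted with `β - f` and `f - α`; the weights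
  -- add up to `β - α`.
  have h3 : D ^ 2 * (β - α) ≤ (C₁ + C₂) * ((f x - α) * (β - f x)) * ‖v‖ ^ 2 := by
    have := mul_le_mul_of_nonneg_left h1 q0
    have := mul_le_mul_of_nonneg_left h2 p0
    linarith
  rw [div_mul_eq_mul_div, div_mul_eq_mul_div]
  exact (le_div_iff₀ hαβ').2 h3

/-- The elementary estimate behind the logarithmic cutoff. -/
lemma neg_le_cutoff_deriv_mul {p q κ κ' lam lam' c d K L : ℝ} (hp : 0 < p) (hq : 0 < q)
    (hκ : 0 ≤ κ) (hκ1 : κ ≤ 1) (hlam : 0 ≤ lam) (hlam1 : lam ≤ 1) (hκ' : 0 ≤ κ')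
    (hlam' : 0 ≤ lam') (hκL : p * κ' ≤ L) (hlamL : q * lam' ≤ L) (hK : 0 ≤ K) (hd0 : 0 ≤ d)
    (hd : d ≤ K * (p * q)) (hc1 : -(1 / (2 * q)) ≤ c) (hc2 : c ≤ 1 / (2 * p)) :
    -(K * L) ≤ (κ' * lam - κ * lam') * (c * d) := by
  -- The factor `q` in the bound for `d` absorbs the pole `1 / q` of the bound for `c`, leaving a
  -- factor `p`, which `p * κ' ≤ L` absorbs in turn. The other sign is symmetric.
  have key1 : -(K * p) / 2 ≤ c * d := by
    have h1 := mul_le_mul_of_nonneg_right hc1 hd0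
    have h2 := mul_le_mul_of_nonneg_left hd (show 0 ≤ 1 / (2 * q) by positivity)
    have h3 : 1 / (2 * q) * (K * (p * q)) = K * p / 2 := by field_simp
    linarith
  have key2 : c * d ≤ K * q / 2 := by
    have h1 := mul_le_mul_of_nonneg_right hc2 hd0
    have h2 := mul_le_mul_of_nonneg_left hd (show 0 ≤ 1 / (2 * p) by positivity)
    have h3 : 1 / (2 * p) * (K * (p * q)) = K * q / 2 := by field_simp
    linarith
  have hL : 0 ≤ L := (mul_nonneg hp.le hκ').trans hκL
  have a1 := mul_le_mul_of_nonneg_left key1 (mul_nonneg hκ' hlam)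
  have a2 := mul_le_mul_of_nonneg_left key2 (mul_nonneg hκ hlam')
  have b1 : κ' * lam * (K * p / 2) ≤ K * L / 2 := by
    have : K * (p * κ') * lam ≤ K * L * 1  := by gcongr
    linarith
  have b2 : κ * lam' * (K * q / 2) ≤ K * L / 2 := by
    have : K * (q * lam') * κ ≤ K * L * 1  := by gcongr
    linarith
  linarith

end

end RiemannianGeometry

/-! ### Constancy of the determinant -/

namespace RiemannianGeometry

noncomputable section

set_option linter.unusedSectionVars false

open MeasureTheory Polynomial

variable {E : Type*} [NormedAddCommGroup E] [NormedSpace ℝ E] [FiniteDimensional ℝ E]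
  [CompleteSpace E]
  {M : Type*} [TopologicalSpace M] [ChartedSpace E M] [IsManifold 𝓘(ℝ, E) ∞ M]
  [RiemannianBundle (fun x : M ↦ TangentSpace 𝓘(ℝ, E) x)]
  [IsContMDiffRiemannianBundle 𝓘(ℝ, E) ∞ E (fun x : M ↦ TangentSpace 𝓘(ℝ, E) x)]
  {ι : Type*} [Fintype ι] [DecidableEq ι]
  {e : ι → Π x : M, TangentSpace 𝓘(ℝ, E) x} {N : Set M} {μ : ι → M → ℝ}
  {a : Π x : M, TangentSpace 𝓘(ℝ, E) x →L[ℝ] TangentSpace 𝓘(ℝ, E) x →L[ℝ] ℝ} {f : M → ℝ}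
  {V : Π x : M, TangentSpace 𝓘(ℝ, E) x} {S : M → ℝ}

/-- The components of `V` are the derivatives of `f` along the frame times `p''/(2 p'^2)`, so the
left derivative is a sum of squares of these derivatives with bounded weights;
`neg_le_cutoff_deriv_mul` estimates every summand. -/
lemma IsEigenDivergence.neg_le_mvfderiv_bandCutoff [Nonempty ι] (hVS : IsEigenDivergence ι a f V S)
    (he : IsEigenframeOn a f e μ N)
    (ha : ∀ (x : M) (v w : TangentSpace 𝓘(ℝ, E) x), a x v w = a x w v) (hcod : IsCodazzi a)
    {x : M} (hx : x ∈ N) (hfx : MDiffAt f x) {Q : ℝ[X]}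
    (hQ : Q - C (f x) = nodalPoly fun i ↦ μ i x) {α β : ℝ}
    {κ τ : ι → ℝ} (hκ : Q - C α = nodalPoly κ) (hτ : Q - C β = nodalPoly τ)
    (h1 : α < f x) (h2 : f x < β) {K : ℝ} (hK : 0 ≤ K)
    (hgrad : ∀ v : TangentSpace 𝓘(ℝ, E) x,
      mvfderiv 𝓘(ℝ, E) f x v ^ 2 ≤ K * ((f x - α) * (β - f x)) * ‖v‖ ^ 2)
    {ε L : ℝ} (hε : 0 < ε)
    (hL : ∀ t > 0, 0 ≤ deriv (logCutoff ε) t ∧ t * deriv (logCutoff ε) t ≤ L) :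
    -(Fintype.card ι * (K * L)) ≤
      mvfderiv 𝓘(ℝ, E) (fun y ↦ bandCutoff α β ε (f y)) x (V x) := by
  have hp := sub_pos.2 h1
  have hq := sub_pos.2 h2
  obtain ⟨-, hb⟩ := nodalPoly_root_bounds hκ hτ hQ h1 h2
  rw [mvfderiv_comp_apply_eq_deriv_mul
    ((contDiff_bandCutoff α β hε).differentiable (by simp)) hfx, deriv_bandCutoff α β hε,
    (hVS e μ N he x hx).1, map_sum, Finset.mul_sum, ← nsmul_eq_mul, ← Finset.card_univ,
    ← smul_neg]
  refine Finset.card_nsmul_le_sum _ _ _ fun j _ ↦ ?_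
  rw [map_smul, smul_eq_mul, he.meanCoeff_eq hx ha hcod j]
  have hj : ‖e j x‖ = 1 := by
    have := he.inner_eq hx j j
    rw [real_inner_self_eq_norm_sq, if_pos rfl] at this
    exact (pow_eq_one_iff_of_nonneg (norm_nonneg _) two_ne_zero).1 this
  have hd := hgrad (e j x)
  rw [hj, one_pow, mul_one] at hd
  have := neg_le_cutoff_deriv_mul hp hq (logCutoff_nonneg ε (f x - α))
    (logCutoff_le_one ε (f x - α)) (logCutoff_nonneg ε (β - f x)) (logCutoff_le_one ε (β - f x))
    (hL _ hp).1 (hL _ hq).1 (hL _ hp).2 (hL _ hq).2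
    hK (sq_nonneg _) hd (hb j).1 (hb j).2
  linarith

lemma IsEigenframeOn.sq_mvfderiv_mul_gapDefect_nonneg
    (he : IsEigenframeOn a f e μ N) (hcard : 3 ≤ Fintype.card ι) {x : M} (hx : x ∈ N) (j : ι) :
    0 ≤ mvfderiv 𝓘(ℝ, E) f x (e j x) ^ 2 * gapDefect (fun k ↦ μ k x) j :=
  mul_nonneg (sq_nonneg _) (gapDefect_pos (he.injective x hx) hcard j).le

/-- On a closed manifold of nonnegative scalar curvature, the constant term of the characteristic
polynomial of a Codazzi tensor is constant if all the other coefficients are. -/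
theorem exists_forall_eq_of_scalarCurvature_nonneg [CompactSpace M] [T2Space M] [ConnectedSpace M]
    {n : ℕ} (hn : Module.finrank ℝ E = n) (hn3 : 3 ≤ n) (ha_smooth : IsSmoothTensor a)
    (ha : ∀ (x : M) (v w : TangentSpace 𝓘(ℝ, E) x), a x v w = a x w v) (hcod : IsCodazzi a)
    (hR : ∀ x : M, 0 ≤ scalarCurvature 𝓘(ℝ, E) x) (hf : CMDiff ∞ f) {Q : ℝ[X]}
    (hQ : ∀ x, (dualEndo a x).charpoly = Q - C (f x))
    (hν : ∀ x, ∃ ν : Fin n → ℝ, (dualEndo a x).charpoly = nodalPoly ν) : ∃ c, ∀ x, f x = c := by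
  have : Nonempty (Fin n) := ⟨⟨0, by omega⟩⟩
  obtain ⟨xα, -, hα⟩ := isCompact_univ.exists_isMinOn (Set.univ_nonempty (α := M))
    hf.continuous.continuousOn
  obtain ⟨xβ, -, hβ⟩ := isCompact_univ.exists_isMaxOn (Set.univ_nonempty (α := M))
    hf.continuous.continuousOn
  replace hα : ∀ x, f xα ≤ f x := fun x ↦ hα (Set.mem_univ x)
  replace hβ : ∀ x, f x ≤ f xβ := fun x ↦ hβ (Set.mem_univ x)
  rcases (hα xβ).eq_or_lt with heq | hlt
  · exact ⟨f xα, fun x ↦ le_antisymm ((hβ x).trans heq.ge) (hα x)⟩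
  obtain ⟨κ, hκ⟩ := hν xα
  obtain ⟨τ, hτ⟩ := hν xβ
  rw [hQ] at hκ hτ
  set α := f xα
  set β := f xβ
  obtain ⟨K, hK, hgrad⟩ := exists_sq_mvfderiv_le_mul hf hlt hα hβ
  obtain ⟨L, hL0, hL⟩ := exists_mul_deriv_logCutoff_le
  have hframe : ∀ x ∈ {x | α < f x ∧ f x < β}, ∃ (e : Fin n → Π x : M, TangentSpace 𝓘(ℝ, E) x)
      (μ : Fin n → M → ℝ) (N : Set M), x ∈ N ∧ IsEigenframeOn a f e μ N := by
    intro x hx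
    obtain ⟨ν, hνx⟩ := hν x
    exact exists_isEigenframeOn hn (by omega) ha_smooth ha hf hQ
      (nodalPoly_root_bounds hκ hτ ((hQ x).symm.trans hνx) hx.1 hx.2).1 hνx
  have hcard : 3 ≤ Fintype.card (Fin n) := by simpa using hn3
  obtain ⟨V, S, hVS⟩ := exists_isEigenDivergence (ι := Fin n) (f := f) ha hcod
  have hS : ∀ x ∈ {x | α < f x ∧ f x < β}, 0 ≤ S x := by
    intro x hx
    obtain ⟨e, μ, N, hxN, he⟩ := hframe x hx
    rw [(hVS e μ N he x hxN).2]
    exact add_nonneg (hR x) (Finset.sum_nonneg fun j _ ↦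
      he.sq_mvfderiv_mul_gapDefect_nonneg hcard hxN j)
  let : MeasurableSpace E := borel E
  have : BorelSpace E := ⟨rfl⟩
  let c := Module.finBasisOfFinrankEq ℝ E hn
  obtain ⟨J, hJ0, hJpos, hJ⟩ := exists_volumeFunctional M c c.addHaar
  have hψ : ∀ ε > 0, CMDiff ∞ fun x ↦ bandCutoff α β ε (f x) := fun ε hε ↦
    (contDiff_bandCutoff α β hε).contMDiff.comp hf
  have hsupp := fun ε (hε : 0 < ε) ↦ tsupport_bandCutoff_comp_subset hf.continuous α β hε
  -- A cutoff with parameter `ε₀` positive at `f x` is fixed; the integral `J G` of its product with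
  -- `div V` is shown to be nonpositive, although `G ≥ 0`.
  have hzero : ∀ x ∈ {x | α < f x ∧ f x < β}, S x = 0 := by
    intro x hx
    obtain ⟨ε₀, hε₀, hpos⟩ := exists_bandCutoff_pos hx.1 hx.2
    let G : C(M, ℝ) := ⟨_, hVS.continuous_mul_half ha hcod (hψ ε₀ hε₀).continuous
      fun y hy ↦ hframe y (hsupp ε₀ hε₀ hy)⟩
    have hG : ∀ y, G y = bandCutoff α β ε₀ (f y) * (S y / 2) := fun y ↦ rfl
    have hG0 : ∀ y, y ∉ {x | α < f x ∧ f x < β} → G y = 0 := fun y hy ↦ by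
      have : bandCutoff α β ε₀ (f y) = 0 := image_eq_zero_of_notMem_tsupport
        (f := fun x ↦ bandCutoff α β ε₀ (f x)) fun h ↦ hy (hsupp ε₀ hε₀ h)
      rw [hG, this, zero_mul]
    have hGnn : ∀ y, 0 ≤ G y := by
      intro y
      by_cases hy : y ∈ {x | α < f x ∧ f x < β}
      · exact mul_nonneg (bandCutoff_nonneg _ _ _ _) (div_nonneg (hS y hy) zero_le_two)
      · exact (hG0 y hy).ge
    have hle : ∀ ε ∈ Set.Ioc 0 ε₀, J G ≤ ε * (n * (K * L) * J 1) := by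
      intro ε hε
      have hU := fun y hy ↦ hframe y (hsupp ε hε.1 hy)
      have hJz := hVS.functional_testDivergence ha hcod hJ (hψ ε hε.1) hU
      set T : C(M, ℝ) := ⟨_, hVS.continuous_testDivergence ha hcod (hψ ε hε.1) hU⟩ with hT
      have hTy : ∀ y, T y = testDivergence V S (fun x ↦ bandCutoff α β ε (f x)) y := fun y ↦ rfl
      have hBnn : 0 ≤ n * (K * (L * ε)) := by have := hε.1.le; positivity
      -- For `ε ≤ ε₀` the cutoff only increases, so with `S ≥ 0` on the band `G` is dominated by the
      -- part of `div (ψ_ε V)` containing `S`; the gradient part is at least `-n K L ε`. Since `div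
      -- (ψ_ε V)` has integral zero, `J G` is of order `ε`.
      have hmain : ∀ y, 0 ≤ (T + (n * (K * (L * ε))) • (1 : C(M, ℝ)) - G) y := by
        intro y
        rw [ContinuousMap.sub_apply, ContinuousMap.add_apply, ContinuousMap.smul_apply,
          ContinuousMap.one_apply, smul_eq_mul, mul_one, hTy]
        by_cases hy : y ∈ {x | α < f x ∧ f x < β}
        · obtain ⟨e, μ, N, hyN, he⟩ := hframe y hy
          have h1 := hVS.neg_le_mvfderiv_bandCutoff he ha hcod hyN
            ((hf y).mdifferentiableAt (by simp)) ((hQ y).symm.trans (he.charpoly_eq hyN)) hκ hτ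
            hy.1 hy.2 hK (hgrad y) hε.1 (hL ε hε.1)
          rw [Fintype.card_fin] at h1
          have h2 := mul_le_mul_of_nonneg_right (bandCutoff_anti (α := α) (β := β) hε.2 hε.1.le
            (f y)) (div_nonneg (hS y hy) zero_le_two)
          rw [testDivergence, hG]
          linarith
        · rw [hG0 y hy, testDivergence_eq_zero fun h ↦ hy (hsupp ε hε.1 h)]
          linarith
      have h := hJ0 _ hmain
      rw [map_sub, map_add, map_smul, hJz, smul_eq_mul] at h
      linarith
    have hJG : J G ≤ 0 := by
      have hlim : Filter.Tendsto (fun ε : ℝ ↦ ε * (n * (K * L) * J 1)) (𝓝[>] 0) (𝓝 0) := by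
        have h : Continuous fun ε : ℝ ↦ ε * (n * (K * L) * J 1) := by fun_prop
        have := h.tendsto 0
        rw [zero_mul] at this
        exact this.mono_left nhdsWithin_le_nhds
      refine ge_of_tendsto hlim ?_
      filter_upwards [Ioc_mem_nhdsGT hε₀] with ε hε using hle ε hε
    have := hJpos G hGnn hJG x
    rw [hG, mul_eq_zero] at this
    linarith [this.resolve_left hpos.ne']
  -- On the band `S = 0` is a sum of nonnegative terms, and the strict positivity of `gapDefect`
  -- forces each frame derivative of `f` to vanish.
  refine exists_forall_eq_of_mvfderiv_eq_zero hf fun x v ↦ ?_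
  by_cases hx : x ∈ {x | α < f x ∧ f x < β}
  · obtain ⟨e, μ, N, hxN, he⟩ := hframe x hx
    have h1 := hzero x hx
    rw [(hVS e μ N he x hxN).2] at h1
    have hnn := fun j (_ : j ∈ Finset.univ) ↦
      he.sq_mvfderiv_mul_gapDefect_nonneg hcard hxN j
    have h2 : ∑ j, mvfderiv 𝓘(ℝ, E) f x (e j x) ^ 2 * gapDefect (fun k ↦ μ k x) j = 0 :=
      le_antisymm (by linarith [hR x]) (Finset.sum_nonneg hnn)
    rw [Finset.sum_eq_zero_iff_of_nonneg hnn] at h2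
    rw [← he.sum_inner_smul hxN v, map_sum]
    refine Finset.sum_eq_zero fun j hj ↦ ?_
    have h3 := (mul_eq_zero.1 (h2 j hj)).resolve_right
      (gapDefect_pos (he.injective x hxN) hcard j).ne'
    rw [map_smul, pow_eq_zero_iff two_ne_zero |>.1 h3, smul_zero]
  -- Off the band `f` takes one of its extreme values and the gradient bound degenerates to zero.
  · have h : (f x - α) * (β - f x) = 0 := by
      rcases (hα x).eq_or_lt with h1 | h1
      · rw [← h1, sub_self, zero_mul]
      rcases (hβ x).eq_or_lt with h2 | h2
      · rw [h2, sub_self, mul_zero]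
      exact absurd ⟨h1, h2⟩ hx
    have := hgrad x v
    rw [h, mul_zero, zero_mul] at this
    exact pow_eq_zero_iff two_ne_zero |>.1 (le_antisymm this (sq_nonneg _))

end

end RiemannianGeometry

/-! ### Vanishing of the scalar curvature and conclusion -/

namespace RiemannianGeometry

noncomputable section

set_option linter.unusedSectionVars false

open Polynomial

variable {E : Type*} [NormedAddCommGroup E] [NormedSpace ℝ E] [FiniteDimensional ℝ E]
  [CompleteSpace E]
  {H : Type*} [TopologicalSpace H] {I : ModelWithCorners ℝ E H}
  {M : Type*} [TopologicalSpace M] [ChartedSpace H M] [IsManifold I ∞ M]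
  [RiemannianBundle (fun x : M ↦ TangentSpace I x)]
  [IsContMDiffRiemannianBundle I ∞ E (fun x : M ↦ TangentSpace I x)]
  {ι : Type*} [Fintype ι] [DecidableEq ι]
  {a : Π x : M, TangentSpace I x →L[ℝ] TangentSpace I x →L[ℝ] ℝ} {f : M → ℝ}
  {e : ι → Π x : M, TangentSpace I x} {N : Set M} {μ : ι → M → ℝ}

/-- The components of `∑ ∇_{e i} e i` are multiples of derivatives of `f`, so they vanish on all of
`N` and the divergence formula retains only the scalar curvature. -/
lemma IsEigenframeOn.scalarCurvature_eq_zero (he : IsEigenframeOn a f e μ N)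
    (ha : ∀ (x : M) (v w : TangentSpace I x), a x v w = a x w v) (hcod : IsCodazzi a) {c : ℝ}
    (hf : ∀ x, f x = c) {x : M} (hx : x ∈ N) : scalarCurvature I x = 0 := by
  obtain rfl : f = fun _ ↦ c := funext hf
  have hdf : ∀ y (v : TangentSpace I y), mvfderiv I (fun _ : M ↦ c) y v = 0 := fun y v ↦
    congrArg (fun T ↦ T v) (mvfderiv_const (I := I) c (x := y))
  have hmean : ∀ j, ∀ y ∈ N, meanCoeff e j y = 0 := fun j y hy ↦ by
    rw [he.meanCoeff_eq hy ha hcod j, hdf, zero_mul]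
  have hdmean : ∀ j, mvfderiv I (meanCoeff e j) x (e j x) = 0 := by
    intro j
    have h1 : meanCoeff e j =ᶠ[𝓝 x] fun _ ↦ 0 := by
      filter_upwards [he.isOpen.mem_nhds hx] with y hy using hmean j y hy
    have h2 : mvfderiv I (meanCoeff e j) x = 0 := by
      rw [mvfderiv, h1.mfderiv_eq]
      exact mvfderiv_const _
    rw [h2]
    rfl
  have h := he.divergence_eq hx ha hcod
  simp only [hdmean, hmean _ x hx, hdf] at h
  simpa using h.symm

lemma exists_orthonormalBasis_dualEndo {n : ℕ} (hn : Module.finrank ℝ E = n)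
    (ha : ∀ (x : M) (v w : TangentSpace I x), a x v w = a x w v) (x : M) :
    ∃ (b : OrthonormalBasis (Fin n) ℝ (TangentSpace I x)) (ν : Fin n → ℝ),
      ∀ i, dualEndo a x (b i) = ν i • b i :=
  ⟨(isSymmetric_dualEndo ha x).eigenvectorBasis hn, (isSymmetric_dualEndo ha x).eigenvalues hn,
    fun i ↦ (isSymmetric_dualEndo ha x).apply_eigenvectorBasis hn i⟩

lemma roots_nodalPoly (ν : ι → ℝ) : (nodalPoly ν).roots = Finset.univ.val.map ν := by
  have h : nodalPoly ν = ((Finset.univ.val.map ν).map fun r ↦ X - C r).prod := by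
    rw [Multiset.map_map]
    rfl
  rw [h, roots_multiset_prod_X_sub_C]

end

end RiemannianGeometry

open RiemannianGeometry in
theorem theorem1p1 (n : ℕ) (hn : 3 < n)
    (M : Type*) [TopologicalSpace M] [T2Space M] [CompactSpace M] [ConnectedSpace M]
    [ChartedSpace (EuclideanSpace ℝ (Fin n)) M] [IsManifold (𝓡 n) ∞ M]
    [RiemannianBundle (fun x : M ↦ TangentSpace (𝓡 n) x)]
    [IsContMDiffRiemannianBundle (𝓡 n) ∞ (EuclideanSpace ℝ (Fin n))
      (fun x : M ↦ TangentSpace (𝓡 n) x)]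
    (a : Π x : M, TangentSpace (𝓡 n) x →L[ℝ] TangentSpace (𝓡 n) x →L[ℝ] ℝ)
    (ha_smooth : IsSmoothTensor a)
    (ha_symm : ∀ (x : M) (v w : TangentSpace (𝓡 n) x), a x v w = a x w v)
    (hR : ∀ x : M, 0 ≤ scalarCurvature (𝓡 n) x)
    (ha_codazzi : IsCodazzi a)
    (htr : ∀ k ∈ Finset.Icc 1 (n - 1), ∃ c : ℝ, ∀ x : M,
      LinearMap.trace ℝ (TangentSpace (𝓡 n) x) (dualEndo a x ^ k) = c) :
    (∃ c : ℝ, ∀ x : M, LinearMap.trace ℝ (TangentSpace (𝓡 n) x) (dualEndo a x ^ n) = c) ∧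
    (∃ μ : Fin n → ℝ, ∀ x : M,
      (LinearMap.charpoly (dualEndo a x)).roots = Finset.univ.val.map μ) ∧
    ((∃ (x : M) (ν : Fin n → ℝ), Function.Injective ν ∧
        ∀ i, Module.End.HasEigenvalue (dualEndo a x) (ν i)) →
      ∀ x : M, scalarCurvature (𝓡 n) x = 0) := by
  have hfin : Module.finrank ℝ (EuclideanSpace ℝ (Fin n)) = n := by simp
  obtain ⟨x₀⟩ := (inferInstance : Nonempty M)
  choose b ν hν using exists_orthonormalBasis_dualEndo hfin ha_symm
  have hchar := fun x ↦ charpoly_eq_nodalPoly (b x) (hν x)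
  have hcoeff := fun x ↦ coeff_zero_nodalPoly (b x) (hν x)
  -- The reference polynomial `Q` is the characteristic polynomial at `x₀`, so `f` measures the
  -- deviation of the constant term from its value there.
  let f : M → ℝ := fun x ↦ (nodalPoly (ν x₀)).coeff 0 - (nodalPoly (ν x)).coeff 0
  have hQ : ∀ x, (dualEndo a x).charpoly = nodalPoly (ν x₀) - Polynomial.C (f x) := by
    intro x
    have h := nodalPoly_sub_nodalPoly (μ := ν x₀) (ν := ν x) fun k hk ↦ by
      rw [Fintype.card_fin] at hk
      obtain ⟨c, hc⟩ := htr k hk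
      rw [← trace_pow_eq_sum (b x₀) (hν x₀), ← trace_pow_eq_sum (b x) (hν x), hc, hc]
    rw [hchar]
    exact eq_sub_of_add_eq h.symm
  -- The eigenvalues `ν x` are chosen pointwise without any continuity; smoothness of `f` comes from
  -- writing the constant term as a determinant.
  have hf : ContMDiff (𝓡 n) 𝓘(ℝ, ℝ) ∞ f := by
    have h : f = fun x ↦ (nodalPoly (ν x₀)).coeff 0 -
        (-1) ^ n * LinearMap.det (dualEndo a x) := by
      funext x
      have := hcoeff x
      rw [show Module.finrank ℝ (TangentSpace (𝓡 n) x) = n from hfin] at this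
      rw [← this]
    rw [h]
    exact contMDiff_const.sub (contMDiff_const.mul (contMDiff_det_dualEndo ha_smooth))
  obtain ⟨c, hc⟩ := exists_forall_eq_of_scalarCurvature_nonneg hfin hn.le ha_smooth ha_symm
    ha_codazzi hR hf hQ fun x ↦ ⟨ν x, hchar x⟩
  have hroots : ∀ x, Finset.univ.val.map (ν x) = Finset.univ.val.map (ν x₀) := by
    intro x
    rw [← roots_nodalPoly, ← roots_nodalPoly, ← hchar, ← hchar, hQ, hQ, hc, hc]
  refine ⟨⟨∑ i, ν x₀ i ^ n, fun x ↦ ?_⟩, ⟨ν x₀, fun x ↦ ?_⟩, ?_⟩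
  · rw [trace_pow_eq_sum (b x) (hν x)]
    have := congrArg (fun s ↦ (s.map (· ^ n)).sum) (hroots x)
    simp only [Multiset.map_map] at this
    exact this
  · rw [hchar, roots_nodalPoly, hroots]
  -- The characteristic polynomial is the same at all points, so simplicity of the roots at `x₁`
  -- yields an eigenframe around every `x`.
  · rintro ⟨x₁, ν₁, hν₁, hev⟩ x
    have h₁ : (dualEndo a x₁).charpoly = nodalPoly ν₁ :=
      eq_nodalPoly (LinearMap.charpoly_monic _)
        (by rw [LinearMap.charpoly_natDegree, Fintype.card_fin]; exact hfin) hν₁ fun i ↦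
        Module.End.hasEigenvalue_iff_isRoot_charpoly _ _ |>.1 (hev i)
    have h₂ : (dualEndo a x).charpoly = nodalPoly ν₁ := by
      rw [← h₁, hQ, hQ, hc, hc]
    obtain ⟨e, μ, N, hxN, he⟩ :=
      exists_isEigenframeOn hfin (by omega) ha_smooth ha_symm hf hQ hν₁ h₂
    exact he.scalarCurvature_eq_zero ha_symm ha_codazzi hc hxN
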